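/- **Setting.** PILL$_Y$ is the polymorphic dual intuitionistic/linear lambda calculus with types $\sigma ::= \alpha \mid C(\sigma_1,\dots,\sigma_m) \mid I \mid \sigma\otimes\sigma \mid \sigma\multimap\sigma \mid {!}\sigma \mid \prod\alpha.\sigma$ over an arbitrary signature (type constants $C$ with arities, term constants of closed type), with terms $\Xi\mid\Gamma;\Delta\vdash t:\sigma$ ($\Gamma$ intuitionistic, $\Delta$ linear), a fixed point combinator $Y:\prod\alpha.(\alpha\to\alpha)\to\alpha$ where $\sigma\to\tau := {!}\sigma\multimap\tau$, and its usual $\beta$, $\eta$, commutation and fixed point equations (external equality). LAPL (Linear Abadi–Plotkin Logic) is the intuitionistic predicate logic over it, with propositions $t=_\sigma u$ (internal equality, containing external equality), $\rho(t,u)$, connectives, and quantifiers over types, terms, relations $R:\mathrm{Rel}(\sigma,\tau)$ and admissible relations $R:\mathrm{AdmRel}(\sigma,\tau)$, and with a relational interpretation $\sigma[\rho_1,\dots,\rho_n]$ of types $\alpha_1,\dots,\alpha_n\vdash\sigma$ at admissible relations. Closed propositions may be added to LAPL as further axioms. *Extensionality* consists of the schemes $(\forall x{:}\sigma.\ t\,x=_\tau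 u\,x)\supset t=_{\sigma\multimap\tau}u$ and $(\forall\alpha.\ t\,\alpha=_\tau u\,\alpha)\supset t=_{\prod\alpha.\tau}u$; *identity extension* is the scheme $\forall\vec\alpha.\ \sigma[\mathrm{eq}_{\alpha_1},\dots,\mathrm{eq}_{\alpha_n}]\equiv \mathrm{eq}_{\sigma}$ for all types $\alpha_1,\dots,\alpha_n\vdash\sigma$, where $\mathrm{eq}_\sigma$ is the equality relation on $\sigma$. For a kind context $\Xi$, the category $\mathrm{LinType}_\Xi$ has the types over $\Xi$ as objects and, as morphisms $\sigma\to\tau$, the terms $\Xi\mid-;-\vdash f:\sigma\multimap\tau$ modulo provability of $f=_{\sigma\multimap\tau}g$; composition is $f\circ g=\lambda^\circ x.\,f(g\,x)$. A type is *inductively constructed* if it is built from type variables and closed types by $I,\otimes,\multimap,{!},\prod$. If $\alpha\vdash\sigma(\alpha)$ is inductively constructed and $\alpha$ occurs only positively in it, recursion on $\sigma$ gives the usual closed term $M_\sigma:\prod\alpha.\prod\beta.(\alpha\multimap\beta)\to\sigma(\alpha)\multimap\sigma(\beta)$, and one writes $\sigma(f)=M_\sigma\,\tau\,\tau'\,{!}f:\sigma(\tau)\multimap\sigma(\tau')$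 for $f:\tau\multimap\tau'$. A coalgebra is a map $f:\tau\multimap\sigma(\tau)$; a map of coalgebras from $f:\tau\multimap\sigma(\tau)$ to $f':\tau'\multimap\sigma(\tau')$ is an $h:\tau\multimap\tau'$ with $f'\circ h=_{\tau\multimap\sigma(\tau')}\sigma(h)\circ f$ provable. Put $\coprod\alpha.\rho:=\prod\beta.(\prod\alpha.\rho\multimap\beta)\multimap\beta$ and $\mathit{pack}:=\Lambda\alpha.\lambda^\circ x.\Lambda\beta.\lambda^\circ g.\,g\,\alpha\,x$ of type $\prod\alpha.(\rho\multimap\coprod\alpha.\rho)$, and $$\nu\alpha.\sigma(\alpha):=\coprod\alpha.\,{!}(\alpha\multimap\sigma(\alpha))\otimes\alpha,$$ $$\mathit{unfold}:=\Lambda\alpha.\lambda^\circ f{:}{!}(\alpha\multimap\sigma(\alpha)).\lambda^\circ x{:}\alpha.\ \mathit{pack}\,\alpha\,(f\otimes x),\qquad \mathit{out}:=\lambda^\circ x{:}\nu\alpha.\sigma(\alpha).\ x\,\sigma(\nu\alpha.\sigma(\alpha))\,r,$$ $$r:=\Lambda\alpha.\lambda^\circ y{:}{!}(\alpha\multimap\sigma(\alpha))\otimes\alpha.\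 \mathrm{let}\ w\otimes z\ \mathrm{be}\ y\ \mathrm{in}\ \mathrm{let}\ {!}f\ \mathrm{be}\ w\ \mathrm{in}\ \sigma(\mathit{unfold}\,\alpha\,{!}f)(f\,z).$$ **Theorem.** Let $\alpha\vdash\sigma(\alpha)$ be an inductively constructed type in which $\alpha$ occurs only positively, and assume identity extension and extensionality. Then for every kind context $\Xi$, $\mathit{out}:\nu\alpha.\sigma(\alpha)\multimap\sigma(\nu\alpha.\sigma(\alpha))$ is a final coalgebra for $\sigma$ in $\mathrm{LinType}_\Xi$: every coalgebra $\Xi\mid-;-\vdash f:\tau\multimap\sigma(\tau)$ has exactly one morphism of $\mathrm{LinType}_\Xi$ to it that is a map of coalgebras from $f$ to $\mathit{out}$. More precisely, $\mathit{unfold}\,\tau\,{!}f$ is a map of coalgebras from $f$ to $\mathit{out}$, and for every map of coalgebras $\Xi\mid-;-\vdash h:\tau\multimap\nu\alpha.\sigma(\alpha)$ from $f$ to $\mathit{out}$ the equality $h=_{\tau\multimap\nu\alpha.\sigma(\alpha)}\mathit{unfold}\,\tau\,{!}f$ is provable. -/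

import Mathlib

/-!
# Linear Abadi-Plotkin Logic over the calculus PILL_Y

Everything is well scoped, with de Bruijn indices (index `0` is the most recently bound variable).
`Ty S k` : types in a kind context of `k` type variables.
`Tm S k n` : terms in `k` type variables and `n` term variables.
`Form S k n m`, `Rel S k n m` : propositions and definable relations in `k` type variables,
`n` (intuitionistic) term variables and `m` relation variables.
-/

namespace LAPL

universe u v

/-- Extension of a finite sequence (a context or a substitution) by a new entry at index `0`. -/
def cons {A : Type*} {n : ℕ} (a : A) (f : Fin n → A) : Fin (n + 1) → A :=
  fun i => Fin.cases (motive := fun _ => A) a f i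

/-- The empty sequence. -/
def nil {A : Type*} : Fin 0 → A := fun i => Fin.elim0 i

/-- Lifting a renaming under one binder. -/
def liftR {n m : ℕ} (r : Fin n → Fin m) : Fin (n + 1) → Fin (m + 1) :=
  cons 0 (fun i => (r i).succ)

/-- Weakening by `j` newest variables. -/
def up (j : ℕ) {n : ℕ} : Fin n → Fin (n + j) := fun i => i.addNat j

/-! ## Types -/

/-- Polymorphic signatures without their term constants: type constants with arities. -/
structure TySig where
  TyCon : Type u
  arity : TyCon → ℕ

/-- Types `σ ::= α | C(σ₁,…,σₘ) | I | σ ⊗ σ | σ ⊸ σ | !σ | Πα.σ`. -/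
inductive Ty (C : TySig.{u}) : ℕ → Type u
  | var {k : ℕ} (i : Fin k) : Ty C k
  | con {k : ℕ} (c : C.TyCon) (args : Fin (C.arity c) → Ty C k) : Ty C k
  | one {k : ℕ} : Ty C k
  | tensor {k : ℕ} (σ τ : Ty C k) : Ty C k
  | lolli {k : ℕ} (σ τ : Ty C k) : Ty C k
  | bang {k : ℕ} (σ : Ty C k) : Ty C k
  | all {k : ℕ} (σ : Ty C (k + 1)) : Ty C k

namespace Ty

variable {C : TySig.{u}}

/-- Renaming of type variables. -/
def ren : {k : ℕ} → Ty C k → {l : ℕ} → (Fin k → Fin l) → Ty C l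
  | _, var i, _, r => var (r i)
  | _, con c args, _, r => con c (fun i => (args i).ren r)
  | _, one, _, _ => one
  | _, tensor σ τ, _, r => tensor (σ.ren r) (τ.ren r)
  | _, lolli σ τ, _, r => lolli (σ.ren r) (τ.ren r)
  | _, bang σ, _, r => bang (σ.ren r)
  | _, all σ, _, r => all (σ.ren (liftR r))

/-- Lifting a type substitution under one binder. -/
def lift {k l : ℕ} (s : Fin k → Ty C l) : Fin (k + 1) → Ty C (l + 1) :=
  cons (var 0) (fun i => (s i).ren (up 1))

/-- Simultaneous substitution of types for type variables. -/
def sub : {k : ℕ} → Ty C k → {l : ℕ} → (Fin k → Ty C l) → Ty C l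
  | _, var i, _, s => s i
  | _, con c args, _, s => con c (fun i => (args i).sub s)
  | _, one, _, _ => one
  | _, tensor σ τ, _, s => tensor (σ.sub s) (τ.sub s)
  | _, lolli σ τ, _, s => lolli (σ.sub s) (τ.sub s)
  | _, bang σ, _, s => bang (σ.sub s)
  | _, all σ, _, s => all (σ.sub (lift s))

/-- `σ[τ/α]` for the most recent type variable `α`. -/
def inst {k : ℕ} (σ : Ty C (k + 1)) (τ : Ty C k) : Ty C k := σ.sub (cons τ var)

/-- `σ(τ)` for a type `α ⊢ σ(α)` and a type `Ξ ⊢ τ`. -/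
def ap (σ : Ty C 1) {k : ℕ} (τ : Ty C k) : Ty C k := σ.sub (fun _ => τ)

/-- A closed type, in the kind context of `k` variables. -/
def wk0 (σ : Ty C 0) (k : ℕ) : Ty C k := σ.ren nil

/-- `Πα.!(!α ⊸ α) ⊸ α`, the type of the fixed point combinator. -/
def fixTy (k : ℕ) : Ty C k :=
  all (lolli (bang (lolli (bang (var 0)) (var 0))) (var 0))

/-- Inductively constructed types: built from type variables and closed types by the type
constructors `I`, `⊗`, `⊸`, `!` and `Π`. -/
inductive IsInductive : {k : ℕ} → Ty C k → Prop
  | closed {k : ℕ} (σ : Ty C 0) : IsInductive (σ.wk0 k)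
  | var {k : ℕ} (i : Fin k) : IsInductive (Ty.var i)
  | one {k : ℕ} : IsInductive (Ty.one : Ty C k)
  | tensor {k : ℕ} {σ τ : Ty C k} : IsInductive σ → IsInductive τ → IsInductive (Ty.tensor σ τ)
  | lolli {k : ℕ} {σ τ : Ty C k} : IsInductive σ → IsInductive τ → IsInductive (Ty.lolli σ τ)
  | bang {k : ℕ} {σ : Ty C k} : IsInductive σ → IsInductive (Ty.bang σ)
  | all {k : ℕ} {σ : Ty C (k + 1)} : IsInductive σ → IsInductive (Ty.all σ)

/-- `σ.Occurs pos a`: the variable `a` has a positive (`pos = true`), respectively a negative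
(`pos = false`), occurrence in `σ`. Polarity is a notion about inductively constructed types, where
no free variable stands below a type constant; an occurrence there counts as one of both kinds. -/
def Occurs : {k : ℕ} → Ty C k → Bool → Fin k → Prop
  | _, var i, pos, a => pos = true ∧ i = a
  | _, con _ args, _, a => ∃ i, ∃ p : Bool, (args i).Occurs p a
  | _, one, _, _ => False
  | _, tensor σ τ, pos, a => σ.Occurs pos a ∨ τ.Occurs pos a
  | _, lolli σ τ, pos, a => σ.Occurs (!pos) a ∨ τ.Occurs pos a
  | _, bang σ, pos, a => σ.Occurs pos a
  | _, all σ, pos, a => σ.Occurs pos a.succ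

/-- The variable `a` occurs only positively in `σ`. -/
def OnlyPositive {k : ℕ} (σ : Ty C k) (a : Fin k) : Prop := ¬ σ.Occurs false a

end Ty

/-! ## Terms -/

/-- A polymorphic signature: type constants with arities, and term constants with closed types. -/
structure Sig extends TySig.{u} where
  TmCon : Type v
  tmTy : TmCon → Ty toTySig 0

/-- The types over a signature. -/
abbrev Typ (S : Sig.{u, v}) (k : ℕ) : Type u := Ty S.toTySig k

/-- Terms of PILL_Y over a signature. In `letTensor σ τ s t`, that is `let x:σ ⊗ y:τ be s in t`,
the variable `y` has index `0` and `x` has index `1` in `t`. -/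
inductive Tm (S : Sig.{u, v}) : ℕ → ℕ → Type (max u v)
  | var {k n : ℕ} (i : Fin n) : Tm S k n
  | con {k n : ℕ} (c : S.TmCon) : Tm S k n
  | star {k n : ℕ} : Tm S k n
  | Y {k n : ℕ} : Tm S k n
  | lam {k n : ℕ} (σ : Typ S k) (t : Tm S k (n + 1)) : Tm S k n
  | app {k n : ℕ} (t s : Tm S k n) : Tm S k n
  | tensor {k n : ℕ} (t s : Tm S k n) : Tm S k n
  | bang {k n : ℕ} (t : Tm S k n) : Tm S k n
  | tlam {k n : ℕ} (t : Tm S (k + 1) n) : Tm S k n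
  | tapp {k n : ℕ} (t : Tm S k n) (σ : Typ S k) : Tm S k n
  | letTensor {k n : ℕ} (σ τ : Typ S k) (s : Tm S k n) (t : Tm S k (n + 2)) : Tm S k n
  | letBang {k n : ℕ} (σ : Typ S k) (s : Tm S k n) (t : Tm S k (n + 1)) : Tm S k n
  | letStar {k n : ℕ} (t s : Tm S k n) : Tm S k n

namespace Tm

variable {S : Sig.{u, v}}

/-- Simultaneous renaming of type and term variables. -/
def ren : {k n : ℕ} → Tm S k n → {l m : ℕ} → (Fin k → Fin l) → (Fin n → Fin m) → Tm S l m
  | _, _, var i, _, _, _, r => var (r i)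
  | _, _, con c, _, _, _, _ => con c
  | _, _, star, _, _, _, _ => star
  | _, _, Y, _, _, _, _ => Y
  | _, _, lam σ t, _, _, q, r => lam (σ.ren q) (t.ren q (liftR r))
  | _, _, app t s, _, _, q, r => app (t.ren q r) (s.ren q r)
  | _, _, tensor t s, _, _, q, r => tensor (t.ren q r) (s.ren q r)
  | _, _, bang t, _, _, q, r => bang (t.ren q r)
  | _, _, tlam t, _, _, q, r => tlam (t.ren (liftR q) r)
  | _, _, tapp t σ, _, _, q, r => tapp (t.ren q r) (σ.ren q)
  | _, _, letTensor σ τ s t, _, _, q, r =>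
      letTensor (σ.ren q) (τ.ren q) (s.ren q r) (t.ren q (liftR (liftR r)))
  | _, _, letBang σ s t, _, _, q, r => letBang (σ.ren q) (s.ren q r) (t.ren q (liftR r))
  | _, _, letStar t s, _, _, q, r => letStar (t.ren q r) (s.ren q r)

/-- Weakening by `c` type variables and `b` term variables. -/
def wk {k n : ℕ} (t : Tm S k n) (c b : ℕ) : Tm S (k + c) (n + b) := t.ren (up c) (up b)

/-- Lifting a term substitution under one term binder. -/
def lift {l n m : ℕ} (s : Fin n → Tm S l m) : Fin (n + 1) → Tm S l (m + 1) :=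
  cons (var 0) (fun i => (s i).wk 0 1)

/-- Simultaneous substitution of types for type variables and terms for term variables. -/
def sub : {k n : ℕ} → Tm S k n → {l m : ℕ} → (Fin k → Typ S l) → (Fin n → Tm S l m) → Tm S l m
  | _, _, var i, _, _, _, r => r i
  | _, _, con c, _, _, _, _ => con c
  | _, _, star, _, _, _, _ => star
  | _, _, Y, _, _, _, _ => Y
  | _, _, lam σ t, _, _, q, r => lam (σ.sub q) (t.sub q (lift r))
  | _, _, app t s, _, _, q, r => app (t.sub q r) (s.sub q r)
  | _, _, tensor t s, _, _, q, r => tensor (t.sub q r) (s.sub q r)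
  | _, _, bang t, _, _, q, r => bang (t.sub q r)
  | _, _, tlam t, _, _, q, r => tlam (t.sub (Ty.lift q) (fun i => (r i).wk 1 0))
  | _, _, tapp t σ, _, _, q, r => tapp (t.sub q r) (σ.sub q)
  | _, _, letTensor σ τ s t, _, _, q, r =>
      letTensor (σ.sub q) (τ.sub q) (s.sub q r) (t.sub q (lift (lift r)))
  | _, _, letBang σ s t, _, _, q, r => letBang (σ.sub q) (s.sub q r) (t.sub q (lift r))
  | _, _, letStar t s, _, _, q, r => letStar (t.sub q r) (s.sub q r)

/-- `t[u/x]` for the most recent term variable `x`. -/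
def inst {k n : ℕ} (t : Tm S k (n + 1)) (u : Tm S k n) : Tm S k n := t.sub Ty.var (cons u var)

/-- `t[σ/α]` for the most recent type variable `α`. -/
def tinst {k n : ℕ} (t : Tm S (k + 1) n) (σ : Typ S k) : Tm S k n := t.sub (cons σ Ty.var) var

/-- A closed term, in the contexts of `k` type variables and `n` term variables. -/
def wk0 (t : Tm S 0 0) (k n : ℕ) : Tm S k n := t.ren nil nil

/-- The identity `λ°x:σ. x`. -/
def idTm {k n : ℕ} (σ : Typ S k) : Tm S k n := lam σ (var 0)

/-- The composite `f ∘ g = λ°x:ω. f (g x)`. -/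
def comp {k n : ℕ} (ω : Typ S k) (f g : Tm S k n) : Tm S k n :=
  lam ω (app (f.wk 0 1) (app (g.wk 0 1) (var 0)))

end Tm

/-! ## Typing

A PILL_Y context `Γ; Δ` is a sequence of types together with a mode for each variable: it belongs
to the intuitionistic part `Γ`, or to the linear part `Δ`, or (`off`) to neither of them. -/

/-- The part of the context `Γ; Δ` that a variable belongs to. -/
inductive Mode
  | intu
  | lin
  | off

/-- One variable in a splitting of `Γ; Δ, Δ'` into `Γ; Δ` and `Γ; Δ'`, with disjoint `Δ`, `Δ'`. -/
inductive Mode.Split : Mode → Mode → Mode → Prop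
  | intu : Mode.Split .intu .intu .intu
  | left : Mode.Split .lin .lin .off
  | right : Mode.Split .lin .off .lin
  | off : Mode.Split .off .off .off

/-- `Γ; Δ, Δ'` splits into `Γ; Δ` and `Γ; Δ'`. -/
def Splits {n : ℕ} (d d₁ d₂ : Fin n → Mode) : Prop := ∀ i, Mode.Split (d i) (d₁ i) (d₂ i)

/-- The linear part of the context is empty. -/
def NoLin {n : ℕ} (d : Fin n → Mode) : Prop := ∀ i, d i ≠ .lin

/-- All variables are intuitionistic: the context `Γ; -`. -/
def allIntu {n : ℕ} : Fin n → Mode := fun _ => .intu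

/-- Weakening of a context by `j` type variables. -/
def wkCx {S : Sig.{u, v}} {k n : ℕ} (Γ : Fin n → Typ S k) (j : ℕ) : Fin n → Typ S (k + j) :=
  fun i => (Γ i).ren (up j)

/-- The typing judgement `Ξ ∣ Γ; Δ ⊢ t : τ`. -/
inductive HasType {S : Sig.{u, v}} :
    {k n : ℕ} → (Fin n → Typ S k) → (Fin n → Mode) → Tm S k n → Typ S k → Prop
  | star {k n : ℕ} {Γ : Fin n → Typ S k} {d : Fin n → Mode} :
      NoLin d → HasType Γ d .star .one
  | con {k n : ℕ} {Γ : Fin n → Typ S k} {d : Fin n → Mode} (c : S.TmCon) :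
      NoLin d → HasType Γ d (.con c) ((S.tmTy c).wk0 k)
  | Y {k n : ℕ} {Γ : Fin n → Typ S k} {d : Fin n → Mode} :
      NoLin d → HasType Γ d .Y (Ty.fixTy k)
  | varIntu {k n : ℕ} {Γ : Fin n → Typ S k} {d : Fin n → Mode} (i : Fin n) :
      d i = .intu → NoLin d → HasType Γ d (.var i) (Γ i)
  | varLin {k n : ℕ} {Γ : Fin n → Typ S k} {d : Fin n → Mode} (i : Fin n) :
      d i = .lin → (∀ j, j ≠ i → d j ≠ .lin) → HasType Γ d (.var i) (Γ i)
  | app {k n : ℕ} {Γ : Fin n → Typ S k} {d d₁ d₂ : Fin n → Mode} {t s : Tm S k n}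
      {σ τ : Typ S k} :
      Splits d d₁ d₂ → HasType Γ d₁ t (.lolli σ τ) → HasType Γ d₂ s σ → HasType Γ d (.app t s) τ
  | lam {k n : ℕ} {Γ : Fin n → Typ S k} {d : Fin n → Mode} {t : Tm S k (n + 1)}
      {σ τ : Typ S k} :
      HasType (cons σ Γ) (cons .lin d) t τ → HasType Γ d (.lam σ t) (.lolli σ τ)
  | tensor {k n : ℕ} {Γ : Fin n → Typ S k} {d d₁ d₂ : Fin n → Mode} {t s : Tm S k n}
      {σ τ : Typ S k} :
      Splits d d₁ d₂ → HasType Γ d₁ t σ → HasType Γ d₂ s τ →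
        HasType Γ d (.tensor t s) (.tensor σ τ)
  | bang {k n : ℕ} {Γ : Fin n → Typ S k} {d : Fin n → Mode} {t : Tm S k n} {σ : Typ S k} :
      NoLin d → HasType Γ d t σ → HasType Γ d (.bang t) (.bang σ)
  | tlam {k n : ℕ} {Γ : Fin n → Typ S k} {d : Fin n → Mode} {t : Tm S (k + 1) n}
      {σ : Typ S (k + 1)} :
      HasType (wkCx Γ 1) d t σ → HasType Γ d (.tlam t) (.all σ)
  | tapp {k n : ℕ} {Γ : Fin n → Typ S k} {d : Fin n → Mode} {t : Tm S k n}
      {σ : Typ S (k + 1)} (τ : Typ S k) :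
      HasType Γ d t (.all σ) → HasType Γ d (.tapp t τ) (σ.inst τ)
  | letTensor {k n : ℕ} {Γ : Fin n → Typ S k} {d d₁ d₂ : Fin n → Mode} {s : Tm S k n}
      {t : Tm S k (n + 2)} {σ σ' τ : Typ S k} :
      Splits d d₁ d₂ → HasType Γ d₁ s (.tensor σ σ') →
        HasType (cons σ' (cons σ Γ)) (cons .lin (cons .lin d₂)) t τ →
          HasType Γ d (.letTensor σ σ' s t) τ
  | letBang {k n : ℕ} {Γ : Fin n → Typ S k} {d d₁ d₂ : Fin n → Mode} {s : Tm S k n}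
      {t : Tm S k (n + 1)} {σ τ : Typ S k} :
      Splits d d₁ d₂ → HasType Γ d₁ s (.bang σ) →
        HasType (cons σ Γ) (cons .intu d₂) t τ → HasType Γ d (.letBang σ s t) τ
  | letStar {k n : ℕ} {Γ : Fin n → Typ S k} {d d₁ d₂ : Fin n → Mode} {t s : Tm S k n}
      {σ : Typ S k} :
      Splits d d₁ d₂ → HasType Γ d₁ t .one → HasType Γ d₂ s σ → HasType Γ d (.letStar t s) σ

/-! ## External equality -/

/-- One layer of a linear term context (a term with one hole, not below `!`). A `Frame S k n c b`
lives over `k` type and `n` term variables and binds `c` type and `b` term variables in its hole.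
Linear contexts are the iterated composites of frames. -/
inductive Frame (S : Sig.{u, v}) : ℕ → ℕ → ℕ → ℕ → Type (max u v)
  | letStarL {k n : ℕ} (t : Tm S k n) : Frame S k n 0 0
  | letStarR {k n : ℕ} (t : Tm S k n) : Frame S k n 0 0
  | tensorL {k n : ℕ} (t : Tm S k n) : Frame S k n 0 0
  | tensorR {k n : ℕ} (t : Tm S k n) : Frame S k n 0 0
  | letTensorL {k n : ℕ} (σ τ : Typ S k) (t : Tm S k (n + 2)) : Frame S k n 0 0
  | letTensorR {k n : ℕ} (σ τ : Typ S k) (s : Tm S k n) : Frame S k n 0 2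
  | lam {k n : ℕ} (σ : Typ S k) : Frame S k n 0 1
  | appL {k n : ℕ} (s : Tm S k n) : Frame S k n 0 0
  | appR {k n : ℕ} (t : Tm S k n) : Frame S k n 0 0
  | letBangL {k n : ℕ} (σ : Typ S k) (t : Tm S k (n + 1)) : Frame S k n 0 0
  | letBangR {k n : ℕ} (σ : Typ S k) (s : Tm S k n) : Frame S k n 0 1
  | tlam {k n : ℕ} : Frame S k n 1 0
  | tapp {k n : ℕ} (σ : Typ S k) : Frame S k n 0 0

namespace Frame

variable {S : Sig.{u, v}}

/-- Filling the hole. -/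
def plug : {k n c b : ℕ} → Frame S k n c b → Tm S (k + c) (n + b) → Tm S k n
  | _, _, _, _, letStarL t, x => .letStar x t
  | _, _, _, _, letStarR t, x => .letStar t x
  | _, _, _, _, tensorL t, x => .tensor x t
  | _, _, _, _, tensorR t, x => .tensor t x
  | _, _, _, _, letTensorL σ τ t, x => .letTensor σ τ x t
  | _, _, _, _, letTensorR σ τ s, x => .letTensor σ τ s x
  | _, _, _, _, lam σ, x => .lam σ x
  | _, _, _, _, appL s, x => .app x s
  | _, _, _, _, appR t, x => .app t x
  | _, _, _, _, letBangL σ t, x => .letBang σ x t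
  | _, _, _, _, letBangR σ s, x => .letBang σ s x
  | _, _, _, _, tlam, x => .tlam x
  | _, _, _, _, tapp σ, x => .tapp x σ

/-- Weakening a frame by `a` term variables (which then do not occur in it). -/
def wk (a : ℕ) : {k n c b : ℕ} → Frame S k n c b → Frame S k (n + a) c b
  | _, _, _, _, letStarL t => letStarL (t.wk 0 a)
  | _, _, _, _, letStarR t => letStarR (t.wk 0 a)
  | _, _, _, _, tensorL t => tensorL (t.wk 0 a)
  | _, _, _, _, tensorR t => tensorR (t.wk 0 a)
  | _, _, _, _, letTensorL σ τ t => letTensorL σ τ (t.ren id (liftR (liftR (up a))))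
  | _, _, _, _, letTensorR σ τ s => letTensorR σ τ (s.wk 0 a)
  | _, _, _, _, lam σ => lam σ
  | _, _, _, _, appL s => appL (s.wk 0 a)
  | _, _, _, _, appR t => appR (t.wk 0 a)
  | _, _, _, _, letBangL σ t => letBangL σ (t.ren id (liftR (up a)))
  | _, _, _, _, letBangR σ s => letBangR σ (s.wk 0 a)
  | _, _, _, _, tlam => tlam
  | _, _, _, _, tapp σ => tapp σ

end Frame

/-- Exchanging a block of `b` newest variables with the block of the `a` variables before them. -/
def swap (a b n : ℕ) (i : Fin (n + a + b)) : Fin (n + b + a) :=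
  ⟨if (i : ℕ) < b then i + a else if (i : ℕ) < a + b then i - b else i, by
    have := i.isLt
    split
    · omega
    · split <;> omega⟩

/-- The computation, uniqueness, commutation and fixed point axioms of external equality, before
typing. The commutation axioms move a `let` across one frame of a linear context; the general
linear context is reached by iteration. -/
inductive EqAx {S : Sig.{u, v}} : {k n : ℕ} → Tm S k n → Tm S k n → Prop
  | betaTerm {k n : ℕ} (σ : Typ S k) (t : Tm S k (n + 1)) (u : Tm S k n) :
      EqAx (.app (.lam σ t) u) (t.inst u)
  | betaType {k n : ℕ} (t : Tm S (k + 1) n) (σ : Typ S k) :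
      EqAx (.tapp (.tlam t) σ) (t.tinst σ)
  | etaTerm {k n : ℕ} (σ : Typ S k) (t : Tm S k n) :
      EqAx (.lam σ (.app (t.wk 0 1) (.var 0))) t
  | etaType {k n : ℕ} (t : Tm S k n) :
      EqAx (.tlam (.tapp (t.wk 1 0) (.var 0))) t
  | betaStar {k n : ℕ} (t : Tm S k n) : EqAx (.letStar .star t) t
  | etaStar {k n : ℕ} (t : Tm S k n) : EqAx (.letStar t .star) t
  | betaTensor {k n : ℕ} (σ τ : Typ S k) (s u : Tm S k n) (t : Tm S k (n + 2)) :
      EqAx (.letTensor σ τ (.tensor s u) t) (t.sub Ty.var (cons u (cons s Tm.var)))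
  | etaTensor {k n : ℕ} (σ τ : Typ S k) (t : Tm S k n) :
      EqAx (.letTensor σ τ t (.tensor (.var 1) (.var 0))) t
  | betaBang {k n : ℕ} (σ : Typ S k) (u : Tm S k n) (t : Tm S k (n + 1)) :
      EqAx (.letBang σ (.bang u) t) (t.inst u)
  | etaBang {k n : ℕ} (σ : Typ S k) (t : Tm S k n) :
      EqAx (.letBang σ t (.bang (.var 0))) t
  | commStar {k n c b : ℕ} (F : Frame S k n c b) (t : Tm S k n) (x : Tm S (k + c) (n + b)) :
      EqAx (.letStar t (F.plug x)) (F.plug (.letStar (t.wk c b) x))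
  | commTensor {k n c b : ℕ} (F : Frame S k n c b) (σ τ : Typ S k) (t : Tm S k n)
      (x : Tm S (k + c) (n + 2 + b)) :
      EqAx (.letTensor σ τ t ((F.wk 2).plug x))
        (F.plug (.letTensor (σ.ren (up c)) (τ.ren (up c)) (t.wk c b) (x.ren id (swap 2 b n))))
  | commBang {k n c b : ℕ} (F : Frame S k n c b) (σ : Typ S k) (t : Tm S k n)
      (x : Tm S (k + c) (n + 1 + b)) :
      EqAx (.letBang σ t ((F.wk 1).plug x))
        (F.plug (.letBang (σ.ren (up c)) (t.wk c b) (x.ren id (swap 1 b n))))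
  | fixed {k n : ℕ} (σ : Typ S k) (f : Tm S k n) :
      EqAx (.app f (.bang (.app (.tapp .Y σ) (.bang f)))) (.app (.tapp .Y σ) (.bang f))

/-- External equality `Ξ ∣ Γ; Δ ⊢ t = s : τ`: the least typed congruence containing the axioms. -/
inductive ExtEq {S : Sig.{u, v}} :
    {k n : ℕ} → (Fin n → Typ S k) → (Fin n → Mode) → Typ S k → Tm S k n → Tm S k n → Prop
  | ax {k n : ℕ} {Γ : Fin n → Typ S k} {d : Fin n → Mode} {τ : Typ S k} {t s : Tm S k n} :
      EqAx t s → HasType Γ d t τ → HasType Γ d s τ → ExtEq Γ d τ t s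
  | refl {k n : ℕ} {Γ : Fin n → Typ S k} {d : Fin n → Mode} {τ : Typ S k} {t : Tm S k n} :
      HasType Γ d t τ → ExtEq Γ d τ t t
  | symm {k n : ℕ} {Γ : Fin n → Typ S k} {d : Fin n → Mode} {τ : Typ S k} {t s : Tm S k n} :
      ExtEq Γ d τ t s → ExtEq Γ d τ s t
  | trans {k n : ℕ} {Γ : Fin n → Typ S k} {d : Fin n → Mode} {τ : Typ S k} {t s r : Tm S k n} :
      ExtEq Γ d τ t s → ExtEq Γ d τ s r → ExtEq Γ d τ t r
  | app {k n : ℕ} {Γ : Fin n → Typ S k} {d d₁ d₂ : Fin n → Mode} {t t' s s' : Tm S k n}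
      {σ τ : Typ S k} :
      Splits d d₁ d₂ → ExtEq Γ d₁ (.lolli σ τ) t t' → ExtEq Γ d₂ σ s s' →
        ExtEq Γ d τ (.app t s) (.app t' s')
  | lam {k n : ℕ} {Γ : Fin n → Typ S k} {d : Fin n → Mode} {t t' : Tm S k (n + 1)}
      {σ τ : Typ S k} :
      ExtEq (cons σ Γ) (cons .lin d) τ t t' → ExtEq Γ d (.lolli σ τ) (.lam σ t) (.lam σ t')
  | tensor {k n : ℕ} {Γ : Fin n → Typ S k} {d d₁ d₂ : Fin n → Mode} {t t' s s' : Tm S k n}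
      {σ τ : Typ S k} :
      Splits d d₁ d₂ → ExtEq Γ d₁ σ t t' → ExtEq Γ d₂ τ s s' →
        ExtEq Γ d (.tensor σ τ) (.tensor t s) (.tensor t' s')
  | bang {k n : ℕ} {Γ : Fin n → Typ S k} {d : Fin n → Mode} {t t' : Tm S k n} {σ : Typ S k} :
      NoLin d → ExtEq Γ d σ t t' → ExtEq Γ d (.bang σ) (.bang t) (.bang t')
  | tlam {k n : ℕ} {Γ : Fin n → Typ S k} {d : Fin n → Mode} {t t' : Tm S (k + 1) n}
      {σ : Typ S (k + 1)} :
      ExtEq (wkCx Γ 1) d σ t t' → ExtEq Γ d (.all σ) (.tlam t) (.tlam t')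
  | tapp {k n : ℕ} {Γ : Fin n → Typ S k} {d : Fin n → Mode} {t t' : Tm S k n}
      {σ : Typ S (k + 1)} (τ : Typ S k) :
      ExtEq Γ d (.all σ) t t' → ExtEq Γ d (σ.inst τ) (.tapp t τ) (.tapp t' τ)
  | letTensor {k n : ℕ} {Γ : Fin n → Typ S k} {d d₁ d₂ : Fin n → Mode} {s s' : Tm S k n}
      {t t' : Tm S k (n + 2)} {σ σ' τ : Typ S k} :
      Splits d d₁ d₂ → ExtEq Γ d₁ (.tensor σ σ') s s' →
        ExtEq (cons σ' (cons σ Γ)) (cons .lin (cons .lin d₂)) τ t t' →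
          ExtEq Γ d τ (.letTensor σ σ' s t) (.letTensor σ σ' s' t')
  | letBang {k n : ℕ} {Γ : Fin n → Typ S k} {d d₁ d₂ : Fin n → Mode} {s s' : Tm S k n}
      {t t' : Tm S k (n + 1)} {σ τ : Typ S k} :
      Splits d d₁ d₂ → ExtEq Γ d₁ (.bang σ) s s' →
        ExtEq (cons σ Γ) (cons .intu d₂) τ t t' →
          ExtEq Γ d τ (.letBang σ s t) (.letBang σ s' t')
  | letStar {k n : ℕ} {Γ : Fin n → Typ S k} {d d₁ d₂ : Fin n → Mode} {t t' s s' : Tm S k n}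
      {σ : Typ S k} :
      Splits d d₁ d₂ → ExtEq Γ d₁ .one t t' → ExtEq Γ d₂ σ s s' →
        ExtEq Γ d σ (.letStar t s) (.letStar t' s')

/-! ## Propositions and definable relations -/

mutual

/-- Propositions of the logic. The suffixes `Ty`, `Tm`, `Rel`, `Adm` of a quantifier say that it
ranges over types, terms, relations `R : Rel(σ,τ)`, or admissible relations `S : AdmRel(σ,τ)`. -/
inductive Form (S : Sig.{u, v}) : ℕ → ℕ → ℕ → Type (max u v)
  | eq {k n m : ℕ} (σ : Typ S k) (t s : Tm S k n) : Form S k n m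
  | rel {k n m : ℕ} (ρ : Rel S k n m) (t s : Tm S k n) : Form S k n m
  | imp {k n m : ℕ} (φ ψ : Form S k n m) : Form S k n m
  | bot {k n m : ℕ} : Form S k n m
  | top {k n m : ℕ} : Form S k n m
  | and {k n m : ℕ} (φ ψ : Form S k n m) : Form S k n m
  | or {k n m : ℕ} (φ ψ : Form S k n m) : Form S k n m
  | allTy {k n m : ℕ} (φ : Form S (k + 1) n m) : Form S k n m
  | allTm {k n m : ℕ} (σ : Typ S k) (φ : Form S k (n + 1) m) : Form S k n m
  | allRel {k n m : ℕ} (σ τ : Typ S k) (φ : Form S k n (m + 1)) : Form S k n m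
  | allAdm {k n m : ℕ} (σ τ : Typ S k) (φ : Form S k n (m + 1)) : Form S k n m
  | exTy {k n m : ℕ} (φ : Form S (k + 1) n m) : Form S k n m
  | exTm {k n m : ℕ} (σ : Typ S k) (φ : Form S k (n + 1) m) : Form S k n m
  | exRel {k n m : ℕ} (σ τ : Typ S k) (φ : Form S k n (m + 1)) : Form S k n m
  | exAdm {k n m : ℕ} (σ τ : Typ S k) (φ : Form S k n (m + 1)) : Form S k n m

/-- Definable relations: relation variables, `(x:σ, y:τ).φ` (where `y` has index `0` and `x` has
index `1`), and the relational interpretation `σ[ρ₁,…,ρₙ]` of a type `α₁,…,αₙ ⊢ σ`. -/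
inductive Rel (S : Sig.{u, v}) : ℕ → ℕ → ℕ → Type (max u v)
  | var {k n m : ℕ} (j : Fin m) : Rel S k n m
  | abs {k n m : ℕ} (σ τ : Typ S k) (φ : Form S k (n + 2) m) : Rel S k n m
  | interp {k n m : ℕ} (a : ℕ) (σ : Typ S a) (ρs : Fin a → Rel S k n m) : Rel S k n m

end

section Substitution

variable {S : Sig.{u, v}}

mutual

/-- Simultaneous renaming of type, term and relation variables in a proposition. -/
def Form.ren : {k n m : ℕ} → Form S k n m → {k' n' m' : ℕ} →
    (Fin k → Fin k') → (Fin n → Fin n') → (Fin m → Fin m') → Form S k' n' m'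
  | _, _, _, .eq σ t s, _, _, _, p, q, _ => .eq (σ.ren p) (t.ren p q) (s.ren p q)
  | _, _, _, .rel ρ t s, _, _, _, p, q, r => .rel (ρ.ren p q r) (t.ren p q) (s.ren p q)
  | _, _, _, .imp φ ψ, _, _, _, p, q, r => .imp (φ.ren p q r) (ψ.ren p q r)
  | _, _, _, .bot, _, _, _, _, _, _ => .bot
  | _, _, _, .top, _, _, _, _, _, _ => .top
  | _, _, _, .and φ ψ, _, _, _, p, q, r => .and (φ.ren p q r) (ψ.ren p q r)
  | _, _, _, .or φ ψ, _, _, _, p, q, r => .or (φ.ren p q r) (ψ.ren p q r)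
  | _, _, _, .allTy φ, _, _, _, p, q, r => .allTy (φ.ren (liftR p) q r)
  | _, _, _, .allTm σ φ, _, _, _, p, q, r => .allTm (σ.ren p) (φ.ren p (liftR q) r)
  | _, _, _, .allRel σ τ φ, _, _, _, p, q, r =>
      .allRel (σ.ren p) (τ.ren p) (φ.ren p q (liftR r))
  | _, _, _, .allAdm σ τ φ, _, _, _, p, q, r =>
      .allAdm (σ.ren p) (τ.ren p) (φ.ren p q (liftR r))
  | _, _, _, .exTy φ, _, _, _, p, q, r => .exTy (φ.ren (liftR p) q r)
  | _, _, _, .exTm σ φ, _, _, _, p, q, r => .exTm (σ.ren p) (φ.ren p (liftR q) r)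
  | _, _, _, .exRel σ τ φ, _, _, _, p, q, r =>
      .exRel (σ.ren p) (τ.ren p) (φ.ren p q (liftR r))
  | _, _, _, .exAdm σ τ φ, _, _, _, p, q, r =>
      .exAdm (σ.ren p) (τ.ren p) (φ.ren p q (liftR r))

/-- Simultaneous renaming of type, term and relation variables in a definable relation. -/
def Rel.ren : {k n m : ℕ} → Rel S k n m → {k' n' m' : ℕ} →
    (Fin k → Fin k') → (Fin n → Fin n') → (Fin m → Fin m') → Rel S k' n' m'
  | _, _, _, .var j, _, _, _, _, _, r => .var (r j)
  | _, _, _, .abs σ τ φ, _, _, _, p, q, r =>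
      .abs (σ.ren p) (τ.ren p) (φ.ren p (liftR (liftR q)) r)
  | _, _, _, .interp a σ ρs, _, _, _, p, q, r => .interp a σ (fun i => (ρs i).ren p q r)

end

/-- Weakening by `a` type, `b` term and `c` relation variables. -/
def Form.wk {k n m : ℕ} (φ : Form S k n m) (a b c : ℕ) : Form S (k + a) (n + b) (m + c) :=
  φ.ren (up a) (up b) (up c)

/-- Weakening by `a` type, `b` term and `c` relation variables. -/
def Rel.wk {k n m : ℕ} (ρ : Rel S k n m) (a b c : ℕ) : Rel S (k + a) (n + b) (m + c) :=
  ρ.ren (up a) (up b) (up c)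

/-- Lifting a relation substitution under one relation binder. -/
def Rel.lift {k n m m' : ℕ} (r : Fin m → Rel S k n m') : Fin (m + 1) → Rel S k n (m' + 1) :=
  cons (.var 0) (fun j => (r j).wk 0 0 1)

mutual

/-- Simultaneous substitution for type, term and relation variables in a proposition. -/
def Form.sub : {k n m : ℕ} → Form S k n m → {k' n' m' : ℕ} →
    (Fin k → Typ S k') → (Fin n → Tm S k' n') → (Fin m → Rel S k' n' m') → Form S k' n' m'
  | _, _, _, .eq σ t s, _, _, _, p, q, _ => .eq (σ.sub p) (t.sub p q) (s.sub p q)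
  | _, _, _, .rel ρ t s, _, _, _, p, q, r => .rel (ρ.sub p q r) (t.sub p q) (s.sub p q)
  | _, _, _, .imp φ ψ, _, _, _, p, q, r => .imp (φ.sub p q r) (ψ.sub p q r)
  | _, _, _, .bot, _, _, _, _, _, _ => .bot
  | _, _, _, .top, _, _, _, _, _, _ => .top
  | _, _, _, .and φ ψ, _, _, _, p, q, r => .and (φ.sub p q r) (ψ.sub p q r)
  | _, _, _, .or φ ψ, _, _, _, p, q, r => .or (φ.sub p q r) (ψ.sub p q r)
  | _, _, _, .allTy φ, _, _, _, p, q, r =>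
      .allTy (φ.sub (Ty.lift p) (fun i => (q i).wk 1 0) (fun j => (r j).wk 1 0 0))
  | _, _, _, .allTm σ φ, _, _, _, p, q, r =>
      .allTm (σ.sub p) (φ.sub p (Tm.lift q) (fun j => (r j).wk 0 1 0))
  | _, _, _, .allRel σ τ φ, _, _, _, p, q, r =>
      .allRel (σ.sub p) (τ.sub p) (φ.sub p q (Rel.lift r))
  | _, _, _, .allAdm σ τ φ, _, _, _, p, q, r =>
      .allAdm (σ.sub p) (τ.sub p) (φ.sub p q (Rel.lift r))
  | _, _, _, .exTy φ, _, _, _, p, q, r =>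
      .exTy (φ.sub (Ty.lift p) (fun i => (q i).wk 1 0) (fun j => (r j).wk 1 0 0))
  | _, _, _, .exTm σ φ, _, _, _, p, q, r =>
      .exTm (σ.sub p) (φ.sub p (Tm.lift q) (fun j => (r j).wk 0 1 0))
  | _, _, _, .exRel σ τ φ, _, _, _, p, q, r =>
      .exRel (σ.sub p) (τ.sub p) (φ.sub p q (Rel.lift r))
  | _, _, _, .exAdm σ τ φ, _, _, _, p, q, r =>
      .exAdm (σ.sub p) (τ.sub p) (φ.sub p q (Rel.lift r))

/-- Simultaneous substitution for type, term and relation variables in a definable relation. -/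
def Rel.sub : {k n m : ℕ} → Rel S k n m → {k' n' m' : ℕ} →
    (Fin k → Typ S k') → (Fin n → Tm S k' n') → (Fin m → Rel S k' n' m') → Rel S k' n' m'
  | _, _, _, .var j, _, _, _, _, _, r => r j
  | _, _, _, .abs σ τ φ, _, _, _, p, q, r =>
      .abs (σ.sub p) (τ.sub p) (φ.sub p (Tm.lift (Tm.lift q)) (fun j => (r j).wk 0 2 0))
  | _, _, _, .interp a σ ρs, _, _, _, p, q, r => .interp a σ (fun i => (ρs i).sub p q r)

end

end Substitution

/-! ## Constructions on definable relations -/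

section Constructions

variable {S : Sig.{u, v}} {k n m : ℕ}

/-- Biimplication. -/
def Form.iff (φ ψ : Form S k n m) : Form S k n m := .and (.imp φ ψ) (.imp ψ φ)

namespace Rel

/-- `ρ ≡ ρ'`, that is `∀ x:σ, y:τ. ρ(x,y) ⇔ ρ'(x,y)`, for relations between `σ` and `τ`. -/
def equiv (σ τ : Typ S k) (ρ ρ' : Rel S k n m) : Form S k n m :=
  .allTm σ (.allTm (τ) (Form.iff
    (.rel (ρ.wk 0 2 0) (.var 1) (.var 0)) (.rel (ρ'.wk 0 2 0) (.var 1) (.var 0))))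

/-- The graph `⟨f⟩ = (x:σ, y:τ). f x =_τ y`. -/
def graph (σ τ : Typ S k) (f : Tm S k n) : Rel S k n m :=
  .abs σ τ (.eq τ (.app (f.wk 0 2) (.var 1)) (.var 0))

/-- The equality relation `eq_σ`, the graph of the identity. -/
def eqRel (σ : Typ S k) : Rel S k n m := graph σ σ (Tm.idTm σ)

/-- `(f,g)^*ρ = (x:σ, y:τ). ρ(f x, g y)`. -/
def reindex (σ τ : Typ S k) (f g : Tm S k n) (ρ : Rel S k n m) : Rel S k n m :=
  .abs σ τ (.rel (ρ.wk 0 2 0) (.app (f.wk 0 2) (.var 1)) (.app (g.wk 0 2) (.var 0)))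

/-- `ρ ⊸ ρ'` for `ρ` between `σ`, `τ` and `ρ'` between `σ'`, `τ'`:
`(f,g). ∀ x:σ, y:τ. ρ(x,y) ⊃ ρ'(f x, g y)`. -/
def lolli (σ τ σ' τ' : Typ S k) (ρ ρ' : Rel S k n m) : Rel S k n m :=
  .abs (.lolli σ σ') (.lolli τ τ') (.allTm σ (.allTm τ (.imp
    (.rel (ρ.wk 0 4 0) (.var 1) (.var 0))
    (.rel (ρ'.wk 0 4 0) (.app (.var 3) (.var 1)) (.app (.var 2) (.var 0))))))

/-- `ρ → ρ'`, that is `(f : !σ ⊸ σ', g : !τ ⊸ τ'). ∀ x:σ, y:τ. ρ(x,y) ⊃ ρ'(f(!x), g(!y))`. -/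
def arrow (σ τ σ' τ' : Typ S k) (ρ ρ' : Rel S k n m) : Rel S k n m :=
  .abs (.lolli (.bang σ) σ') (.lolli (.bang τ) τ') (.allTm σ (.allTm τ (.imp
    (.rel (ρ.wk 0 4 0) (.var 1) (.var 0))
    (.rel (ρ'.wk 0 4 0) (.app (.var 3) (.bang (.var 1))) (.app (.var 2) (.bang (.var 0)))))))

/-- `∀(α, β, R : AdmRel(α,β)). ρ`, that is
`(t : Πα.σ, u : Πβ.τ). ∀ α β. ∀ R : AdmRel(α,β). ρ(t α, u β)`. In `ρ`, the type variables `α`, `β`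
have the indices `1`, `0`, and `R` has index `0`. -/
def poly (σ τ : Typ S (k + 1)) (ρ : Rel S (k + 2) n (m + 1)) : Rel S k n m :=
  .abs (.all σ) (.all τ) (.allTy (.allTy (.allAdm (.var 1) (.var 0)
    (.rel (ρ.wk 0 2 0) (.tapp (.var 1) (.var 1)) (.tapp (.var 0) (.var 0))))))

/-- The map `σ ⊗ σ' ⊸ Πα.(σ ⊸ σ' ⊸ α) ⊸ α`, namely
`λ°x. let x' ⊗ x'' be x in Λα. λ°h. h x' x''`. -/
def tensorMap (σ σ' : Typ S k) : Tm S k n :=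
  .lam (.tensor σ σ') (.letTensor σ σ' (.var 0) (.tlam
    (.lam (.lolli (σ.ren (up 1)) (.lolli (σ'.ren (up 1)) (.var 0)))
      (.app (.app (.var 0) (.var 2)) (.var 1)))))

/-- `ρ ⊗ ρ'` for `ρ` between `σ`, `τ` and `ρ'` between `σ'`, `τ'`: the reindexing along
`tensorMap` of `∀(α, β, R : AdmRel(α,β)). (ρ ⊸ ρ' ⊸ R) ⊸ R`. -/
def tensor (σ τ σ' τ' : Typ S k) (ρ ρ' : Rel S k n m) : Rel S k n m :=
  reindex (.tensor σ σ') (.tensor τ τ') (tensorMap σ σ') (tensorMap τ τ')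
    (poly
      (.lolli (.lolli (σ.ren (up 1)) (.lolli (σ'.ren (up 1)) (.var 0))) (.var 0))
      (.lolli (.lolli (τ.ren (up 1)) (.lolli (τ'.ren (up 1)) (.var 0))) (.var 0))
      (lolli
        (.lolli (σ.ren (up 2)) (.lolli (σ'.ren (up 2)) (.var 1)))
        (.lolli (τ.ren (up 2)) (.lolli (τ'.ren (up 2)) (.var 0)))
        (.var 1) (.var 0)
        (lolli (σ.ren (up 2)) (τ.ren (up 2))
          (.lolli (σ'.ren (up 2)) (.var 1)) (.lolli (τ'.ren (up 2)) (.var 0))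
          (ρ.wk 2 0 1)
          (lolli (σ'.ren (up 2)) (τ'.ren (up 2)) (.var 1) (.var 0) (ρ'.wk 2 0 1) (.var 0)))
        (.var 0)))

/-- The map `I ⊸ Πα. α ⊸ α`, namely `λ°x. let ⋆ be x in Λα. λ°y. y`. -/
def unitMap : Tm S k n :=
  .lam .one (.letStar (.var 0) (.tlam (Tm.idTm (.var 0))))

/-- The relation `I_Rel` between `I` and `I`: the reindexing along `unitMap` of
`∀(α, β, R : AdmRel(α,β)). R ⊸ R`. -/
def unit : Rel S k n m :=
  reindex .one .one unitMap unitMap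
    (poly (.lolli (.var 0) (.var 0)) (.lolli (.var 0) (.var 0))
      (lolli (.var 1) (.var 0) (.var 1) (.var 0) (.var 0) (.var 0)))

/-- The map `!σ ⊸ Πα. (σ → α) ⊸ α`, namely `λ°x. Λα. λ°g. g x`. -/
def bangMap (σ : Typ S k) : Tm S k n :=
  .lam (.bang σ) (.tlam (.lam (.lolli (.bang (σ.ren (up 1))) (.var 0))
    (.app (.var 0) (.var 1))))

/-- `!ρ` for `ρ` between `σ` and `τ`: the reindexing along `bangMap` of
`∀(α, β, R : AdmRel(α,β)). (ρ → R) ⊸ R`. -/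
def bang (σ τ : Typ S k) (ρ : Rel S k n m) : Rel S k n m :=
  reindex (.bang σ) (.bang τ) (bangMap σ) (bangMap τ)
    (poly
      (.lolli (.lolli (.bang (σ.ren (up 1))) (.var 0)) (.var 0))
      (.lolli (.lolli (.bang (τ.ren (up 1))) (.var 0)) (.var 0))
      (lolli
        (.lolli (.bang (σ.ren (up 2))) (.var 1)) (.lolli (.bang (τ.ren (up 2))) (.var 0))
        (.var 1) (.var 0)
        (arrow (σ.ren (up 2)) (τ.ren (up 2)) (.var 1) (.var 0) (ρ.wk 2 0 1) (.var 0))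
        (.var 0)))

end Rel

end Constructions

/-! ## The logic -/

/-- A relation variable of a relational context `Θ`: `R : Rel(dom, cod)`, or
`R : AdmRel(dom, cod)` when `adm` is `true`. -/
structure RelDecl (S : Sig.{u, v}) (k : ℕ) where
  adm : Bool
  dom : Typ S k
  cod : Typ S k

/-- Weakening of a relational context by `j` type variables. -/
def wkRCx {S : Sig.{u, v}} {k m : ℕ} (Θ : Fin m → RelDecl S k) (j : ℕ) :
    Fin m → RelDecl S (k + j) :=
  fun i => ⟨(Θ i).adm, (Θ i).dom.ren (up j), (Θ i).cod.ren (up j)⟩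

mutual

/-- `Ξ ∣ Γ ∣ Θ ⊢ φ : Prop`. This judgement and the next three are relative to a set `T` of
additional closed propositions that the logic takes as axioms (such as instances of the
extensionality and identity extension schemes). -/
inductive WfForm {S : Sig.{u, v}} (T : Set (Form S 0 0 0)) :
    {k n m : ℕ} → (Fin n → Typ S k) → (Fin m → RelDecl S k) → Form S k n m → Prop
  | eq {k n m : ℕ} {Γ : Fin n → Typ S k} {Θ : Fin m → RelDecl S k} {σ : Typ S k}
      {t s : Tm S k n} :
      HasType Γ allIntu t σ → HasType Γ allIntu s σ → WfForm T Γ Θ (.eq σ t s)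
  | rel {k n m : ℕ} {Γ : Fin n → Typ S k} {Θ : Fin m → RelDecl S k} {ρ : Rel S k n m}
      {σ τ : Typ S k} {t s : Tm S k n} :
      IsRel T Γ Θ ρ σ τ → HasType Γ allIntu t σ → HasType Γ allIntu s τ →
        WfForm T Γ Θ (.rel ρ t s)
  | imp {k n m : ℕ} {Γ : Fin n → Typ S k} {Θ : Fin m → RelDecl S k} {φ ψ : Form S k n m} :
      WfForm T Γ Θ φ → WfForm T Γ Θ ψ → WfForm T Γ Θ (.imp φ ψ)
  | bot {k n m : ℕ} {Γ : Fin n → Typ S k} {Θ : Fin m → RelDecl S k} : WfForm T Γ Θ .bot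
  | top {k n m : ℕ} {Γ : Fin n → Typ S k} {Θ : Fin m → RelDecl S k} : WfForm T Γ Θ .top
  | and {k n m : ℕ} {Γ : Fin n → Typ S k} {Θ : Fin m → RelDecl S k} {φ ψ : Form S k n m} :
      WfForm T Γ Θ φ → WfForm T Γ Θ ψ → WfForm T Γ Θ (.and φ ψ)
  | or {k n m : ℕ} {Γ : Fin n → Typ S k} {Θ : Fin m → RelDecl S k} {φ ψ : Form S k n m} :
      WfForm T Γ Θ φ → WfForm T Γ Θ ψ → WfForm T Γ Θ (.or φ ψ)
  | allTy {k n m : ℕ} {Γ : Fin n → Typ S k} {Θ : Fin m → RelDecl S k}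
      {φ : Form S (k + 1) n m} :
      WfForm T (wkCx Γ 1) (wkRCx Θ 1) φ → WfForm T Γ Θ (.allTy φ)
  | allTm {k n m : ℕ} {Γ : Fin n → Typ S k} {Θ : Fin m → RelDecl S k} {σ : Typ S k}
      {φ : Form S k (n + 1) m} :
      WfForm T (cons σ Γ) Θ φ → WfForm T Γ Θ (.allTm σ φ)
  | allRel {k n m : ℕ} {Γ : Fin n → Typ S k} {Θ : Fin m → RelDecl S k} {σ τ : Typ S k}
      {φ : Form S k n (m + 1)} :
      WfForm T Γ (cons ⟨false, σ, τ⟩ Θ) φ → WfForm T Γ Θ (.allRel σ τ φ)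
  | allAdm {k n m : ℕ} {Γ : Fin n → Typ S k} {Θ : Fin m → RelDecl S k} {σ τ : Typ S k}
      {φ : Form S k n (m + 1)} :
      WfForm T Γ (cons ⟨true, σ, τ⟩ Θ) φ → WfForm T Γ Θ (.allAdm σ τ φ)
  | exTy {k n m : ℕ} {Γ : Fin n → Typ S k} {Θ : Fin m → RelDecl S k}
      {φ : Form S (k + 1) n m} :
      WfForm T (wkCx Γ 1) (wkRCx Θ 1) φ → WfForm T Γ Θ (.exTy φ)
  | exTm {k n m : ℕ} {Γ : Fin n → Typ S k} {Θ : Fin m → RelDecl S k} {σ : Typ S k}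
      {φ : Form S k (n + 1) m} :
      WfForm T (cons σ Γ) Θ φ → WfForm T Γ Θ (.exTm σ φ)
  | exRel {k n m : ℕ} {Γ : Fin n → Typ S k} {Θ : Fin m → RelDecl S k} {σ τ : Typ S k}
      {φ : Form S k n (m + 1)} :
      WfForm T Γ (cons ⟨false, σ, τ⟩ Θ) φ → WfForm T Γ Θ (.exRel σ τ φ)
  | exAdm {k n m : ℕ} {Γ : Fin n → Typ S k} {Θ : Fin m → RelDecl S k} {σ τ : Typ S k}
      {φ : Form S k n (m + 1)} :
      WfForm T Γ (cons ⟨true, σ, τ⟩ Θ) φ → WfForm T Γ Θ (.exAdm σ τ φ)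

/-- `Ξ ∣ Γ ∣ Θ ⊢ ρ : Rel(σ,τ)`. -/
inductive IsRel {S : Sig.{u, v}} (T : Set (Form S 0 0 0)) :
    {k n m : ℕ} → (Fin n → Typ S k) → (Fin m → RelDecl S k) → Rel S k n m →
      Typ S k → Typ S k → Prop
  | var {k n m : ℕ} {Γ : Fin n → Typ S k} {Θ : Fin m → RelDecl S k} (j : Fin m) :
      (Θ j).adm = false → IsRel T Γ Θ (.var j) (Θ j).dom (Θ j).cod
  | abs {k n m : ℕ} {Γ : Fin n → Typ S k} {Θ : Fin m → RelDecl S k} {σ τ : Typ S k}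
      {φ : Form S k (n + 2) m} :
      WfForm T (cons τ (cons σ Γ)) Θ φ → IsRel T Γ Θ (.abs σ τ φ) σ τ
  | ofAdm {k n m : ℕ} {Γ : Fin n → Typ S k} {Θ : Fin m → RelDecl S k} {ρ : Rel S k n m}
      {σ τ : Typ S k} :
      IsAdm T Γ Θ ρ σ τ → IsRel T Γ Θ ρ σ τ

/-- `Ξ ∣ Γ ∣ Θ ⊢ ρ : AdmRel(σ,τ)`. -/
inductive IsAdm {S : Sig.{u, v}} (T : Set (Form S 0 0 0)) :
    {k n m : ℕ} → (Fin n → Typ S k) → (Fin m → RelDecl S k) → Rel S k n m →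
      Typ S k → Typ S k → Prop
  | var {k n m : ℕ} {Γ : Fin n → Typ S k} {Θ : Fin m → RelDecl S k} (j : Fin m) :
      (Θ j).adm = true → IsAdm T Γ Θ (.var j) (Θ j).dom (Θ j).cod
  | eqRel {k n m : ℕ} {Γ : Fin n → Typ S k} {Θ : Fin m → RelDecl S k} (σ : Typ S k) :
      IsAdm T Γ Θ (Rel.eqRel σ) σ σ
  | reindex {k n m : ℕ} {Γ : Fin n → Typ S k} {Θ : Fin m → RelDecl S k} {ρ : Rel S k n m}
      {σ τ σ' τ' : Typ S k} {t s : Tm S k n} :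
      IsAdm T Γ Θ ρ σ τ → HasType Γ allIntu t (.lolli σ' σ) →
        HasType Γ allIntu s (.lolli τ' τ) → IsAdm T Γ Θ (Rel.reindex σ' τ' t s ρ) σ' τ'
  | and {k n m : ℕ} {Γ : Fin n → Typ S k} {Θ : Fin m → RelDecl S k} {ρ ρ' : Rel S k n m}
      {σ τ : Typ S k} :
      IsAdm T Γ Θ ρ σ τ → IsAdm T Γ Θ ρ' σ τ →
        IsAdm T Γ Θ (.abs σ τ (.and (.rel (ρ.wk 0 2 0) (.var 1) (.var 0))
          (.rel (ρ'.wk 0 2 0) (.var 1) (.var 0)))) σ τ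
  | inverse {k n m : ℕ} {Γ : Fin n → Typ S k} {Θ : Fin m → RelDecl S k} {ρ : Rel S k n m}
      {σ τ : Typ S k} :
      IsAdm T Γ Θ ρ σ τ → IsAdm T Γ Θ (.abs τ σ (.rel (ρ.wk 0 2 0) (.var 0) (.var 1))) τ σ
  | top {k n m : ℕ} {Γ : Fin n → Typ S k} {Θ : Fin m → RelDecl S k} (σ τ : Typ S k) :
      IsAdm T Γ Θ (.abs σ τ .top) σ τ
  | imp {k n m : ℕ} {Γ : Fin n → Typ S k} {Θ : Fin m → RelDecl S k} {ρ : Rel S k n m}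
      {φ : Form S k n m} {σ τ : Typ S k} :
      IsAdm T Γ Θ ρ σ τ → WfForm T Γ Θ φ →
        IsAdm T Γ Θ (.abs σ τ (.imp (φ.wk 0 2 0) (.rel (ρ.wk 0 2 0) (.var 1) (.var 0)))) σ τ
  | allTy {k n m : ℕ} {Γ : Fin n → Typ S k} {Θ : Fin m → RelDecl S k}
      {ρ : Rel S (k + 1) n m} {σ τ : Typ S k} :
      IsAdm T (wkCx Γ 1) (wkRCx Θ 1) ρ (σ.ren (up 1)) (τ.ren (up 1)) →
        IsAdm T Γ Θ (.abs σ τ (.allTy (.rel (ρ.wk 0 2 0) (.var 1) (.var 0)))) σ τ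
  | allTm {k n m : ℕ} {Γ : Fin n → Typ S k} {Θ : Fin m → RelDecl S k} {ω : Typ S k}
      {ρ : Rel S k (n + 1) m} {σ τ : Typ S k} :
      IsAdm T (cons ω Γ) Θ ρ σ τ →
        IsAdm T Γ Θ (.abs σ τ (.allTm ω
          (.rel (ρ.ren id (liftR (up 2)) id) (.var 2) (.var 1)))) σ τ
  | allAdm {k n m : ℕ} {Γ : Fin n → Typ S k} {Θ : Fin m → RelDecl S k} {ω ω' : Typ S k}
      {ρ : Rel S k n (m + 1)} {σ τ : Typ S k} :
      IsAdm T Γ (cons ⟨true, ω, ω'⟩ Θ) ρ σ τ →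
        IsAdm T Γ Θ (.abs σ τ (.allAdm ω ω' (.rel (ρ.wk 0 2 0) (.var 1) (.var 0)))) σ τ
  | allRel {k n m : ℕ} {Γ : Fin n → Typ S k} {Θ : Fin m → RelDecl S k} {ω ω' : Typ S k}
      {ρ : Rel S k n (m + 1)} {σ τ : Typ S k} :
      IsAdm T Γ (cons ⟨false, ω, ω'⟩ Θ) ρ σ τ →
        IsAdm T Γ Θ (.abs σ τ (.allRel ω ω' (.rel (ρ.wk 0 2 0) (.var 1) (.var 0)))) σ τ
  | equiv {k n m : ℕ} {Γ : Fin n → Typ S k} {Θ : Fin m → RelDecl S k} {ρ ρ' : Rel S k n m}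
      {σ τ : Typ S k} :
      IsAdm T Γ Θ ρ σ τ → IsRel T Γ Θ ρ' σ τ → Prov T Γ Θ [] (Rel.equiv σ τ ρ ρ') →
        IsAdm T Γ Θ ρ' σ τ
  | interp {k n m : ℕ} {Γ : Fin n → Typ S k} {Θ : Fin m → RelDecl S k} {a : ℕ}
      (σ : Typ S a) {ρs : Fin a → Rel S k n m} {τs τs' : Fin a → Typ S k} :
      (∀ i, IsAdm T Γ Θ (ρs i) (τs i) (τs' i)) →
        IsAdm T Γ Θ (.interp a σ ρs) (σ.sub τs) (σ.sub τs')

/-- Provability `Ξ ∣ Γ ∣ Θ ∣ φ₁,…,φₗ ⊢ ψ` in LAPL with the additional axioms `T`: intuitionistic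
predicate logic with quantifiers over types, terms, relations and admissible relations, the rules
of equality, and the rules for definable relations and for the relational interpretation of
types. -/
inductive Prov {S : Sig.{u, v}} (T : Set (Form S 0 0 0)) :
    {k n m : ℕ} → (Fin n → Typ S k) → (Fin m → RelDecl S k) → List (Form S k n m) →
      Form S k n m → Prop
  | extra {φ : Form S 0 0 0} : φ ∈ T → WfForm T nil nil φ → Prov T nil nil [] φ
  -- structural and propositional rules
  | hyp {k n m : ℕ} {Γ : Fin n → Typ S k} {Θ : Fin m → RelDecl S k}
      {Φ : List (Form S k n m)} {φ : Form S k n m} :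
      (∀ χ ∈ Φ, WfForm T Γ Θ χ) → φ ∈ Φ → Prov T Γ Θ Φ φ
  | weaken {k n m : ℕ} {Γ : Fin n → Typ S k} {Θ : Fin m → RelDecl S k}
      {Φ Φ' : List (Form S k n m)} {φ : Form S k n m} :
      Prov T Γ Θ Φ φ → Φ ⊆ Φ' → (∀ χ ∈ Φ', WfForm T Γ Θ χ) → Prov T Γ Θ Φ' φ
  | impI {k n m : ℕ} {Γ : Fin n → Typ S k} {Θ : Fin m → RelDecl S k}
      {Φ : List (Form S k n m)} {φ ψ : Form S k n m} :
      Prov T Γ Θ (φ :: Φ) ψ → Prov T Γ Θ Φ (.imp φ ψ)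
  | impE {k n m : ℕ} {Γ : Fin n → Typ S k} {Θ : Fin m → RelDecl S k}
      {Φ : List (Form S k n m)} {φ ψ : Form S k n m} :
      Prov T Γ Θ Φ (.imp φ ψ) → Prov T Γ Θ Φ φ → Prov T Γ Θ Φ ψ
  | botE {k n m : ℕ} {Γ : Fin n → Typ S k} {Θ : Fin m → RelDecl S k}
      {Φ : List (Form S k n m)} {φ : Form S k n m} :
      Prov T Γ Θ Φ .bot → WfForm T Γ Θ φ → Prov T Γ Θ Φ φ
  | topI {k n m : ℕ} {Γ : Fin n → Typ S k} {Θ : Fin m → RelDecl S k} :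
      Prov T Γ Θ [] .top
  | andI {k n m : ℕ} {Γ : Fin n → Typ S k} {Θ : Fin m → RelDecl S k}
      {Φ : List (Form S k n m)} {φ ψ : Form S k n m} :
      Prov T Γ Θ Φ φ → Prov T Γ Θ Φ ψ → Prov T Γ Θ Φ (.and φ ψ)
  | andL {k n m : ℕ} {Γ : Fin n → Typ S k} {Θ : Fin m → RelDecl S k}
      {Φ : List (Form S k n m)} {φ ψ : Form S k n m} :
      Prov T Γ Θ Φ (.and φ ψ) → Prov T Γ Θ Φ φ
  | andR {k n m : ℕ} {Γ : Fin n → Typ S k} {Θ : Fin m → RelDecl S k}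
      {Φ : List (Form S k n m)} {φ ψ : Form S k n m} :
      Prov T Γ Θ Φ (.and φ ψ) → Prov T Γ Θ Φ ψ
  | orL {k n m : ℕ} {Γ : Fin n → Typ S k} {Θ : Fin m → RelDecl S k}
      {Φ : List (Form S k n m)} {φ ψ : Form S k n m} :
      Prov T Γ Θ Φ φ → WfForm T Γ Θ ψ → Prov T Γ Θ Φ (.or φ ψ)
  | orR {k n m : ℕ} {Γ : Fin n → Typ S k} {Θ : Fin m → RelDecl S k}
      {Φ : List (Form S k n m)} {φ ψ : Form S k n m} :
      Prov T Γ Θ Φ ψ → WfForm T Γ Θ φ → Prov T Γ Θ Φ (.or φ ψ)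
  | orE {k n m : ℕ} {Γ : Fin n → Typ S k} {Θ : Fin m → RelDecl S k}
      {Φ : List (Form S k n m)} {φ ψ χ : Form S k n m} :
      Prov T Γ Θ Φ (.or φ ψ) → Prov T Γ Θ (φ :: Φ) χ → Prov T Γ Θ (ψ :: Φ) χ → Prov T Γ Θ Φ χ
  -- simultaneous substitution of types, terms, relations and admissible relations
  | subst {k n m k' n' m' : ℕ} {Γ : Fin n → Typ S k} {Θ : Fin m → RelDecl S k}
      {Γ' : Fin n' → Typ S k'} {Θ' : Fin m' → RelDecl S k'}
      {Φ : List (Form S k n m)} {φ : Form S k n m}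
      (p : Fin k → Typ S k') (q : Fin n → Tm S k' n') (r : Fin m → Rel S k' n' m') :
      Prov T Γ Θ Φ φ →
      (∀ i, HasType Γ' allIntu (q i) ((Γ i).sub p)) →
      (∀ j, (Θ j).adm = false → IsRel T Γ' Θ' (r j) ((Θ j).dom.sub p) ((Θ j).cod.sub p)) →
      (∀ j, (Θ j).adm = true → IsAdm T Γ' Θ' (r j) ((Θ j).dom.sub p) ((Θ j).cod.sub p)) →
        Prov T Γ' Θ' (Φ.map (fun χ => χ.sub p q r)) (φ.sub p q r)
  -- universal quantifiers
  | allTyI {k n m : ℕ} {Γ : Fin n → Typ S k} {Θ : Fin m → RelDecl S k}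
      {Φ : List (Form S k n m)} {φ : Form S (k + 1) n m} :
      (∀ χ ∈ Φ, WfForm T Γ Θ χ) →
        Prov T (wkCx Γ 1) (wkRCx Θ 1) (Φ.map (fun χ => χ.wk 1 0 0)) φ → Prov T Γ Θ Φ (.allTy φ)
  | allTyE {k n m : ℕ} {Γ : Fin n → Typ S k} {Θ : Fin m → RelDecl S k}
      {Φ : List (Form S k n m)} {φ : Form S (k + 1) n m} :
      Prov T Γ Θ Φ (.allTy φ) → Prov T (wkCx Γ 1) (wkRCx Θ 1) (Φ.map (fun χ => χ.wk 1 0 0)) φ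
  | allTmI {k n m : ℕ} {Γ : Fin n → Typ S k} {Θ : Fin m → RelDecl S k} {σ : Typ S k}
      {Φ : List (Form S k n m)} {φ : Form S k (n + 1) m} :
      (∀ χ ∈ Φ, WfForm T Γ Θ χ) →
        Prov T (cons σ Γ) Θ (Φ.map (fun χ => χ.wk 0 1 0)) φ → Prov T Γ Θ Φ (.allTm σ φ)
  | allTmE {k n m : ℕ} {Γ : Fin n → Typ S k} {Θ : Fin m → RelDecl S k} {σ : Typ S k}
      {Φ : List (Form S k n m)} {φ : Form S k (n + 1) m} :
      Prov T Γ Θ Φ (.allTm σ φ) → Prov T (cons σ Γ) Θ (Φ.map (fun χ => χ.wk 0 1 0)) φ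
  | allRelI {k n m : ℕ} {Γ : Fin n → Typ S k} {Θ : Fin m → RelDecl S k} {σ τ : Typ S k}
      {Φ : List (Form S k n m)} {φ : Form S k n (m + 1)} :
      (∀ χ ∈ Φ, WfForm T Γ Θ χ) →
        Prov T Γ (cons ⟨false, σ, τ⟩ Θ) (Φ.map (fun χ => χ.wk 0 0 1)) φ →
          Prov T Γ Θ Φ (.allRel σ τ φ)
  | allRelE {k n m : ℕ} {Γ : Fin n → Typ S k} {Θ : Fin m → RelDecl S k} {σ τ : Typ S k}
      {Φ : List (Form S k n m)} {φ : Form S k n (m + 1)} :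
      Prov T Γ Θ Φ (.allRel σ τ φ) →
        Prov T Γ (cons ⟨false, σ, τ⟩ Θ) (Φ.map (fun χ => χ.wk 0 0 1)) φ
  | allAdmI {k n m : ℕ} {Γ : Fin n → Typ S k} {Θ : Fin m → RelDecl S k} {σ τ : Typ S k}
      {Φ : List (Form S k n m)} {φ : Form S k n (m + 1)} :
      (∀ χ ∈ Φ, WfForm T Γ Θ χ) →
        Prov T Γ (cons ⟨true, σ, τ⟩ Θ) (Φ.map (fun χ => χ.wk 0 0 1)) φ →
          Prov T Γ Θ Φ (.allAdm σ τ φ)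
  | allAdmE {k n m : ℕ} {Γ : Fin n → Typ S k} {Θ : Fin m → RelDecl S k} {σ τ : Typ S k}
      {Φ : List (Form S k n m)} {φ : Form S k n (m + 1)} :
      Prov T Γ Θ Φ (.allAdm σ τ φ) →
        Prov T Γ (cons ⟨true, σ, τ⟩ Θ) (Φ.map (fun χ => χ.wk 0 0 1)) φ
  -- existential quantifiers
  | exTyE {k n m : ℕ} {Γ : Fin n → Typ S k} {Θ : Fin m → RelDecl S k}
      {φ : Form S (k + 1) n m} {ψ : Form S k n m} :
      WfForm T Γ Θ ψ → Prov T (wkCx Γ 1) (wkRCx Θ 1) [φ] (ψ.wk 1 0 0) →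
        Prov T Γ Θ [.exTy φ] ψ
  | exTyI {k n m : ℕ} {Γ : Fin n → Typ S k} {Θ : Fin m → RelDecl S k}
      {φ : Form S (k + 1) n m} {ψ : Form S k n m} :
      Prov T Γ Θ [.exTy φ] ψ → Prov T (wkCx Γ 1) (wkRCx Θ 1) [φ] (ψ.wk 1 0 0)
  | exTmE {k n m : ℕ} {Γ : Fin n → Typ S k} {Θ : Fin m → RelDecl S k} {σ : Typ S k}
      {φ : Form S k (n + 1) m} {ψ : Form S k n m} :
      WfForm T Γ Θ ψ → Prov T (cons σ Γ) Θ [φ] (ψ.wk 0 1 0) → Prov T Γ Θ [.exTm σ φ] ψ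
  | exTmI {k n m : ℕ} {Γ : Fin n → Typ S k} {Θ : Fin m → RelDecl S k} {σ : Typ S k}
      {φ : Form S k (n + 1) m} {ψ : Form S k n m} :
      Prov T Γ Θ [.exTm σ φ] ψ → Prov T (cons σ Γ) Θ [φ] (ψ.wk 0 1 0)
  | exRelE {k n m : ℕ} {Γ : Fin n → Typ S k} {Θ : Fin m → RelDecl S k} {σ τ : Typ S k}
      {φ : Form S k n (m + 1)} {ψ : Form S k n m} :
      WfForm T Γ Θ ψ → Prov T Γ (cons ⟨false, σ, τ⟩ Θ) [φ] (ψ.wk 0 0 1) →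
        Prov T Γ Θ [.exRel σ τ φ] ψ
  | exRelI {k n m : ℕ} {Γ : Fin n → Typ S k} {Θ : Fin m → RelDecl S k} {σ τ : Typ S k}
      {φ : Form S k n (m + 1)} {ψ : Form S k n m} :
      Prov T Γ Θ [.exRel σ τ φ] ψ → Prov T Γ (cons ⟨false, σ, τ⟩ Θ) [φ] (ψ.wk 0 0 1)
  | exAdmE {k n m : ℕ} {Γ : Fin n → Typ S k} {Θ : Fin m → RelDecl S k} {σ τ : Typ S k}
      {φ : Form S k n (m + 1)} {ψ : Form S k n m} :
      WfForm T Γ Θ ψ → Prov T Γ (cons ⟨true, σ, τ⟩ Θ) [φ] (ψ.wk 0 0 1) →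
        Prov T Γ Θ [.exAdm σ τ φ] ψ
  | exAdmI {k n m : ℕ} {Γ : Fin n → Typ S k} {Θ : Fin m → RelDecl S k} {σ τ : Typ S k}
      {φ : Form S k n (m + 1)} {ψ : Form S k n m} :
      Prov T Γ Θ [.exAdm σ τ φ] ψ → Prov T Γ (cons ⟨true, σ, τ⟩ Θ) [φ] (ψ.wk 0 0 1)
  -- internal equality
  | ofExtEq {k n m : ℕ} {Γ : Fin n → Typ S k} {Θ : Fin m → RelDecl S k} {σ : Typ S k}
      {t s : Tm S k n} :
      ExtEq Γ allIntu σ t s → Prov T Γ Θ [] (.eq σ t s)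
  | eqSymm {k n m : ℕ} {Γ : Fin n → Typ S k} {Θ : Fin m → RelDecl S k} {σ : Typ S k}
      {Φ : List (Form S k n m)} {t s : Tm S k n} :
      Prov T Γ Θ Φ (.eq σ t s) → Prov T Γ Θ Φ (.eq σ s t)
  | eqTrans {k n m : ℕ} {Γ : Fin n → Typ S k} {Θ : Fin m → RelDecl S k} {σ : Typ S k}
      {Φ : List (Form S k n m)} {t s r : Tm S k n} :
      Prov T Γ Θ Φ (.eq σ t s) → Prov T Γ Θ Φ (.eq σ s r) → Prov T Γ Θ Φ (.eq σ t r)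
  | eqSubst {k n m : ℕ} {Γ : Fin n → Typ S k} {Θ : Fin m → RelDecl S k} {σ τ : Typ S k}
      {ρ : Rel S k n m} {t t' s s' : Tm S k n} :
      IsRel T Γ Θ ρ σ τ → HasType Γ allIntu t σ → HasType Γ allIntu t' σ →
        HasType Γ allIntu s τ → HasType Γ allIntu s' τ →
        Prov T Γ Θ [] (.imp (.and (.rel ρ t s) (.and (.eq σ t t') (.eq τ s s'))) (.rel ρ t' s'))
  -- definable relations `(x:σ, y:τ).φ`
  | defRel {k n m : ℕ} {Γ : Fin n → Typ S k} {Θ : Fin m → RelDecl S k} {σ τ : Typ S k}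
      {φ : Form S k (n + 2) m} {t s : Tm S k n} :
      WfForm T (cons τ (cons σ Γ)) Θ φ → HasType Γ allIntu t σ → HasType Γ allIntu s τ →
        Prov T Γ Θ [] (Form.iff (.rel (.abs σ τ φ) t s)
          (φ.sub Ty.var (cons s (cons t Tm.var)) Rel.var))
  -- the relational interpretation of types
  | interpVar {k n m : ℕ} {Γ : Fin n → Typ S k} {Θ : Fin m → RelDecl S k} {a : ℕ}
      {ρs : Fin a → Rel S k n m} {τs τs' : Fin a → Typ S k} (i : Fin a) :
      (∀ i, IsAdm T Γ Θ (ρs i) (τs i) (τs' i)) →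
        Prov T Γ Θ [] (Rel.equiv (τs i) (τs' i) (.interp a (.var i) ρs) (ρs i))
  | interpLolli {k n m : ℕ} {Γ : Fin n → Typ S k} {Θ : Fin m → RelDecl S k} {a : ℕ}
      {ρs : Fin a → Rel S k n m} {τs τs' : Fin a → Typ S k} (σ σ' : Typ S a) :
      (∀ i, IsAdm T Γ Θ (ρs i) (τs i) (τs' i)) →
        Prov T Γ Θ [] (Rel.equiv ((Ty.lolli σ σ').sub τs) ((Ty.lolli σ σ').sub τs')
          (.interp a (.lolli σ σ') ρs)
          (Rel.lolli (σ.sub τs) (σ.sub τs') (σ'.sub τs) (σ'.sub τs')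
            (.interp a σ ρs) (.interp a σ' ρs)))
  | interpTensor {k n m : ℕ} {Γ : Fin n → Typ S k} {Θ : Fin m → RelDecl S k} {a : ℕ}
      {ρs : Fin a → Rel S k n m} {τs τs' : Fin a → Typ S k} (σ σ' : Typ S a) :
      (∀ i, IsAdm T Γ Θ (ρs i) (τs i) (τs' i)) →
        Prov T Γ Θ [] (Rel.equiv ((Ty.tensor σ σ').sub τs) ((Ty.tensor σ σ').sub τs')
          (.interp a (.tensor σ σ') ρs)
          (Rel.tensor (σ.sub τs) (σ.sub τs') (σ'.sub τs) (σ'.sub τs')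
            (.interp a σ ρs) (.interp a σ' ρs)))
  | interpOne {k n m : ℕ} {Γ : Fin n → Typ S k} {Θ : Fin m → RelDecl S k} {a : ℕ}
      {ρs : Fin a → Rel S k n m} {τs τs' : Fin a → Typ S k} :
      (∀ i, IsAdm T Γ Θ (ρs i) (τs i) (τs' i)) →
        Prov T Γ Θ [] (Rel.equiv .one .one (.interp a .one ρs) Rel.unit)
  | interpAll {k n m : ℕ} {Γ : Fin n → Typ S k} {Θ : Fin m → RelDecl S k} {a : ℕ}
      {ρs : Fin a → Rel S k n m} {τs τs' : Fin a → Typ S k} (σ : Typ S (a + 1)) :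
      (∀ i, IsAdm T Γ Θ (ρs i) (τs i) (τs' i)) →
        Prov T Γ Θ [] (Rel.equiv ((Ty.all σ).sub τs) ((Ty.all σ).sub τs')
          (.interp a (.all σ) ρs)
          (Rel.poly (σ.sub (Ty.lift τs)) (σ.sub (Ty.lift τs'))
            (.interp (a + 1) σ (cons (.var 0) (fun i => (ρs i).wk 2 0 1)))))
  | interpBang {k n m : ℕ} {Γ : Fin n → Typ S k} {Θ : Fin m → RelDecl S k} {a : ℕ}
      {ρs : Fin a → Rel S k n m} {τs τs' : Fin a → Typ S k} (σ : Typ S a) :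
      (∀ i, IsAdm T Γ Θ (ρs i) (τs i) (τs' i)) →
        Prov T Γ Θ [] (Rel.equiv ((Ty.bang σ).sub τs) ((Ty.bang σ).sub τs')
          (.interp a (.bang σ) ρs)
          (Rel.bang (σ.sub τs) (σ.sub τs') (.interp a σ ρs)))
  -- parametricity of the fixed point combinator
  | fixRel {k n m : ℕ} {Γ : Fin n → Typ S k} {Θ : Fin m → RelDecl S k} :
      Prov T Γ Θ [] (.rel (.interp 0 (Ty.fixTy 0) nil) .Y .Y)

end

/-! ## Extensionality and identity extension -/

/-- Both extensionality schemes hold in the logic with the additional axioms `T`: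
`(∀ x:σ. t x =_τ u x) ⊃ t =_{σ ⊸ τ} u` and `(∀ α. t α =_τ u α) ⊃ t =_{Πα.τ} u`. -/
def Extensionality {S : Sig.{u, v}} (T : Set (Form S 0 0 0)) : Prop :=
  (∀ {k n m : ℕ} (Γ : Fin n → Typ S k) (Θ : Fin m → RelDecl S k) (σ τ : Typ S k)
      (t u : Tm S k n),
      HasType Γ allIntu t (.lolli σ τ) → HasType Γ allIntu u (.lolli σ τ) →
        Prov T Γ Θ [] (.imp
          (.allTm σ (.eq τ (.app (t.wk 0 1) (.var 0)) (.app (u.wk 0 1) (.var 0))))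
          (.eq (.lolli σ τ) t u))) ∧
  (∀ {k n m : ℕ} (Γ : Fin n → Typ S k) (Θ : Fin m → RelDecl S k) (τ : Typ S (k + 1))
      (t u : Tm S k n),
      HasType Γ allIntu t (.all τ) → HasType Γ allIntu u (.all τ) →
        Prov T Γ Θ [] (.imp
          (.allTy (.eq τ (.tapp (t.wk 1 0) (.var 0)) (.tapp (u.wk 1 0) (.var 0))))
          (.eq (.all τ) t u)))

/-- The identity extension schema holds in the logic with the additional axioms `T`:
`σ[eq_{α₁},…,eq_{αₙ}] ≡ eq_σ` in the context `α₁,…,αₙ`, for all types `α₁,…,αₙ ⊢ σ`. -/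
def IdentityExtension {S : Sig.{u, v}} (T : Set (Form S 0 0 0)) : Prop :=
  ∀ (a : ℕ) (σ : Typ S a),
    Prov T (k := a) (n := 0) (m := 0) nil nil []
      (Rel.equiv σ σ (.interp a σ (fun i => Rel.eqRel (.var i))) (Rel.eqRel σ))

/-! ## Types as functors -/

section Functors

variable {S : Sig.{u, v}}

/-- The body of the functorial action of a type, by recursion on the type. Given
`g i : dom i ⊸ cod i` for the variables `i` of `σ`, this is a map `σ(dom) ⊸ σ(cod)`, provided that
the variables with `dom i ≠ cod i` occur only positively in `σ`. A variable bound by `Π` and a type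
constant are acted on by identities; on the left of `⊸` the roles of `dom` and `cod` are exchanged,
so that the result is then `σ(dom) ⊸ σ(cod)` for `g i : cod i ⊸ dom i` and negative variables. -/
def act : {a : ℕ} → Typ S a → {k n : ℕ} → (dom cod : Fin a → Typ S k) → (Fin a → Tm S k n) →
    Tm S k n
  | _, .var i, _, _, _, _, g => g i
  | _, .con c args, _, _, dom, _, _ => Tm.idTm ((Ty.con c args).sub dom)
  | _, .one, _, _, _, _, _ => Tm.idTm .one
  | _, .lolli σ τ, _, _, dom, cod, g =>
      -- `λ°h. λ°x. M_τ (h (M_σ x))`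
      .lam ((Ty.lolli σ τ).sub dom) (.lam (σ.sub cod)
        (.app (act τ dom cod (fun i => (g i).wk 0 2))
          (.app (.var 1) (.app (act σ cod dom (fun i => (g i).wk 0 2)) (.var 0)))))
  | _, .tensor σ τ, _, _, dom, cod, g =>
      -- `λ°z. let x ⊗ y be z in (M_σ x) ⊗ (M_τ y)`
      .lam ((Ty.tensor σ τ).sub dom) (.letTensor (σ.sub dom) (τ.sub dom) (.var 0)
        (.tensor (.app (act σ dom cod (fun i => (g i).wk 0 3)) (.var 1))
          (.app (act τ dom cod (fun i => (g i).wk 0 3)) (.var 0))))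
  | _, .bang σ, _, _, dom, cod, g =>
      -- `λ°x. let !y be x in !(M_σ y)`
      .lam ((Ty.bang σ).sub dom) (.letBang (σ.sub dom) (.var 0)
        (.bang (.app (act σ dom cod (fun i => (g i).wk 0 2)) (.var 0))))
  | _, .all σ, _, _, dom, cod, g =>
      -- `λ°z. Λω. M_σ (z ω)`
      .lam ((Ty.all σ).sub dom) (.tlam
        (.app (act σ (Ty.lift dom) (Ty.lift cod)
            (cons (Tm.idTm (.var 0)) (fun i => (g i).wk 1 1)))
          (.tapp (.var 0) (.var 0))))

/-- The closed term `M_σ = Λα. Λβ. λf. (…) : Πα. Πβ. (α ⊸ β) → σ(α) ⊸ σ(β)` of a type `α ⊢ σ(α)`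
with `α` occurring only positively. Here `λf:α ⊸ β. t` is the intuitionistic abstraction
`λ°y:!(α ⊸ β). let !f be y in t`. -/
def functorTm (σ : Typ S 1) : Tm S 0 0 :=
  .tlam (.tlam (.lam (.bang (.lolli (.var 1) (.var 0)))
    (.letBang (.lolli (.var 1) (.var 0)) (.var 0)
      (act σ (fun _ => .var 1) (fun _ => .var 0) (fun _ => .var 0)))))

/-- `σ(f) = M_σ τ τ' !f : σ(τ) ⊸ σ(τ')` for `f : τ ⊸ τ'`. -/
def fmap (σ : Typ S 1) {k n : ℕ} (τ τ' : Typ S k) (f : Tm S k n) : Tm S k n :=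
  .app (.tapp (.tapp ((functorTm σ).wk0 k n) τ) τ') (.bang f)

end Functors

/-! ## Existential and coinductive types -/

section Coinductive

variable {S : Sig.{u, v}}

/-- `∐α.σ = Πβ.(Πα.(σ ⊸ β)) ⊸ β` for `α ⊢ σ`. -/
def coprod (σ : Typ S 1) : Typ S 0 :=
  .all (.lolli (.all (.lolli (σ.ap (.var 0)) (.var 1))) (.var 0))

/-- `pack = Λα. λ°x:σ. Λβ. λ°f:Πα.(σ ⊸ β). f α x : Πα.(σ ⊸ ∐α.σ)`. -/
def pack (σ : Typ S 1) : Tm S 0 0 :=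
  .tlam (.lam σ (.tlam (.lam (.all (.lolli (σ.ap (.var 0)) (.var 1)))
    (.app (.tapp (.var 0) (.var 1)) (.var 1)))))

/-- The type `α ⊢ !(α ⊸ σ(α)) ⊗ α`. -/
def coalgTy (σ : Typ S 1) : Typ S 1 := .tensor (.bang (.lolli (.var 0) σ)) (.var 0)

/-- `να.σ(α) = ∐α. !(α ⊸ σ(α)) ⊗ α`. -/
def nu (σ : Typ S 1) : Typ S 0 := coprod (coalgTy σ)

/-- `unfold = Λα. λ°f:!(α ⊸ σ(α)). λ°x:α. pack α (f ⊗ x) : Πα.(α ⊸ σ(α)) → α ⊸ να.σ(α)`. -/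
def unfold (σ : Typ S 1) : Tm S 0 0 :=
  .tlam (.lam (.bang (.lolli (.var 0) σ)) (.lam (.var 0)
    (.app (.tapp ((pack (coalgTy σ)).wk0 1 2) (.var 0)) (.tensor (.var 1) (.var 0)))))

/-- `r = Λα. λ°y. let w ⊗ z be y in let !f be w in σ(unfold α !f) (f z)`, of type
`Πα. !(α ⊸ σ(α)) ⊗ α ⊸ σ(να.σ(α))`. -/
def outStep (σ : Typ S 1) : Tm S 0 0 :=
  .tlam (.lam (coalgTy σ) (.letTensor (.bang (.lolli (.var 0) σ)) (.var 0) (.var 0)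
    (.letBang (.lolli (.var 0) σ) (.var 1)
      (.app (fmap σ (.var 0) ((nu σ).wk0 1)
          (.app (.tapp ((unfold σ).wk0 1 4) (.var 0)) (.bang (.var 0))))
        (.app (.var 0) (.var 1))))))

/-- `out = λ°x:να.σ(α). x σ(να.σ(α)) r : να.σ(α) ⊸ σ(να.σ(α))`. -/
def out (σ : Typ S 1) : Tm S 0 0 :=
  .lam (nu σ) (.app (.tapp (.var 0) (σ.ap (nu σ))) ((outStep σ).wk0 0 1))

/-- `unfold τ !f`. -/
def unfoldAt (σ : Typ S 1) {k : ℕ} (τ : Typ S k) (f : Tm S k 0) : Tm S k 0 :=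
  .app (.tapp ((unfold σ).wk0 k 0) τ) (.bang f)

end Coinductive

/-! ## The category of linear maps and its coalgebras -/

section LinType

variable {S : Sig.{u, v}}

/-- `Ξ ∣ -; - ⊢ f : σ ⊸ τ`, where `Ξ` consists of `k` type variables: `f` represents a morphism from
`σ` to `τ` of `LinType_Ξ`. -/
def IsMap {k : ℕ} (σ τ : Typ S k) (f : Tm S k 0) : Prop := HasType nil allIntu f (.lolli σ τ)

/-- `f =_{σ ⊸ τ} g` is provable over `Ξ`: `f` and `g` represent the same morphism from `σ` to `τ` of
`LinType_Ξ`. -/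
def MapEq (T : Set (Form S 0 0 0)) {k : ℕ} (σ τ : Typ S k) (f g : Tm S k 0) : Prop :=
  Prov T (k := k) (n := 0) (m := 0) nil nil [] (.eq (.lolli σ τ) f g)

/-- `h : τ ⊸ τ'` is a map of coalgebras from `f : τ ⊸ σ(τ)` to `f' : τ' ⊸ σ(τ')`:
`f' ∘ h = σ(h) ∘ f` in `LinType_Ξ`. -/
def IsCoalgMap (T : Set (Form S 0 0 0)) (σ : Typ S 1) {k : ℕ} (τ τ' : Typ S k)
    (f f' h : Tm S k 0) : Prop :=
  IsMap τ τ' h ∧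
    MapEq T τ (σ.ap τ') (Tm.comp τ f' h) (Tm.comp τ (fmap σ τ τ' h) f)

/-- `(ν, o)` is a final coalgebra for `σ` in `LinType_Ξ`: from every coalgebra there is exactly one
morphism of `LinType_Ξ` to it that is a map of coalgebras. -/
def IsFinalCoalg (T : Set (Form S 0 0 0)) (σ : Typ S 1) {k : ℕ} (ν : Typ S k)
    (o : Tm S k 0) : Prop :=
  IsMap ν (σ.ap ν) o ∧
    ∀ (τ : Typ S k) (f : Tm S k 0), IsMap τ (σ.ap τ) f →
      ∃ h : Tm S k 0, IsCoalgMap T σ τ ν f o h ∧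
        ∀ h' : Tm S k 0, IsCoalgMap T σ τ ν f o h' → MapEq T τ ν h' h

end LinType

end LAPL

namespace LAPL

universe u v

/-! ## Syntax of types and terms under renaming and substitution -/

section Sequences

variable {A B : Type*} {n m l : ℕ}

@[simp] theorem cons_zero (a : A) (f : Fin n → A) : cons a f 0 = a := rfl

@[simp] theorem cons_succ (a : A) (f : Fin n → A) (i : Fin n) : cons a f i.succ = f i := rfl

@[simp] theorem cons_one (a b : A) (f : Fin n → A) : cons a (cons b f) 1 = b := rfl

@[simp] theorem up_zero : (up 0 : Fin n → Fin n) = id := rfl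

@[simp] theorem up_one (i : Fin n) : up 1 i = i.succ := rfl

@[simp] theorem up_two (i : Fin n) : up 2 i = i.succ.succ := rfl

@[simp] theorem up_three (i : Fin n) : up 3 i = i.succ.succ.succ := rfl

@[simp] theorem up_four (i : Fin n) : up 4 i = i.succ.succ.succ.succ := rfl

@[simp] theorem liftR_succ (r : Fin n → Fin m) (i : Fin n) : liftR r i.succ = (r i).succ := rfl

end Sequences

namespace Ty

variable {C : TySig.{u}}

@[simp] theorem lift_zero {k l : ℕ} (s : Fin k → Ty C l) : lift s 0 = var 0 := rfl

@[simp] theorem lift_succ {k l : ℕ} (s : Fin k → Ty C l) (i : Fin k) :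
    lift s i.succ = (s i).ren Fin.succ := rfl

theorem ren_eq_sub {k : ℕ} (σ : Ty C k) : ∀ {l : ℕ} (r : Fin k → Fin l),
    σ.ren r = σ.sub (fun i => var (r i)) := by
  induction σ with
  | all σ ih =>
    intro l r
    simp only [ren, sub, ih]
    congr 2
    funext i; refine Fin.cases rfl (fun _ => rfl) i
  | _ => intros; simp_all [ren, sub]

theorem ren_sub {k : ℕ} (σ : Ty C k) : ∀ {l l' : ℕ} (r : Fin k → Fin l) (s : Fin l → Ty C l'),
    (σ.ren r).sub s = σ.sub (fun i => s (r i)) := by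
  induction σ with
  | all σ ih =>
    intro l l' r s
    simp only [ren, sub, ih]
    congr 2
    funext i; refine Fin.cases rfl (fun _ => rfl) i
  | _ => intros; simp_all [ren, sub]

@[simp] theorem lift_var {k : ℕ} : lift (var : Fin k → Ty C k) = var := by
  funext i; refine Fin.cases rfl (fun _ => rfl) i

@[simp] theorem sub_var {k : ℕ} (σ : Ty C k) : σ.sub var = σ := by
  induction σ <;> simp_all [sub]

@[simp] theorem ren_id {k : ℕ} (σ : Ty C k) : σ.ren id = σ := by
  rw [ren_eq_sub]; exact sub_var σ

theorem ren_ren {k l l' : ℕ} (σ : Ty C k) (r : Fin k → Fin l) (s : Fin l → Fin l') :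
    (σ.ren r).ren s = σ.ren (fun i => s (r i)) := by
  rw [ren_eq_sub (σ.ren r), ren_sub, ren_eq_sub]

theorem sub_ren {k : ℕ} (σ : Ty C k) : ∀ {l l' : ℕ} (s : Fin k → Ty C l) (r : Fin l → Fin l'),
    (σ.sub s).ren r = σ.sub (fun i => (s i).ren r) := by
  induction σ with
  | all σ ih =>
    intro l l' s r
    simp only [ren, sub, ih]
    congr 2
    funext i; refine Fin.cases rfl (fun j => ?_) i
    simp [ren_ren]
  | _ => intros; simp_all [ren, sub]

theorem sub_sub {k : ℕ} (σ : Ty C k) : ∀ {l l' : ℕ} (s : Fin k → Ty C l) (t : Fin l → Ty C l'),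
    (σ.sub s).sub t = σ.sub (fun i => (s i).sub t) := by
  induction σ with
  | all σ ih =>
    intro l l' s t
    simp only [sub, ih]
    congr 2
    funext i; refine Fin.cases rfl (fun j => ?_) i
    simp [ren_sub, sub_ren]
  | _ => intros; simp_all [sub]

/-- The composite of two type substitutions under a binder. -/
theorem lift_sub {k l l' : ℕ} (s : Fin k → Ty C l) (t : Fin l → Ty C l') :
    (fun i => (lift s i).sub (lift t)) = lift (fun i => (s i).sub t) := by
  funext i; refine Fin.cases rfl (fun j => ?_) i
  simp [ren_sub, sub_ren]

@[simp] theorem ap_ren (σ : Ty C 1) {k l : ℕ} (τ : Ty C k) (r : Fin k → Fin l) :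
    (σ.ap τ).ren r = σ.ap (τ.ren r) := sub_ren ..

@[simp] theorem ap_sub (σ : Ty C 1) {k l : ℕ} (τ : Ty C k) (s : Fin k → Ty C l) :
    (σ.ap τ).sub s = σ.ap (τ.sub s) := sub_sub ..

@[simp] theorem ap_var (σ : Ty C 1) : σ.ap (var 0) = σ := by
  have : (fun _ => var 0 : Fin 1 → Ty C 1) = var := by
    funext i; rw [Subsingleton.elim i 0]
  rw [ap, this, sub_var]

@[simp] theorem wk0_ren (σ : Ty C 0) {k l : ℕ} (r : Fin k → Fin l) :
    (σ.wk0 k).ren r = σ.wk0 l := by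
  rw [wk0, ren_ren, wk0]; congr 1; exact Subsingleton.elim _ _

@[simp] theorem wk0_sub (σ : Ty C 0) {k l : ℕ} (s : Fin k → Ty C l) :
    (σ.wk0 k).sub s = σ.wk0 l := by
  rw [wk0, ren_sub, wk0, ren_eq_sub]; congr 1; exact Subsingleton.elim _ _

@[simp] theorem wk0_zero (σ : Ty C 0) : σ.wk0 0 = σ := by
  rw [wk0, Subsingleton.elim (nil : Fin 0 → Fin 0) id, ren_id]

theorem wk0_eq_sub (σ : Ty C 0) {k : ℕ} (s : Fin 0 → Ty C k) : σ.sub s = σ.wk0 k := by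
  rw [wk0, ren_eq_sub]; congr 1; exact Subsingleton.elim _ _

/-- Substitution into a type weakened by one variable. -/
@[simp] theorem ren_succ_inst {k : ℕ} (σ τ : Ty C k) : (σ.ren Fin.succ).sub (cons τ var) = σ := by
  simp [ren_sub]

end Ty

namespace Tm

variable {S : Sig.{u, v}}

@[simp] theorem lift_zero {l n m : ℕ} (s : Fin n → Tm S l m) : lift s 0 = var 0 := rfl

@[simp] theorem lift_succ {l n m : ℕ} (s : Fin n → Tm S l m) (i : Fin n) :
    lift s i.succ = (s i).ren id Fin.succ := rfl

theorem ren_eq_sub {k n : ℕ} (t : Tm S k n) :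
    ∀ {l m : ℕ} (p : Fin k → Fin l) (q : Fin n → Fin m),
      t.ren p q = t.sub (fun i => .var (p i)) (fun i => .var (q i)) := by
  have hq : ∀ {n m l : ℕ} (q : Fin n → Fin m),
      (fun i => (.var (liftR q i) : Tm S l _)) = lift (fun i => .var (q i)) := by
    intro n m l q; funext i; refine Fin.cases rfl (fun _ => rfl) i
  have hp : ∀ {n m : ℕ} (q : Fin n → Fin m),
      (fun i => (.var (liftR q i) : Typ S _)) = Ty.lift (fun i => .var (q i)) := by
    intro n m q; funext i; refine Fin.cases rfl (fun _ => rfl) i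
  induction t with
  | var i => intros; rfl
  | con c => intros; rfl
  | star => intros; rfl
  | Y => intros; rfl
  | lam σ t ih => intros; simp only [ren, sub, hq, hp, Ty.ren_eq_sub, ih]
  | app t s ih₁ ih₂ => intros; simp only [ren, sub, hq, hp, Ty.ren_eq_sub, ih₁, ih₂]
  | tensor t s ih₁ ih₂ => intros; simp only [ren, sub, hq, hp, Ty.ren_eq_sub, ih₁, ih₂]
  | bang t ih => intros; simp only [ren, sub, hq, hp, Ty.ren_eq_sub, ih]
  | tlam t ih => intros; simp only [ren, sub, hq, hp, Ty.ren_eq_sub, ih]; rfl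
  | tapp t σ ih => intros; simp only [ren, sub, hq, hp, Ty.ren_eq_sub, ih]
  | letTensor σ τ s t ih₁ ih₂ => intros; simp only [ren, sub, hq, hp, Ty.ren_eq_sub, ih₁, ih₂]
  | letBang σ s t ih₁ ih₂ => intros; simp only [ren, sub, hq, hp, Ty.ren_eq_sub, ih₁, ih₂]
  | letStar t s ih₁ ih₂ => intros; simp only [ren, sub, hq, hp, Ty.ren_eq_sub, ih₁, ih₂]

theorem ren_sub {k n : ℕ} (t : Tm S k n) :
    ∀ {l m l' m' : ℕ} (p : Fin k → Fin l) (q : Fin n → Fin m)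
      (p' : Fin l → Typ S l') (q' : Fin m → Tm S l' m'),
      (t.ren p q).sub p' q' = t.sub (fun i => p' (p i)) (fun i => q' (q i)) := by
  have hq : ∀ {n m l m' : ℕ} (q : Fin n → Fin m) (q' : Fin m → Tm S l m'),
      (fun i => lift q' (liftR q i)) = lift (fun i => q' (q i)) := by
    intro n m l m' q q'; funext i; refine Fin.cases rfl (fun _ => rfl) i
  have hp : ∀ {n m l : ℕ} (q : Fin n → Fin m) (q' : Fin m → Typ S l),
      (fun i => Ty.lift q' (liftR q i)) = Ty.lift (fun i => q' (q i)) := by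
    intro n m l q q'; funext i; refine Fin.cases rfl (fun _ => rfl) i
  induction t with
  | var i => intros; rfl
  | con c => intros; rfl
  | star => intros; rfl
  | Y => intros; rfl
  | lam σ t ih => intros; simp only [ren, sub, hq, hp, Ty.ren_sub, ih]
  | app t s ih₁ ih₂ => intros; simp only [ren, sub, hq, hp, Ty.ren_sub, ih₁, ih₂]
  | tensor t s ih₁ ih₂ => intros; simp only [ren, sub, hq, hp, Ty.ren_sub, ih₁, ih₂]
  | bang t ih => intros; simp only [ren, sub, hq, hp, Ty.ren_sub, ih]
  | tlam t ih => intros; simp only [ren, sub, hq, hp, Ty.ren_sub, ih]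
  | tapp t σ ih => intros; simp only [ren, sub, hq, hp, Ty.ren_sub, ih]
  | letTensor σ τ s t ih₁ ih₂ => intros; simp only [ren, sub, hq, hp, Ty.ren_sub, ih₁, ih₂]
  | letBang σ s t ih₁ ih₂ => intros; simp only [ren, sub, hq, hp, Ty.ren_sub, ih₁, ih₂]
  | letStar t s ih₁ ih₂ => intros; simp only [ren, sub, hq, hp, Ty.ren_sub, ih₁, ih₂]

@[simp] theorem lift_var {l n : ℕ} : lift (var : Fin n → Tm S l n) = var := by
  funext i; refine Fin.cases rfl (fun _ => rfl) i

@[simp] theorem sub_var {k n : ℕ} (t : Tm S k n) : t.sub Ty.var var = t := by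
  induction t <;> simp_all [sub]
  case tlam t ih => exact ih

@[simp] theorem ren_id {k n : ℕ} (t : Tm S k n) : t.ren id id = t := by
  rw [ren_eq_sub]; exact sub_var t

theorem ren_ren {k n l m l' m' : ℕ} (t : Tm S k n) (p : Fin k → Fin l) (q : Fin n → Fin m)
    (p' : Fin l → Fin l') (q' : Fin m → Fin m') :
    (t.ren p q).ren p' q' = t.ren (fun i => p' (p i)) (fun i => q' (q i)) := by
  rw [ren_eq_sub (t.ren p q), ren_sub, ren_eq_sub]

theorem sub_ren {k n : ℕ} (t : Tm S k n) :
    ∀ {l m l' m' : ℕ} (p : Fin k → Typ S l) (q : Fin n → Tm S l m)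
      (p' : Fin l → Fin l') (q' : Fin m → Fin m'),
      (t.sub p q).ren p' q' = t.sub (fun i => (p i).ren p') (fun i => (q i).ren p' q') := by
  have hq : ∀ {n m l m' l' : ℕ} (q : Fin n → Tm S l m) (p' : Fin l → Fin l')
      (q' : Fin m → Fin m'),
      (fun i => (lift q i).ren p' (liftR q')) = lift (fun i => (q i).ren p' q') := by
    intro n m l m' l' q p' q'; funext i; refine Fin.cases rfl (fun _ => ?_) i
    simp [ren_ren]
  have hp : ∀ {n m l : ℕ} (p : Fin n → Typ S m) (p' : Fin m → Fin l),
      (fun i => (Ty.lift p i).ren (liftR p')) = Ty.lift (fun i => (p i).ren p') := by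
    intro n m l q q'; funext i; refine Fin.cases rfl (fun _ => ?_) i
    simp [Ty.ren_ren]
  induction t with
  | var i => intros; rfl
  | con c => intros; rfl
  | star => intros; rfl
  | Y => intros; rfl
  | lam σ t ih => intros; simp only [ren, sub, hq, hp, Ty.sub_ren, ih]
  | app t s ih₁ ih₂ => intros; simp only [ren, sub, hq, hp, Ty.sub_ren, ih₁, ih₂]
  | tensor t s ih₁ ih₂ => intros; simp only [ren, sub, hq, hp, Ty.sub_ren, ih₁, ih₂]
  | bang t ih => intros; simp only [ren, sub, hq, hp, Ty.sub_ren, ih]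
  | tlam t ih => intros; simp only [ren, sub, hq, hp, Ty.sub_ren, ih]; simp only [wk, ren_ren]; rfl
  | tapp t σ ih => intros; simp only [ren, sub, hq, hp, Ty.sub_ren, ih]
  | letTensor σ τ s t ih₁ ih₂ => intros; simp only [ren, sub, hq, hp, Ty.sub_ren, ih₁, ih₂]
  | letBang σ s t ih₁ ih₂ => intros; simp only [ren, sub, hq, hp, Ty.sub_ren, ih₁, ih₂]
  | letStar t s ih₁ ih₂ => intros; simp only [ren, sub, hq, hp, Ty.sub_ren, ih₁, ih₂]

theorem sub_sub {k n : ℕ} (t : Tm S k n) :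
    ∀ {l m l' m' : ℕ} (p : Fin k → Typ S l) (q : Fin n → Tm S l m)
      (p' : Fin l → Typ S l') (q' : Fin m → Tm S l' m'),
      (t.sub p q).sub p' q' = t.sub (fun i => (p i).sub p') (fun i => (q i).sub p' q') := by
  have hq : ∀ {n m l m' l' : ℕ} (q : Fin n → Tm S l m) (p' : Fin l → Typ S l')
      (q' : Fin m → Tm S l' m'),
      (fun i => (lift q i).sub p' (lift q')) = lift (fun i => (q i).sub p' q') := by
    intro n m l m' l' q p' q'; funext i; refine Fin.cases rfl (fun _ => ?_) i
    simp [ren_sub, sub_ren]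
  induction t with
  | var i => intros; rfl
  | con c => intros; rfl
  | star => intros; rfl
  | Y => intros; rfl
  | lam σ t ih => intros; simp only [sub, hq, Ty.lift_sub, Ty.sub_sub, ih]
  | app t s ih₁ ih₂ => intros; simp only [sub, hq, Ty.lift_sub, Ty.sub_sub, ih₁, ih₂]
  | tensor t s ih₁ ih₂ => intros; simp only [sub, hq, Ty.lift_sub, Ty.sub_sub, ih₁, ih₂]
  | bang t ih => intros; simp only [sub, hq, Ty.lift_sub, Ty.sub_sub, ih]
  | tlam t ih => intros; simp only [sub, hq, Ty.lift_sub, Ty.sub_sub, ih]; simp only [wk, ren_sub, sub_ren]; rfl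
  | tapp t σ ih => intros; simp only [sub, hq, Ty.lift_sub, Ty.sub_sub, ih]
  | letTensor σ τ s t ih₁ ih₂ => intros; simp only [sub, hq, Ty.lift_sub, Ty.sub_sub, ih₁, ih₂]
  | letBang σ s t ih₁ ih₂ => intros; simp only [sub, hq, Ty.lift_sub, Ty.sub_sub, ih₁, ih₂]
  | letStar t s ih₁ ih₂ => intros; simp only [sub, hq, Ty.lift_sub, Ty.sub_sub, ih₁, ih₂]

@[simp] theorem wk0_ren (t : Tm S 0 0) {k n l m : ℕ} (p : Fin k → Fin l) (q : Fin n → Fin m) :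
    (t.wk0 k n).ren p q = t.wk0 l m := by
  rw [wk0, ren_ren, wk0]; congr 1 <;> exact Subsingleton.elim _ _

@[simp] theorem wk0_sub (t : Tm S 0 0) {k n l m : ℕ} (p : Fin k → Typ S l)
    (q : Fin n → Tm S l m) : (t.wk0 k n).sub p q = t.wk0 l m := by
  rw [wk0, ren_sub, wk0, ren_eq_sub]; congr 1 <;> exact Subsingleton.elim _ _

@[simp] theorem idTm_ren {k n l m : ℕ} (σ : Typ S k) (p : Fin k → Fin l) (q : Fin n → Fin m) :
    (idTm σ).ren p q = idTm (σ.ren p) := rfl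

@[simp] theorem idTm_sub {k n l m : ℕ} (σ : Typ S k) (p : Fin k → Typ S l)
    (q : Fin n → Tm S l m) : (idTm σ).sub p q = idTm (σ.sub p) := rfl

@[simp] theorem ren_succ_sub {k n : ℕ} (t u : Tm S k n) :
    (t.ren id Fin.succ).sub Ty.var (cons u var) = t := by
  rw [ren_sub]; exact sub_var t

@[simp] theorem wk_sub_cons {k n : ℕ} (t u : Tm S k n) :
    (t.wk 0 1).sub Ty.var (cons u var) = t := ren_succ_sub t u

@[simp] theorem wk_tinst {k n : ℕ} (t : Tm S k n) (σ : Typ S k) : (t.wk 1 0).tinst σ = t := by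
  rw [tinst, wk, ren_sub]; exact sub_var t

end Tm

section Weakening

variable {S : Sig.{u, v}}

theorem Tm.wk_sub {k n l m c b : ℕ} (t : Tm S k n) {p : Fin k → Typ S l} {q : Fin n → Tm S l m}
    {P : Fin (k + c) → Typ S (l + c)} {Q : Fin (n + b) → Tm S (l + c) (m + b)}
    (hP : ∀ i, P (up c i) = (p i).ren (up c)) (hQ : ∀ i, Q (up b i) = (q i).wk c b) :
    (t.wk c b).sub P Q = (t.sub p q).wk c b := by
  simp only [wk, ren_sub, sub_ren, hP, hQ]

theorem Tm.lift_lift_up {l n m : ℕ} (q : Fin n → Tm S l m) (i : Fin n) :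
    lift (lift q) (up 2 i) = (q i).wk 0 2 := by
  simp only [up_two, lift_succ, ren_ren]; rfl

theorem Tm.lift_lift_lift_up {l n m : ℕ} (q : Fin n → Tm S l m) (i : Fin n) :
    lift (lift (lift q)) (up 3 i) = (q i).wk 0 3 := by
  simp only [up_three, lift_succ, ren_ren]; rfl

end Weakening

section Functors

variable {S : Sig.{u, v}}

theorem act_sub : ∀ {a : ℕ} (σ : Typ S a) {k n l m : ℕ} (dom cod : Fin a → Typ S k)
    (g : Fin a → Tm S k n) (p : Fin k → Typ S l) (q : Fin n → Tm S l m),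
    (act σ dom cod g).sub p q =
      act σ (fun i => (dom i).sub p) (fun i => (cod i).sub p) (fun i => (g i).sub p q) := by
  intro a σ
  induction σ with
  | var i => intros; rfl
  | con c args => intros; simp [act, Ty.sub_sub, Ty.sub]
  | one => intros; rfl
  | lolli σ τ ih₁ ih₂ =>
    intro k n l m dom cod g p q
    have h : ∀ i, ((g i).wk 0 2).sub p (Tm.lift (Tm.lift q)) = ((g i).sub p q).wk 0 2 :=
      fun i => (g i).wk_sub (fun i => (Ty.ren_id _).symm) (Tm.lift_lift_up q)
    simp only [act, Tm.sub, ih₁, ih₂, Ty.sub_sub, h]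
    rfl
  | tensor σ τ ih₁ ih₂ =>
    intro k n l m dom cod g p q
    have h : ∀ i, ((g i).wk 0 3).sub p (Tm.lift (Tm.lift (Tm.lift q))) =
        ((g i).sub p q).wk 0 3 :=
      fun i => (g i).wk_sub (fun i => (Ty.ren_id _).symm) (Tm.lift_lift_lift_up q)
    simp only [act, Tm.sub, ih₁, ih₂, Ty.sub_sub, h]
    rfl
  | bang σ ih =>
    intro k n l m dom cod g p q
    have h : ∀ i, ((g i).wk 0 2).sub p (Tm.lift (Tm.lift q)) = ((g i).sub p q).wk 0 2 :=
      fun i => (g i).wk_sub (fun i => (Ty.ren_id _).symm) (Tm.lift_lift_up q)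
    simp only [act, Tm.sub, ih, Ty.sub_sub, h]
    rfl
  | all σ ih =>
    intro k n l m dom cod g p q
    have h : ∀ i, ((g i).wk 1 1).sub (Ty.lift p) (fun i => (Tm.lift q i).wk 1 0) =
        ((g i).sub p q).wk 1 1 :=
      fun i => (g i).wk_sub (fun i => rfl) (fun i => Tm.ren_ren ..)
    simp only [act, Tm.sub, ih, Ty.sub_sub, Ty.lift_sub]
    congr 3
    refine congrArg (act σ _ _) ?_
    funext i
    exact Fin.cases rfl h i

@[simp] theorem fmap_ren (σ : Typ S 1) {k n l m : ℕ} (τ τ' : Typ S k) (f : Tm S k n)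
    (p : Fin k → Fin l) (q : Fin n → Fin m) :
    (fmap σ τ τ' f).ren p q = fmap σ (τ.ren p) (τ'.ren p) (f.ren p q) := by
  simp [fmap, Tm.ren]

@[simp] theorem fmap_sub (σ : Typ S 1) {k n l m : ℕ} (τ τ' : Typ S k) (f : Tm S k n)
    (p : Fin k → Typ S l) (q : Fin n → Tm S l m) :
    (fmap σ τ τ' f).sub p q = fmap σ (τ.sub p) (τ'.sub p) (f.sub p q) := by
  simp [fmap, Tm.sub]

end Functors

/-! ## Typing under renaming and substitution -/

section Modes

variable {n m l : ℕ}

/-- The intuitionistic part of a mode. -/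
def Mode.nolin : Mode → Mode
  | .intu => .intu
  | _ => .off

/-- The intuitionistic part of a context. -/
def nolin (d : Fin n → Mode) : Fin n → Mode := fun i => (d i).nolin

theorem noLin_nolin (d : Fin n → Mode) : NoLin (nolin d) := by
  intro i; unfold nolin; cases d i <;> simp [Mode.nolin]

theorem NoLin.nolin_eq {d : Fin n → Mode} (h : NoLin d) : nolin d = d := by
  funext i; have := h i; unfold nolin; cases hd : d i <;> simp_all [Mode.nolin]

theorem noLin_allIntu : NoLin (allIntu : Fin n → Mode) := by intro i; simp [allIntu]

theorem NoLin.splits {d : Fin n → Mode} (h : NoLin d) : Splits d d d := by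
  intro i; have := h i
  cases hd : d i
  · exact .intu
  · exact absurd hd this
  · exact .off

theorem Splits.nolin_left {d d₁ d₂ : Fin n → Mode} (h : Splits d d₁ d₂) :
    nolin d₁ = nolin d := by
  funext i; have := h i; unfold nolin
  generalize d i = a at this; generalize d₁ i = b at this; generalize d₂ i = c at this
  cases this <;> rfl

theorem Splits.nolin_right {d d₁ d₂ : Fin n → Mode} (h : Splits d d₁ d₂) :
    nolin d₂ = nolin d := by
  funext i; have := h i; unfold nolin
  generalize d i = a at this; generalize d₁ i = b at this; generalize d₂ i = c at this
  cases this <;> rfl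

theorem Splits.cons {a b c : Mode} {d d₁ d₂ : Fin n → Mode} (h : Splits d d₁ d₂)
    (h₀ : Mode.Split a b c) : Splits (cons a d) (cons b d₁) (cons c d₂) := by
  intro i; exact Fin.cases h₀ h i

theorem NoLin.cons {a : Mode} {d : Fin n → Mode} (h : NoLin d) (h₀ : a ≠ .lin) :
    NoLin (cons a d) := by
  intro i; exact Fin.cases h₀ h i

theorem cons_allIntu : cons Mode.intu (allIntu : Fin n → Mode) = allIntu := by
  funext i; exact Fin.cases rfl (fun _ => rfl) i

/-- The partial map `κ` is a bijection between the linear variables of `d` in its domain and the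
linear variables of `d'`. -/
structure Track (d : Fin n → Mode) (d' : Fin m → Mode) (κ : Fin n → Option (Fin m)) : Prop where
  keep : ∀ i j, d i = .lin → κ i = some j → d' j = .lin
  surj : ∀ j, d' j = .lin → ∃ i, d i = .lin ∧ κ i = some j
  inj : ∀ i i' j, d i = .lin → d i' = .lin → κ i = some j → κ i' = some j → i = i'

theorem Track.noLin {d : Fin n → Mode} {d' : Fin m → Mode} {κ : Fin n → Option (Fin m)}
    (h : Track d d' κ) (hd : NoLin d) : NoLin d' := by
  intro j hj
  obtain ⟨i, hi, -⟩ := h.surj j hj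
  exact hd i hi

open Classical in
theorem Track.split {d d₁ d₂ : Fin n → Mode} {d' : Fin m → Mode} {κ : Fin n → Option (Fin m)}
    (h : Track d d' κ) (hs : Splits d d₁ d₂) :
    ∃ d₁' d₂', Splits d' d₁' d₂' ∧ Track d₁ d₁' κ ∧ Track d₂ d₂' κ := by
  have h1 : ∀ i, d₁ i = .lin → d i = .lin ∧ d₂ i = .off := by
    intro i hi; have := hs i; rw [hi] at this
    generalize d i = a at *; generalize d₂ i = b at *; cases this; exact ⟨rfl, rfl⟩
  have h2 : ∀ i, d₂ i = .lin → d i = .lin ∧ d₁ i = .off := by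
    intro i hi; have := hs i; rw [hi] at this
    generalize d i = a at *; generalize d₁ i = b at *; cases this; exact ⟨rfl, rfl⟩
  have h3 : ∀ i, d i = .lin → d₁ i = .lin ∨ d₂ i = .lin := by
    intro i hi; have := hs i; rw [hi] at this
    generalize d₁ i = a at *; generalize d₂ i = b at *; cases this <;> simp
  let e : Fin m → Prop := fun j => ∃ i, d₁ i = .lin ∧ κ i = some j
  refine ⟨fun j => if d' j = .lin then (if e j then .lin else .off) else d' j,
    fun j => if d' j = .lin then (if e j then .off else .lin) else d' j, ?_, ?_, ?_⟩
  · intro j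
    cases hj : d' j
    · simp [hj]; exact .intu
    · by_cases he : e j
      · simp [hj, he]; exact .left
      · simp [hj, he]; exact .right
    · simp [hj]; exact .off
  · refine ⟨fun i j hi hk => ?_, fun j hj => ?_, fun i i' j hi hi' => ?_⟩
    · have he : e j := ⟨i, hi, hk⟩
      simp [h.keep i j (h1 i hi).1 hk, he]
    · split_ifs at hj with ha hb
      · exact hb
      · exact absurd hj ha
    · exact h.inj i i' j (h1 i hi).1 (h1 i' hi').1
  · refine ⟨fun i j hi hk => ?_, fun j hj => ?_, fun i i' j hi hi' => ?_⟩
    · have he : ¬ e j := by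
        rintro ⟨i', hi', hk'⟩
        have := h.inj i' i j (h1 i' hi').1 (h2 i hi).1 hk' hk
        subst this
        rw [(h2 _ hi).2] at hi'; exact Mode.noConfusion hi'
      simp [h.keep i j (h2 i hi).1 hk, he]
    · split_ifs at hj with ha hb
      · obtain ⟨i, hi, hk⟩ := h.surj j ha
        exact ⟨i, (h3 i hi).resolve_left fun h' => hb ⟨i, h', hk⟩, hk⟩
      · exact absurd hj ha
    · exact h.inj i i' j (h2 i hi).1 (h2 i' hi').1

/-- Lifting of a partial map under a binder. -/
def liftK (κ : Fin n → Option (Fin m)) : Fin (n + 1) → Option (Fin (m + 1)) :=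
  cons (some 0) (fun i => (κ i).map Fin.succ)

theorem Track.lift {d : Fin n → Mode} {d' : Fin m → Mode} {κ : Fin n → Option (Fin m)}
    (h : Track d d' κ) (a : Mode) : Track (cons a d) (cons a d') (liftK κ) := by
  refine ⟨fun i => ?_, fun j => ?_, fun i i' => ?_⟩
  · refine Fin.cases (fun j ha hj => ?_) (fun i j hi hj => ?_) i
    · simp only [liftK, cons_zero, Option.some.injEq] at hj
      subst hj; exact ha
    · simp only [liftK, cons_succ, Option.map_eq_some_iff] at hj
      obtain ⟨j, hj, rfl⟩ := hj
      exact h.keep i j hi hj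
  · refine Fin.cases (fun ha => ⟨0, ha, rfl⟩) (fun j hj => ?_) j
    obtain ⟨i, hi, hk⟩ := h.surj j hj
    exact ⟨i.succ, hi, by simp [liftK, hk]⟩
  · refine Fin.cases ?_ (fun i => ?_) i <;> refine Fin.cases ?_ (fun i' => ?_) i'
    · intros; rfl
    · intro j _ _ h1 h2
      simp only [liftK, cons_zero, cons_succ, Option.some.injEq, Option.map_eq_some_iff] at h1 h2
      obtain ⟨j', _, rfl⟩ := h2
      exact absurd h1.symm (Fin.succ_ne_zero _)
    · intro j _ _ h1 h2
      simp only [liftK, cons_zero, cons_succ, Option.some.injEq, Option.map_eq_some_iff] at h1 h2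
      obtain ⟨j', _, rfl⟩ := h1
      exact absurd h2.symm (Fin.succ_ne_zero _)
    · intro j ha hb h1 h2
      simp only [liftK, cons_succ, Option.map_eq_some_iff] at h1 h2
      obtain ⟨j₁, h1, rfl⟩ := h1
      obtain ⟨j₂, h2, h3⟩ := h2
      rw [Fin.succ_inj] at h3
      subst h3
      rw [h.inj i i' _ ha hb h1 h2]

end Modes

section Typing

variable {S : Sig.{u, v}}

theorem Ty.inst_ren {C : TySig.{u}} {k l : ℕ} (σ : Ty C (k + 1)) (τ : Ty C k)
    (p : Fin k → Fin l) : (σ.inst τ).ren p = (σ.ren (liftR p)).inst (τ.ren p) := by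
  simp only [inst, sub_ren, ren_sub]
  congr 1; funext i; exact Fin.cases rfl (fun _ => rfl) i

theorem Ty.inst_sub {C : TySig.{u}} {k l : ℕ} (σ : Ty C (k + 1)) (τ : Ty C k)
    (p : Fin k → Ty C l) : (σ.inst τ).sub p = (σ.sub (Ty.lift p)).inst (τ.sub p) := by
  simp only [inst, sub_sub]
  congr 1; funext i; exact Fin.cases rfl (fun i => by simp [Ty.sub]) i

theorem HasType.ren {k n : ℕ} {Γ : Fin n → Typ S k} {d : Fin n → Mode} {t : Tm S k n}
    {τ : Typ S k} (h : HasType Γ d t τ) :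
    ∀ {l m : ℕ} {Γ' : Fin m → Typ S l} {d' : Fin m → Mode} {p : Fin k → Fin l}
      {q : Fin n → Fin m}, (∀ i, Γ' (q i) = (Γ i).ren p) → (∀ i, d i = .intu → d' (q i) = .intu) →
      Track d d' (fun i => some (q i)) → HasType Γ' d' (t.ren p q) (τ.ren p) := by
  have hk : ∀ {n m : ℕ} (q : Fin n → Fin m),
      liftK (fun i => some (q i)) = fun i => some (liftR q i) := by
    intro n m q; funext i; exact Fin.cases rfl (fun _ => rfl) i
  have hsl : ∀ {n m : ℕ} {d d₁ d₂ : Fin n → Mode} {d' d₁' d₂' : Fin m → Mode} {q : Fin n → Fin m},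
      Splits d d₁ d₂ → Splits d' d₁' d₂' → (∀ i, d i = .intu → d' (q i) = .intu) →
      ((∀ i, d₁ i = .intu → d₁' (q i) = .intu) ∧ (∀ i, d₂ i = .intu → d₂' (q i) = .intu)) := by
    intro n m d d₁ d₂ d' d₁' d₂' q hs hs' hi
    constructor <;> intro i h1
    · have := hs i; rw [h1] at this
      have h2 := hi i (by generalize d i = a at *; generalize d₂ i = b at *; cases this; rfl)
      have := hs' (q i); rw [h2] at this
      generalize d₁' (q i) = a at *; generalize d₂' (q i) = b at *; cases this; rfl
    · have := hs i; rw [h1] at this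
      have h2 := hi i (by generalize d i = a at *; generalize d₁ i = b at *; cases this; rfl)
      have := hs' (q i); rw [h2] at this
      generalize d₁' (q i) = a at *; generalize d₂' (q i) = b at *; cases this; rfl
  have hG : ∀ {k l n m : ℕ} {Γ : Fin n → Typ S k} {Γ' : Fin m → Typ S l} {p : Fin k → Fin l}
      {q : Fin n → Fin m} (σ : Typ S k), (∀ i, Γ' (q i) = (Γ i).ren p) →
      ∀ i, cons (σ.ren p) Γ' (liftR q i) = (cons σ Γ i).ren p := by
    intro k l n m Γ Γ' p q σ h i; exact Fin.cases rfl h i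
  have hI : ∀ {n m : ℕ} {d : Fin n → Mode} {d' : Fin m → Mode} {q : Fin n → Fin m} (a : Mode),
      (∀ i, d i = .intu → d' (q i) = .intu) →
      ∀ i, cons a d i = .intu → cons a d' (liftR q i) = .intu := by
    intro n m d d' q a h i; exact Fin.cases id h i
  induction h with
  | star hd => intro l m Γ' d' p q hΓ hi ht; exact .star (ht.noLin hd)
  | con c hd => intro l m Γ' d' p q hΓ hi ht; rw [Ty.wk0_ren]; exact .con c (ht.noLin hd)
  | Y hd => intro l m Γ' d' p q hΓ hi ht; exact .Y (ht.noLin hd)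
  | varIntu i h hd =>
    intro l m Γ' d' p q hΓ hi ht
    rw [← hΓ]; exact .varIntu _ (hi i h) (ht.noLin hd)
  | varLin i h hd =>
    intro l m Γ' d' p q hΓ hi ht
    rw [← hΓ]
    refine .varLin _ (ht.keep i _ h rfl) fun j hj hl => ?_
    obtain ⟨i', hi', hk'⟩ := ht.surj j hl
    by_cases e : i' = i
    · subst e; exact hj (Option.some.inj hk').symm
    · exact hd i' e hi'
  | app hs _ _ ih₁ ih₂ =>
    intro l m Γ' d' p q hΓ hi ht
    obtain ⟨d₁', d₂', hs', t₁, t₂⟩ := ht.split hs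
    obtain ⟨i₁, i₂⟩ := hsl hs hs' hi
    exact .app hs' (ih₁ hΓ i₁ t₁) (ih₂ hΓ i₂ t₂)
  | lam _ ih =>
    intro l m Γ' d' p q hΓ hi ht
    exact .lam (ih (hG _ hΓ) (hI _ hi) (hk q ▸ ht.lift _))
  | tensor hs _ _ ih₁ ih₂ =>
    intro l m Γ' d' p q hΓ hi ht
    obtain ⟨d₁', d₂', hs', t₁, t₂⟩ := ht.split hs
    obtain ⟨i₁, i₂⟩ := hsl hs hs' hi
    exact .tensor hs' (ih₁ hΓ i₁ t₁) (ih₂ hΓ i₂ t₂)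
  | bang hd _ ih =>
    intro l m Γ' d' p q hΓ hi ht
    exact .bang (ht.noLin hd) (ih hΓ hi ht)
  | tlam _ ih =>
    intro l m Γ' d' p q hΓ hi ht
    refine .tlam (ih (fun i => ?_) hi ht)
    simp only [wkCx, hΓ, Ty.ren_ren]; rfl
  | tapp τ _ ih =>
    intro l m Γ' d' p q hΓ hi ht
    rw [Ty.inst_ren]; exact .tapp _ (ih hΓ hi ht)
  | letTensor hs _ _ ih₁ ih₂ =>
    intro l m Γ' d' p q hΓ hi ht
    obtain ⟨d₁', d₂', hs', t₁, t₂⟩ := ht.split hs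
    obtain ⟨i₁, i₂⟩ := hsl hs hs' hi
    refine .letTensor hs' (ih₁ hΓ i₁ t₁) (ih₂ (hG _ (hG _ hΓ)) (hI _ (hI _ i₂)) ?_)
    rw [← hk, ← hk]; exact (t₂.lift _).lift _
  | letBang hs _ _ ih₁ ih₂ =>
    intro l m Γ' d' p q hΓ hi ht
    obtain ⟨d₁', d₂', hs', t₁, t₂⟩ := ht.split hs
    obtain ⟨i₁, i₂⟩ := hsl hs hs' hi
    exact .letBang hs' (ih₁ hΓ i₁ t₁) (ih₂ (hG _ hΓ) (hI _ i₂) (hk q ▸ t₂.lift _))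
  | letStar hs _ _ ih₁ ih₂ =>
    intro l m Γ' d' p q hΓ hi ht
    obtain ⟨d₁', d₂', hs', t₁, t₂⟩ := ht.split hs
    obtain ⟨i₁, i₂⟩ := hsl hs hs' hi
    exact .letStar hs' (ih₁ hΓ i₁ t₁) (ih₂ hΓ i₂ t₂)

theorem Track.of_noLin {n m : ℕ} {d : Fin n → Mode} {d' : Fin m → Mode}
    {κ : Fin n → Option (Fin m)} (h : NoLin d) (h' : NoLin d') : Track d d' κ :=
  ⟨fun i _ hi => absurd hi (h i), fun j hj => absurd hj (h' j), fun i _ _ hi => absurd hi (h i)⟩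

/-- Renaming of a term all of whose variables are intuitionistic. -/
theorem HasType.ren_noLin {k n l m : ℕ} {Γ : Fin n → Typ S k} {d : Fin n → Mode} {t : Tm S k n}
    {τ : Typ S k} {Γ' : Fin m → Typ S l} {d' : Fin m → Mode} (h : HasType Γ d t τ)
    (hd : NoLin d) (hd' : NoLin d') {p : Fin k → Fin l} {q : Fin n → Fin m}
    (hΓ : ∀ i, Γ' (q i) = (Γ i).ren p) (hi : ∀ i, d i = .intu → d' (q i) = .intu) :
    HasType Γ' d' (t.ren p q) (τ.ren p) :=
  h.ren hΓ hi (.of_noLin hd hd')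

/-- A well-typed simultaneous substitution. The linear variables in the domain of `κ` are renamed
along `κ`, and for all other variables a term without linear variables is substituted. -/
structure SubstOk {k n l m : ℕ} (Γ : Fin n → Typ S k) (d : Fin n → Mode) (Γ' : Fin m → Typ S l)
    (d' : Fin m → Mode) (p : Fin k → Typ S l) (q : Fin n → Tm S l m)
    (κ : Fin n → Option (Fin m)) : Prop where
  tm : ∀ i, d i ≠ .off → (d i = .lin → κ i = none) → HasType Γ' (nolin d') (q i) ((Γ i).sub p)
  var : ∀ i j, d i = .lin → κ i = some j → q i = .var j ∧ Γ' j = (Γ i).sub p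
  track : Track d d' κ

theorem SubstOk.split {k n l m : ℕ} {Γ : Fin n → Typ S k} {d d₁ d₂ : Fin n → Mode}
    {Γ' : Fin m → Typ S l} {d' : Fin m → Mode} {p : Fin k → Typ S l} {q : Fin n → Tm S l m}
    {κ : Fin n → Option (Fin m)} (h : SubstOk Γ d Γ' d' p q κ) (hs : Splits d d₁ d₂) :
    ∃ d₁' d₂', Splits d' d₁' d₂' ∧ SubstOk Γ d₁ Γ' d₁' p q κ ∧ SubstOk Γ d₂ Γ' d₂' p q κ := by
  obtain ⟨d₁', d₂', hs', t₁, t₂⟩ := h.track.split hs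
  have a₁ : ∀ i, d₁ i ≠ .off → d i = d₁ i := by
    intro i hi; have := hs i
    generalize d i = a at *; generalize d₁ i = b at *; generalize d₂ i = c at *
    cases this <;> simp_all
  have a₂ : ∀ i, d₂ i ≠ .off → d i = d₂ i := by
    intro i hi; have := hs i
    generalize d i = a at *; generalize d₁ i = b at *; generalize d₂ i = c at *
    cases this <;> simp_all
  refine ⟨d₁', d₂', hs', ⟨fun i hi hk => ?_, fun i j hi => ?_, t₁⟩,
    ⟨fun i hi hk => ?_, fun i j hi => ?_, t₂⟩⟩
  · rw [hs'.nolin_left]; exact h.tm i (by rwa [a₁ i hi]) (by rwa [a₁ i hi])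
  · exact h.var i j (by rw [a₁ i (by simp [hi]), hi])
  · rw [hs'.nolin_right]; exact h.tm i (by rwa [a₂ i hi]) (by rwa [a₂ i hi])
  · exact h.var i j (by rw [a₂ i (by simp [hi]), hi])

theorem SubstOk.lift {k n l m : ℕ} {Γ : Fin n → Typ S k} {d : Fin n → Mode}
    {Γ' : Fin m → Typ S l} {d' : Fin m → Mode} {p : Fin k → Typ S l} {q : Fin n → Tm S l m}
    {κ : Fin n → Option (Fin m)} (h : SubstOk Γ d Γ' d' p q κ) (σ : Typ S k) (a : Mode) :
    SubstOk (cons σ Γ) (cons a d) (cons (σ.sub p) Γ') (cons a d') p (Tm.lift q) (liftK κ) := by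
  refine ⟨fun i => ?_, fun i j => ?_, h.track.lift a⟩
  · refine Fin.cases (fun hi hk => ?_) (fun i hi hk => ?_) i
    · cases a
      · exact .varIntu 0 rfl (noLin_nolin _)
      · have := hk rfl; simp [liftK] at this
      · exact absurd rfl hi
    · have := h.tm i hi (fun hl => by simpa [liftK] using hk hl)
      have := this.ren_noLin (Γ' := cons (σ.sub p) Γ') (d' := nolin (cons a d'))
        (noLin_nolin _) (noLin_nolin _) (p := id) (q := Fin.succ) (fun i => by simp)
        (fun i hi => hi)
      rw [Ty.ren_id] at this
      exact this
  · refine Fin.cases (fun hi hk => ?_) (fun i hi hk => ?_) i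
    · simp only [liftK, cons_zero, Option.some.injEq] at hk
      subst hk; exact ⟨rfl, rfl⟩
    · simp only [liftK, cons_succ, Option.map_eq_some_iff] at hk
      obtain ⟨j, hj, rfl⟩ := hk
      obtain ⟨h1, h2⟩ := h.var i j hi hj
      refine ⟨?_, h2⟩
      rw [Tm.lift_succ, h1]; rfl

theorem HasType.sub {k n : ℕ} {Γ : Fin n → Typ S k} {d : Fin n → Mode} {t : Tm S k n}
    {τ : Typ S k} (h : HasType Γ d t τ) :
    ∀ {l m : ℕ} {Γ' : Fin m → Typ S l} {d' : Fin m → Mode} {p : Fin k → Typ S l}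
      {q : Fin n → Tm S l m} {κ : Fin n → Option (Fin m)}, SubstOk Γ d Γ' d' p q κ →
      HasType Γ' d' (t.sub p q) (τ.sub p) := by
  induction h with
  | star hd => intro l m Γ' d' p q κ ho; exact .star (ho.track.noLin hd)
  | con c hd => intro l m Γ' d' p q κ ho; rw [Ty.wk0_sub]; exact .con c (ho.track.noLin hd)
  | Y hd => intro l m Γ' d' p q κ ho; exact .Y (ho.track.noLin hd)
  | varIntu i h hd =>
    intro l m Γ' d' p q κ ho
    have := ho.tm i (by simp [h]) (by simp [h])
    rwa [(ho.track.noLin hd).nolin_eq] at this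
  | varLin i h hd =>
    intro l m Γ' d' p q κ ho
    cases hk : κ i with
    | none =>
      have := ho.tm i (by simp [h]) (fun _ => hk)
      have hd' : NoLin d' := by
        intro j hj
        obtain ⟨i', hi', hk'⟩ := ho.track.surj j hj
        by_cases e : i' = i
        · subst e; simp [hk] at hk'
        · exact hd i' e hi'
      rwa [hd'.nolin_eq] at this
    | some j =>
      obtain ⟨h1, h2⟩ := ho.var i j h hk
      rw [Tm.sub, h1, ← h2]
      refine .varLin _ (ho.track.keep i _ h hk) fun j' hj hl => ?_
      obtain ⟨i', hi', hk'⟩ := ho.track.surj j' hl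
      by_cases e : i' = i
      · subst e; exact hj (Option.some.inj (hk'.symm.trans hk))
      · exact hd i' e hi'
  | app hs _ _ ih₁ ih₂ =>
    intro l m Γ' d' p q κ ho
    obtain ⟨d₁', d₂', hs', o₁, o₂⟩ := ho.split hs
    exact .app hs' (ih₁ o₁) (ih₂ o₂)
  | lam _ ih => intro l m Γ' d' p q κ ho; exact .lam (ih (ho.lift _ _))
  | tensor hs _ _ ih₁ ih₂ =>
    intro l m Γ' d' p q κ ho
    obtain ⟨d₁', d₂', hs', o₁, o₂⟩ := ho.split hs
    exact .tensor hs' (ih₁ o₁) (ih₂ o₂)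
  | bang hd _ ih => intro l m Γ' d' p q κ ho; exact .bang (ho.track.noLin hd) (ih ho)
  | tlam _ ih =>
    intro l m Γ' d' p q κ ho
    have hT : ∀ σ, (Ty.ren σ (up 1)).sub (Ty.lift p) = (σ.sub p).ren (up 1) := by
      intro σ; simp only [Ty.ren_sub, Ty.sub_ren]; rfl
    refine .tlam (ih (κ := κ) ⟨fun i hi hk => ?_, fun i j hi hk => ?_, ho.track⟩)
    · simp only [wkCx, hT]
      exact (ho.tm i hi hk).ren_noLin (noLin_nolin _) (noLin_nolin _) (fun i => rfl)
        (fun i hi => hi)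
    · obtain ⟨h1, h2⟩ := ho.var i j hi hk
      simp only [wkCx, hT, h1, h2]
      exact ⟨rfl, trivial⟩
  | tapp τ _ ih => intro l m Γ' d' p q κ ho; rw [Ty.inst_sub]; exact .tapp _ (ih ho)
  | letTensor hs _ _ ih₁ ih₂ =>
    intro l m Γ' d' p q κ ho
    obtain ⟨d₁', d₂', hs', o₁, o₂⟩ := ho.split hs
    exact .letTensor hs' (ih₁ o₁) (ih₂ ((o₂.lift _ _).lift _ _))
  | letBang hs _ _ ih₁ ih₂ =>
    intro l m Γ' d' p q κ ho
    obtain ⟨d₁', d₂', hs', o₁, o₂⟩ := ho.split hs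
    exact .letBang hs' (ih₁ o₁) (ih₂ (o₂.lift _ _))
  | letStar hs _ _ ih₁ ih₂ =>
    intro l m Γ' d' p q κ ho
    obtain ⟨d₁', d₂', hs', o₁, o₂⟩ := ho.split hs
    exact .letStar hs' (ih₁ o₁) (ih₂ o₂)

/-- Substitution of terms without linear variables. -/
theorem HasType.sub_noLin {k n l m : ℕ} {Γ : Fin n → Typ S k} {d : Fin n → Mode} {t : Tm S k n}
    {τ : Typ S k} (h : HasType Γ d t τ) {Γ' : Fin m → Typ S l} {d' : Fin m → Mode}
    (hd' : NoLin d') {p : Fin k → Typ S l} {q : Fin n → Tm S l m}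
    (hq : ∀ i, d i ≠ .off → HasType Γ' d' (q i) ((Γ i).sub p)) :
    HasType Γ' d' (t.sub p q) (τ.sub p) :=
  h.sub (κ := fun _ => none) ⟨fun i hi _ => by rw [hd'.nolin_eq]; exact hq i hi,
    fun i j _ h => by simp at h, ⟨fun i j _ h => by simp at h, fun j hj => absurd hj (hd' j),
      fun i i' j _ _ h => by simp at h⟩⟩

end Typing

/-! ## Syntax of propositions and relations under renaming and substitution -/

section Lifting

variable {S : Sig.{u, v}} {k n m l n' m' l' : ℕ}

theorem Ty.lift_var_comp (p : Fin k → Fin l) :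
    Ty.lift (fun i => (.var (p i) : Typ S l)) = fun i => .var (liftR p i) := by
  funext i; exact Fin.cases rfl (fun _ => rfl) i

theorem Tm.lift_var_comp (q : Fin n → Fin m) :
    Tm.lift (fun i => (.var (q i) : Tm S l m)) = fun i => .var (liftR q i) := by
  funext i; exact Fin.cases rfl (fun _ => rfl) i

theorem Rel.lift_var_comp (r : Fin m → Fin m') :
    Rel.lift (fun i => (.var (r i) : Rel S k n m')) = fun i => .var (liftR r i) := by
  funext i; exact Fin.cases rfl (fun _ => rfl) i

theorem Ty.lift_comp_liftR (p : Fin k → Fin l) (p' : Fin l → Typ S l') :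
    Ty.lift (fun i => p' (p i)) = fun i => Ty.lift p' (liftR p i) := by
  funext i; exact Fin.cases rfl (fun _ => rfl) i

theorem Tm.lift_comp_liftR (q : Fin n → Fin m) (q' : Fin m → Tm S l m') :
    Tm.lift (fun i => q' (q i)) = fun i => Tm.lift q' (liftR q i) := by
  funext i; exact Fin.cases rfl (fun _ => rfl) i

theorem Rel.lift_comp_liftR {a : ℕ} (r : Fin n → Fin m) (r' : Fin m → Rel S l m' a) :
    Rel.lift (fun i => r' (r i)) = fun i => Rel.lift r' (liftR r i) := by
  funext i; exact Fin.cases rfl (fun _ => rfl) i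

theorem Rel.lift_var : Rel.lift (Rel.var : Fin m → Rel S k n m) = Rel.var := by
  funext i; exact Fin.cases rfl (fun _ => rfl) i

end Lifting

section Forms

variable {S : Sig.{u, v}}

mutual

theorem Form.ren_eq_sub : {k n m : ℕ} → (φ : Form S k n m) → {k' n' m' : ℕ} → (p : Fin k → Fin k') →
    (q : Fin n → Fin n') → (r : Fin m → Fin m') →
      φ.ren p q r = φ.sub (fun i => .var (p i)) (fun i => .var (q i)) (fun i => .var (r i))
  | _, _, _, .eq σ t s, _, _, _, p, q, r => by
    simp only [Form.ren, Form.sub, Ty.ren_eq_sub, Tm.ren_eq_sub]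
  | _, _, _, .rel ρ t s, _, _, _, p, q, r => by
    simp only [Form.ren, Form.sub, Tm.ren_eq_sub, Rel.ren_eq_sub ρ]
  | _, _, _, .imp φ ψ, _, _, _, p, q, r => by
    simp only [Form.ren, Form.sub, Form.ren_eq_sub φ, Form.ren_eq_sub ψ]
  | _, _, _, .bot, _, _, _, p, q, r => rfl
  | _, _, _, .top, _, _, _, p, q, r => rfl
  | _, _, _, .and φ ψ, _, _, _, p, q, r => by
    simp only [Form.ren, Form.sub, Form.ren_eq_sub φ, Form.ren_eq_sub ψ]
  | _, _, _, .or φ ψ, _, _, _, p, q, r => by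
    simp only [Form.ren, Form.sub, Form.ren_eq_sub φ, Form.ren_eq_sub ψ]
  | _, _, _, .allTy φ, _, _, _, p, q, r => by
    simp only [Form.ren, Form.sub, Ty.lift_var_comp, Form.ren_eq_sub φ]; rfl
  | _, _, _, .allTm σ φ, _, _, _, p, q, r => by
    simp only [Form.ren, Form.sub, Ty.ren_eq_sub, Tm.lift_var_comp, Form.ren_eq_sub φ]; rfl
  | _, _, _, .allRel σ τ φ, _, _, _, p, q, r => by
    simp only [Form.ren, Form.sub, Ty.ren_eq_sub, Rel.lift_var_comp, Form.ren_eq_sub φ]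
  | _, _, _, .allAdm σ τ φ, _, _, _, p, q, r => by
    simp only [Form.ren, Form.sub, Ty.ren_eq_sub, Rel.lift_var_comp, Form.ren_eq_sub φ]
  | _, _, _, .exTy φ, _, _, _, p, q, r => by
    simp only [Form.ren, Form.sub, Ty.lift_var_comp, Form.ren_eq_sub φ]; rfl
  | _, _, _, .exTm σ φ, _, _, _, p, q, r => by
    simp only [Form.ren, Form.sub, Ty.ren_eq_sub, Tm.lift_var_comp, Form.ren_eq_sub φ]; rfl
  | _, _, _, .exRel σ τ φ, _, _, _, p, q, r => by
    simp only [Form.ren, Form.sub, Ty.ren_eq_sub, Rel.lift_var_comp, Form.ren_eq_sub φ]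
  | _, _, _, .exAdm σ τ φ, _, _, _, p, q, r => by
    simp only [Form.ren, Form.sub, Ty.ren_eq_sub, Rel.lift_var_comp, Form.ren_eq_sub φ]

theorem Rel.ren_eq_sub : {k n m : ℕ} → (ρ : Rel S k n m) → {k' n' m' : ℕ} → (p : Fin k → Fin k') →
    (q : Fin n → Fin n') → (r : Fin m → Fin m') →
      ρ.ren p q r = ρ.sub (fun i => .var (p i)) (fun i => .var (q i)) (fun i => .var (r i))
  | _, _, _, .var j, _, _, _, p, q, r => rfl
  | _, _, _, .abs σ τ φ, _, _, _, p, q, r => by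
    simp only [Rel.ren, Rel.sub, Ty.ren_eq_sub, Tm.lift_var_comp, Form.ren_eq_sub φ]; rfl
  | _, _, _, .interp a σ ρs, _, _, _, p, q, r => by
    simp only [Rel.ren, Rel.sub]; exact congrArg _ (funext fun i => Rel.ren_eq_sub (ρs i) _ _ _)

end

mutual

theorem Form.ren_sub : {k n m : ℕ} → (φ : Form S k n m) → {k' n' m' k'' n'' m'' : ℕ} → (p : Fin k → Fin k') →
    (q : Fin n → Fin n') → (r : Fin m → Fin m') → (p' : Fin k' → Typ S k'') →
    (q' : Fin n' → Tm S k'' n'') → (r' : Fin m' → Rel S k'' n'' m'') →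
      (φ.ren p q r).sub p' q' r' =
        φ.sub (fun i => p' (p i)) (fun i => q' (q i)) (fun i => r' (r i))
  | _, _, _, .eq σ t s, _, _, _, _, _, _, p, q, r, p', q', r' => by
    simp only [Form.ren, Form.sub, Ty.ren_sub, Tm.ren_sub]
  | _, _, _, .rel ρ t s, _, _, _, _, _, _, p, q, r, p', q', r' => by
    simp only [Form.ren, Form.sub, Tm.ren_sub, Rel.ren_sub ρ]
  | _, _, _, .imp φ ψ, _, _, _, _, _, _, p, q, r, p', q', r' => by
    simp only [Form.ren, Form.sub, Form.ren_sub φ, Form.ren_sub ψ]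
  | _, _, _, .bot, _, _, _, _, _, _, p, q, r, p', q', r' => rfl
  | _, _, _, .top, _, _, _, _, _, _, p, q, r, p', q', r' => rfl
  | _, _, _, .and φ ψ, _, _, _, _, _, _, p, q, r, p', q', r' => by
    simp only [Form.ren, Form.sub, Form.ren_sub φ, Form.ren_sub ψ]
  | _, _, _, .or φ ψ, _, _, _, _, _, _, p, q, r, p', q', r' => by
    simp only [Form.ren, Form.sub, Form.ren_sub φ, Form.ren_sub ψ]
  | _, _, _, .allTy φ, _, _, _, _, _, _, p, q, r, p', q', r' => by
    simp only [Form.ren, Form.sub, Ty.lift_comp_liftR, Form.ren_sub φ]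
  | _, _, _, .allTm σ φ, _, _, _, _, _, _, p, q, r, p', q', r' => by
    simp only [Form.ren, Form.sub, Ty.ren_sub, Tm.lift_comp_liftR, Form.ren_sub φ]
  | _, _, _, .allRel σ τ φ, _, _, _, _, _, _, p, q, r, p', q', r' => by
    simp only [Form.ren, Form.sub, Ty.ren_sub, Rel.lift_comp_liftR, Form.ren_sub φ]
  | _, _, _, .allAdm σ τ φ, _, _, _, _, _, _, p, q, r, p', q', r' => by
    simp only [Form.ren, Form.sub, Ty.ren_sub, Rel.lift_comp_liftR, Form.ren_sub φ]
  | _, _, _, .exTy φ, _, _, _, _, _, _, p, q, r, p', q', r' => by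
    simp only [Form.ren, Form.sub, Ty.lift_comp_liftR, Form.ren_sub φ]
  | _, _, _, .exTm σ φ, _, _, _, _, _, _, p, q, r, p', q', r' => by
    simp only [Form.ren, Form.sub, Ty.ren_sub, Tm.lift_comp_liftR, Form.ren_sub φ]
  | _, _, _, .exRel σ τ φ, _, _, _, _, _, _, p, q, r, p', q', r' => by
    simp only [Form.ren, Form.sub, Ty.ren_sub, Rel.lift_comp_liftR, Form.ren_sub φ]
  | _, _, _, .exAdm σ τ φ, _, _, _, _, _, _, p, q, r, p', q', r' => by
    simp only [Form.ren, Form.sub, Ty.ren_sub, Rel.lift_comp_liftR, Form.ren_sub φ]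

theorem Rel.ren_sub : {k n m : ℕ} → (ρ : Rel S k n m) → {k' n' m' k'' n'' m'' : ℕ} → (p : Fin k → Fin k') →
    (q : Fin n → Fin n') → (r : Fin m → Fin m') → (p' : Fin k' → Typ S k'') →
    (q' : Fin n' → Tm S k'' n'') → (r' : Fin m' → Rel S k'' n'' m'') →
      (ρ.ren p q r).sub p' q' r' =
        ρ.sub (fun i => p' (p i)) (fun i => q' (q i)) (fun i => r' (r i))
  | _, _, _, .var j, _, _, _, _, _, _, p, q, r, p', q', r' => rfl
  | _, _, _, .abs σ τ φ, _, _, _, _, _, _, p, q, r, p', q', r' => by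
    simp only [Rel.ren, Rel.sub, Ty.ren_sub, Tm.lift_comp_liftR, Form.ren_sub φ]
  | _, _, _, .interp a σ ρs, _, _, _, _, _, _, p, q, r, p', q', r' => by
    simp only [Rel.ren, Rel.sub]; exact congrArg _ (funext fun i => Rel.ren_sub (ρs i) _ _ _ _ _ _)

end

mutual

theorem Form.sub_var : {k n m : ℕ} → (φ : Form S k n m) → φ.sub Ty.var Tm.var Rel.var = φ
  | _, _, _, .eq σ t s => by
    simp only [Form.sub, Ty.sub_var, Tm.sub_var]
  | _, _, _, .rel ρ t s => by
    simp only [Form.sub, Tm.sub_var, Rel.sub_var ρ]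
  | _, _, _, .imp φ ψ => by
    simp only [Form.sub, Form.sub_var φ, Form.sub_var ψ]
  | _, _, _, .bot => rfl
  | _, _, _, .top => rfl
  | _, _, _, .and φ ψ => by
    simp only [Form.sub, Form.sub_var φ, Form.sub_var ψ]
  | _, _, _, .or φ ψ => by
    simp only [Form.sub, Form.sub_var φ, Form.sub_var ψ]
  | _, _, _, .allTy φ => by
    simp only [Form.sub, Ty.lift_var]; exact congrArg _ (Form.sub_var φ)
  | _, _, _, .allTm σ φ => by
    simp only [Form.sub, Ty.sub_var, Tm.lift_var]; exact congrArg _ (Form.sub_var φ)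
  | _, _, _, .allRel σ τ φ => by
    simp only [Form.sub, Ty.sub_var, Rel.lift_var, Form.sub_var φ]
  | _, _, _, .allAdm σ τ φ => by
    simp only [Form.sub, Ty.sub_var, Rel.lift_var, Form.sub_var φ]
  | _, _, _, .exTy φ => by
    simp only [Form.sub, Ty.lift_var]; exact congrArg _ (Form.sub_var φ)
  | _, _, _, .exTm σ φ => by
    simp only [Form.sub, Ty.sub_var, Tm.lift_var]; exact congrArg _ (Form.sub_var φ)
  | _, _, _, .exRel σ τ φ => by
    simp only [Form.sub, Ty.sub_var, Rel.lift_var, Form.sub_var φ]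
  | _, _, _, .exAdm σ τ φ => by
    simp only [Form.sub, Ty.sub_var, Rel.lift_var, Form.sub_var φ]

theorem Rel.sub_var : {k n m : ℕ} → (ρ : Rel S k n m) → ρ.sub Ty.var Tm.var Rel.var = ρ
  | _, _, _, .var j => rfl
  | _, _, _, .abs σ τ φ => by
    simp only [Rel.sub, Ty.sub_var, Tm.lift_var]; exact congrArg _ (Form.sub_var φ)
  | _, _, _, .interp a σ ρs => by
    simp only [Rel.sub, fun i => Rel.sub_var (ρs i)]

end

theorem Rel.ren_ren {k n m k' n' m' k'' n'' m'' : ℕ} (ρ : Rel S k n m) (p : Fin k → Fin k')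
    (q : Fin n → Fin n') (r : Fin m → Fin m') (p' : Fin k' → Fin k'') (q' : Fin n' → Fin n'')
    (r' : Fin m' → Fin m'') : (ρ.ren p q r).ren p' q' r' =
      ρ.ren (fun i => p' (p i)) (fun i => q' (q i)) (fun i => r' (r i)) := by
  rw [Rel.ren_eq_sub (ρ.ren p q r), Rel.ren_sub, Rel.ren_eq_sub]

@[simp] theorem Form.ren_id {k n m : ℕ} (φ : Form S k n m) : φ.ren id id id = φ := by
  rw [Form.ren_eq_sub]; exact φ.sub_var

@[simp] theorem Rel.ren_id {k n m : ℕ} (ρ : Rel S k n m) : ρ.ren id id id = ρ := by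
  rw [Rel.ren_eq_sub]; exact ρ.sub_var

theorem Ty.lift_ren {k l l' : ℕ} (p : Fin k → Typ S l) (p' : Fin l → Fin l') :
    (fun i => (Ty.lift p i).ren (liftR p')) = Ty.lift (fun i => (p i).ren p') := by
  funext i; refine Fin.cases rfl (fun _ => ?_) i
  simp only [Ty.lift_succ, Ty.ren_ren]; rfl

theorem Tm.lift_ren {k n l l' m : ℕ} (q : Fin k → Tm S l n) (p' : Fin l → Fin l')
    (q' : Fin n → Fin m) :
    (fun i => (Tm.lift q i).ren p' (liftR q')) = Tm.lift (fun i => (q i).ren p' q') := by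
  funext i; refine Fin.cases rfl (fun _ => ?_) i
  simp only [Tm.lift, cons_succ, Tm.wk, Tm.ren_ren]; rfl

theorem Rel.lift_ren {a k n m k' n' m' : ℕ} (r : Fin a → Rel S k n m) (p : Fin k → Fin k')
    (q : Fin n → Fin n') (r' : Fin m → Fin m') :
    (fun i => (Rel.lift r i).ren p q (liftR r')) = Rel.lift (fun i => (r i).ren p q r') := by
  funext i; refine Fin.cases rfl (fun _ => ?_) i
  simp only [Rel.lift, cons_succ, Rel.wk, Rel.ren_ren]; rfl

theorem Tm.wk_ty_ren {k n k' n' : ℕ} (t : Tm S k n) (p : Fin k → Fin k') (q : Fin n → Fin n') :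
    (t.wk 1 0).ren (liftR p) q = (t.ren p q).wk 1 0 := by
  simp only [Tm.wk, Tm.ren_ren]; rfl

theorem Rel.wk_ty_ren {k n m k' n' m' : ℕ} (ρ : Rel S k n m) (p : Fin k → Fin k')
    (q : Fin n → Fin n') (r : Fin m → Fin m') :
    (ρ.wk 1 0 0).ren (liftR p) q r = (ρ.ren p q r).wk 1 0 0 := by
  simp only [Rel.wk, Rel.ren_ren]; rfl

theorem Rel.wk_tm_ren {k n m k' n' m' : ℕ} (ρ : Rel S k n m) (p : Fin k → Fin k')
    (q : Fin n → Fin n') (r : Fin m → Fin m') :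
    (ρ.wk 0 1 0).ren p (liftR q) r = (ρ.ren p q r).wk 0 1 0 := by
  simp only [Rel.wk, Rel.ren_ren]; rfl

theorem Rel.wk_tm_two_ren {k n m k' n' m' : ℕ} (ρ : Rel S k n m) (p : Fin k → Fin k')
    (q : Fin n → Fin n') (r : Fin m → Fin m') :
    (ρ.wk 0 2 0).ren p (liftR (liftR q)) r = (ρ.ren p q r).wk 0 2 0 := by
  simp only [Rel.wk, Rel.ren_ren]; rfl

mutual

theorem Form.sub_ren : {k n m : ℕ} → (φ : Form S k n m) → {k' n' m' k'' n'' m'' : ℕ} → (p : Fin k → Typ S k') →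
    (q : Fin n → Tm S k' n') → (r : Fin m → Rel S k' n' m') → (p' : Fin k' → Fin k'') →
    (q' : Fin n' → Fin n'') → (r' : Fin m' → Fin m'') →
      (φ.sub p q r).ren p' q' r' = φ.sub (fun i => (p i).ren p')
        (fun i => (q i).ren p' q') (fun i => (r i).ren p' q' r')
  | _, _, _, .eq σ t s, _, _, _, _, _, _, p, q, r, p', q', r' => by
    simp only [Form.sub, Form.ren, Ty.sub_ren, Tm.sub_ren]
  | _, _, _, .rel ρ t s, _, _, _, _, _, _, p, q, r, p', q', r' => by
    simp only [Form.sub, Form.ren, Tm.sub_ren, Rel.sub_ren ρ]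
  | _, _, _, .imp φ ψ, _, _, _, _, _, _, p, q, r, p', q', r' => by
    simp only [Form.sub, Form.ren, Form.sub_ren φ, Form.sub_ren ψ]
  | _, _, _, .bot, _, _, _, _, _, _, p, q, r, p', q', r' => rfl
  | _, _, _, .top, _, _, _, _, _, _, p, q, r, p', q', r' => rfl
  | _, _, _, .and φ ψ, _, _, _, _, _, _, p, q, r, p', q', r' => by
    simp only [Form.sub, Form.ren, Form.sub_ren φ, Form.sub_ren ψ]
  | _, _, _, .or φ ψ, _, _, _, _, _, _, p, q, r, p', q', r' => by
    simp only [Form.sub, Form.ren, Form.sub_ren φ, Form.sub_ren ψ]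
  | _, _, _, .allTy φ, _, _, _, _, _, _, p, q, r, p', q', r' => by
    simp only [Form.sub, Form.ren, Ty.lift_ren, Tm.wk_ty_ren, Rel.wk_ty_ren, Form.sub_ren φ]
  | _, _, _, .allTm σ φ, _, _, _, _, _, _, p, q, r, p', q', r' => by
    simp only [Form.sub, Form.ren, Ty.sub_ren, Tm.lift_ren, Rel.wk_tm_ren, Form.sub_ren φ]
  | _, _, _, .allRel σ τ φ, _, _, _, _, _, _, p, q, r, p', q', r' => by
    simp only [Form.sub, Form.ren, Ty.sub_ren, Rel.lift_ren, Form.sub_ren φ]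
  | _, _, _, .allAdm σ τ φ, _, _, _, _, _, _, p, q, r, p', q', r' => by
    simp only [Form.sub, Form.ren, Ty.sub_ren, Rel.lift_ren, Form.sub_ren φ]
  | _, _, _, .exTy φ, _, _, _, _, _, _, p, q, r, p', q', r' => by
    simp only [Form.sub, Form.ren, Ty.lift_ren, Tm.wk_ty_ren, Rel.wk_ty_ren, Form.sub_ren φ]
  | _, _, _, .exTm σ φ, _, _, _, _, _, _, p, q, r, p', q', r' => by
    simp only [Form.sub, Form.ren, Ty.sub_ren, Tm.lift_ren, Rel.wk_tm_ren, Form.sub_ren φ]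
  | _, _, _, .exRel σ τ φ, _, _, _, _, _, _, p, q, r, p', q', r' => by
    simp only [Form.sub, Form.ren, Ty.sub_ren, Rel.lift_ren, Form.sub_ren φ]
  | _, _, _, .exAdm σ τ φ, _, _, _, _, _, _, p, q, r, p', q', r' => by
    simp only [Form.sub, Form.ren, Ty.sub_ren, Rel.lift_ren, Form.sub_ren φ]

theorem Rel.sub_ren : {k n m : ℕ} → (ρ : Rel S k n m) → {k' n' m' k'' n'' m'' : ℕ} → (p : Fin k → Typ S k') →
    (q : Fin n → Tm S k' n') → (r : Fin m → Rel S k' n' m') → (p' : Fin k' → Fin k'') →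
    (q' : Fin n' → Fin n'') → (r' : Fin m' → Fin m'') →
      (ρ.sub p q r).ren p' q' r' = ρ.sub (fun i => (p i).ren p')
        (fun i => (q i).ren p' q') (fun i => (r i).ren p' q' r')
  | _, _, _, .var j, _, _, _, _, _, _, p, q, r, p', q', r' => rfl
  | _, _, _, .abs σ τ φ, _, _, _, _, _, _, p, q, r, p', q', r' => by
    simp only [Rel.sub, Rel.ren, Ty.sub_ren, Tm.lift_ren, Rel.wk_tm_two_ren, Form.sub_ren φ]
  | _, _, _, .interp a σ ρs, _, _, _, _, _, _, p, q, r, p', q', r' => by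
    simp only [Rel.sub, Rel.ren]; exact congrArg _ (funext fun i => Rel.sub_ren (ρs i) _ _ _ _ _ _)

end

theorem Rel.wk_sub {k n m k' n' m' a b c : ℕ} (ρ : Rel S k n m) {p : Fin k → Typ S k'}
    {q : Fin n → Tm S k' n'} {r : Fin m → Rel S k' n' m'}
    {P : Fin (k + a) → Typ S (k' + a)} {Q : Fin (n + b) → Tm S (k' + a) (n' + b)}
    {R : Fin (m + c) → Rel S (k' + a) (n' + b) (m' + c)}
    (hP : ∀ i, P (up a i) = (p i).ren (up a)) (hQ : ∀ i, Q (up b i) = (q i).wk a b)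
    (hR : ∀ i, R (up c i) = (r i).wk a b c) :
    (ρ.wk a b c).sub P Q R = (ρ.sub p q r).wk a b c := by
  simp only [Rel.wk, Rel.ren_sub, Rel.sub_ren, hP, hQ, hR, Tm.wk]

end Forms

/-! ## Derived rules of the logic -/

section IntuTyping

variable {S : Sig.{u, v}} {k n : ℕ} {Γ : Fin n → Typ S k}

theorem HasType.app_intu {t s : Tm S k n} {σ τ : Typ S k}
    (ht : HasType Γ allIntu t (.lolli σ τ)) (hs : HasType Γ allIntu s σ) :
    HasType Γ allIntu (.app t s) τ := .app noLin_allIntu.splits ht hs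

theorem HasType.tapp_intu {t : Tm S k n} {σ : Typ S (k + 1)} (A : Typ S k) {τ : Typ S k}
    (ht : HasType Γ allIntu t (.all σ)) (e : σ.inst A = τ) :
    HasType Γ allIntu (.tapp t A) τ := e ▸ .tapp A ht

theorem HasType.tensor_intu {t s : Tm S k n} {σ τ : Typ S k}
    (ht : HasType Γ allIntu t σ) (hs : HasType Γ allIntu s τ) :
    HasType Γ allIntu (.tensor t s) (.tensor σ τ) := .tensor noLin_allIntu.splits ht hs

theorem HasType.bang_intu {t : Tm S k n} {σ : Typ S k} (ht : HasType Γ allIntu t σ) :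
    HasType Γ allIntu (.bang t) (.bang σ) := .bang noLin_allIntu ht

theorem HasType.var_intu (i : Fin n) {σ : Typ S k} (e : Γ i = σ) :
    HasType Γ allIntu (.var i) σ := e ▸ .varIntu i rfl noLin_allIntu

theorem HasType.ren_intu {l m : ℕ} {t : Tm S k n} {τ : Typ S k} {Γ' : Fin m → Typ S l}
    (h : HasType Γ allIntu t τ) {p : Fin k → Fin l} {q : Fin n → Fin m}
    (hΓ : ∀ i, Γ' (q i) = (Γ i).ren p) : HasType Γ' allIntu (t.ren p q) (τ.ren p) :=
  h.ren_noLin noLin_allIntu noLin_allIntu hΓ fun _ _ => rfl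

theorem HasType.wk_tm {t : Tm S k n} {τ : Typ S k} (h : HasType Γ allIntu t τ) (σ : Typ S k) :
    HasType (cons σ Γ) allIntu (t.wk 0 1) τ := by
  have := h.ren_intu (Γ' := cons σ Γ) (p := id) (q := Fin.succ) (fun i => (Ty.ren_id _).symm)
  rwa [Ty.ren_id] at this

theorem HasType.wk_tm_two {t : Tm S k n} {τ : Typ S k} (h : HasType Γ allIntu t τ)
    (σ σ' : Typ S k) : HasType (cons σ' (cons σ Γ)) allIntu (t.wk 0 2) τ := by
  have := h.ren_intu (Γ' := cons σ' (cons σ Γ)) (p := id) (q := fun i => i.succ.succ)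
    (fun i => (Ty.ren_id _).symm)
  rwa [Ty.ren_id] at this

theorem HasType.wk_ty {t : Tm S k n} {τ : Typ S k} (h : HasType Γ allIntu t τ) :
    HasType (wkCx Γ 1) allIntu (t.wk 1 0) (τ.ren (up 1)) :=
  h.ren_intu fun _ => rfl

/-- A closed well-typed term is well-typed in every context without linear variables. -/
theorem HasType.wk0 {t : Tm S 0 0} {τ : Typ S 0} (h : HasType nil allIntu t τ)
    {d : Fin n → Mode} (hd : NoLin d) : HasType Γ d (t.wk0 k n) (τ.wk0 k) :=
  h.ren_noLin noLin_allIntu hd (fun i => i.elim0) fun i => i.elim0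

theorem HasType.idTm {d : Fin n → Mode} (hd : NoLin d) (σ : Typ S k) :
    HasType Γ d (Tm.idTm σ) (.lolli σ σ) :=
  .lam (.varLin 0 rfl fun j => Fin.cases (fun h => absurd rfl h) (fun i _ => hd i) j)

/-- Substitution for the variable bound by a linear abstraction. -/
theorem HasType.inst_lin {t : Tm S k (n + 1)} {u : Tm S k n} {σ τ : Typ S k} {a : Mode}
    (ht : HasType (cons σ Γ) (cons a allIntu) t τ) (hu : HasType Γ allIntu u σ) :
    HasType Γ allIntu (t.inst u) τ := by
  have := ht.sub_noLin (Γ' := Γ) noLin_allIntu (p := Ty.var) (q := cons u Tm.var) (fun i _ => by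
    refine Fin.cases ?_ (fun i => ?_) i
    · simpa using hu
    · exact .var_intu i (Ty.sub_var _).symm)
  rwa [Ty.sub_var] at this

theorem HasType.inst_intu {t : Tm S k (n + 1)} {u : Tm S k n} {σ τ : Typ S k}
    (ht : HasType (cons σ Γ) allIntu t τ) (hu : HasType Γ allIntu u σ) :
    HasType Γ allIntu (t.inst u) τ :=
  HasType.inst_lin (a := .intu) (by rwa [cons_allIntu]) hu

theorem HasType.tinst_intu {t : Tm S (k + 1) n} {σ : Typ S (k + 1)} (A : Typ S k)
    (ht : HasType (wkCx Γ 1) allIntu t σ) : HasType Γ allIntu (t.tinst A) (σ.inst A) :=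
  ht.sub_noLin noLin_allIntu fun i _ => by
    refine .var_intu i ?_
    simp only [wkCx, Ty.ren_sub]
    exact (Ty.sub_var _).symm

end IntuTyping

section Stability

variable {S : Sig.{u, v}} {T : Set (Form S 0 0 0)} {k n m k' n' m' k'' n'' m'' : ℕ}
  {Γ : Fin n → Typ S k} {Θ : Fin m → RelDecl S k} {Γ' : Fin n' → Typ S k'}
  {Θ' : Fin m' → RelDecl S k'} {Γ'' : Fin n'' → Typ S k''} {Θ'' : Fin m'' → RelDecl S k''}

/-- A renaming of type, term and relation variables that respects the contexts. -/
structure CxRen (Γ : Fin n → Typ S k) (Θ : Fin m → RelDecl S k) (Γ' : Fin n' → Typ S k')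
    (Θ' : Fin m' → RelDecl S k') (p : Fin k → Fin k') (q : Fin n → Fin n')
    (r : Fin m → Fin m') : Prop where
  tm : ∀ i, Γ' (q i) = (Γ i).ren p
  rel : ∀ j, Θ' (r j) = ⟨(Θ j).adm, (Θ j).dom.ren p, (Θ j).cod.ren p⟩

theorem CxRen.refl : CxRen Γ Θ Γ Θ id id id :=
  ⟨fun i => (Ty.ren_id _).symm, fun j => by simp⟩

theorem CxRen.comp {p : Fin k → Fin k'} {q : Fin n → Fin n'} {r : Fin m → Fin m'}
    {p' : Fin k' → Fin k''} {q' : Fin n' → Fin n''} {r' : Fin m' → Fin m''}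
    (h : CxRen Γ Θ Γ' Θ' p q r) (h' : CxRen Γ' Θ' Γ'' Θ'' p' q' r') :
    CxRen Γ Θ Γ'' Θ'' (fun i => p' (p i)) (fun i => q' (q i)) (fun i => r' (r i)) :=
  ⟨fun i => by rw [h'.tm, h.tm, Ty.ren_ren], fun j => by simp only [h'.rel, h.rel, Ty.ren_ren]⟩

theorem CxRen.tm_one (σ : Typ S k) : CxRen Γ Θ (cons σ Γ) Θ (up 0) (up 1) (up 0) :=
  ⟨fun i => (Ty.ren_id _).symm, fun j => by simp⟩

theorem CxRen.tm_two (σ σ' : Typ S k) :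
    CxRen Γ Θ (cons σ' (cons σ Γ)) Θ (up 0) (up 2) (up 0) :=
  ⟨fun i => (Ty.ren_id _).symm, fun j => by simp⟩

theorem CxRen.tm_four (σ σ' τ τ' : Typ S k) :
    CxRen Γ Θ (cons τ' (cons τ (cons σ' (cons σ Γ)))) Θ (up 0) (up 4) (up 0) :=
  ⟨fun i => (Ty.ren_id _).symm, fun j => by simp⟩

theorem CxRen.ty_one : CxRen Γ Θ (wkCx Γ 1) (wkRCx Θ 1) (up 1) (up 0) (up 0) :=
  ⟨fun i => rfl, fun j => rfl⟩

theorem CxRen.rel_one (D : RelDecl S k) : CxRen Γ Θ Γ (cons D Θ) (up 0) (up 0) (up 1) :=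
  ⟨fun i => (Ty.ren_id _).symm, fun j => by simp⟩

/-- Weakening by two type variables and a relation between them. -/
theorem CxRen.poly (a : Bool) : CxRen Γ Θ (wkCx (wkCx Γ 1) 1)
    (cons ⟨a, .var 1, .var 0⟩ (wkRCx (wkRCx Θ 1) 1)) (up 2) (up 0) (up 1) :=
  ⟨fun i => by simp only [wkCx, up_zero, id, Ty.ren_ren]; rfl,
    fun j => by simp only [up_one, cons_succ, wkRCx, Ty.ren_ren]; rfl⟩

theorem CxRen.lift_tm {p : Fin k → Fin k'} {q : Fin n → Fin n'} {r : Fin m → Fin m'}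
    (h : CxRen Γ Θ Γ' Θ' p q r) (σ : Typ S k) :
    CxRen (cons σ Γ) Θ (cons (σ.ren p) Γ') Θ' p (liftR q) r :=
  ⟨fun i => Fin.cases rfl h.tm i, h.rel⟩

theorem CxRen.lift_ty {p : Fin k → Fin k'} {q : Fin n → Fin n'} {r : Fin m → Fin m'}
    (h : CxRen Γ Θ Γ' Θ' p q r) :
    CxRen (wkCx Γ 1) (wkRCx Θ 1) (wkCx Γ' 1) (wkRCx Θ' 1) (liftR p) q r :=
  ⟨fun i => by simp only [wkCx, h.tm, Ty.ren_ren]; rfl,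
    fun j => by simp only [wkRCx, h.rel, Ty.ren_ren]; rfl⟩

theorem CxRen.lift_rel {p : Fin k → Fin k'} {q : Fin n → Fin n'} {r : Fin m → Fin m'}
    (h : CxRen Γ Θ Γ' Θ' p q r) (a : Bool) (σ τ : Typ S k) :
    CxRen Γ (cons ⟨a, σ, τ⟩ Θ) Γ' (cons ⟨a, σ.ren p, τ.ren p⟩ Θ') p q (liftR r) :=
  ⟨h.tm, fun j => Fin.cases rfl h.rel j⟩

/-- The proposition `φ` is well-formed in the context, and stays so in all renamed contexts. -/
def StabForm (T : Set (Form S 0 0 0)) (Γ : Fin n → Typ S k) (Θ : Fin m → RelDecl S k)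
    (φ : Form S k n m) : Prop :=
  ∀ ⦃k' n' m' : ℕ⦄ ⦃Γ' : Fin n' → Typ S k'⦄ ⦃Θ' : Fin m' → RelDecl S k'⦄ ⦃p : Fin k → Fin k'⦄
    ⦃q : Fin n → Fin n'⦄ ⦃r : Fin m → Fin m'⦄, CxRen Γ Θ Γ' Θ' p q r →
      WfForm T Γ' Θ' (φ.ren p q r)

/-- `ρ : Rel(σ,τ)` in the context and in all renamed contexts. -/
def StabRel (T : Set (Form S 0 0 0)) (Γ : Fin n → Typ S k) (Θ : Fin m → RelDecl S k)
    (ρ : Rel S k n m) (σ τ : Typ S k) : Prop :=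
  ∀ ⦃k' n' m' : ℕ⦄ ⦃Γ' : Fin n' → Typ S k'⦄ ⦃Θ' : Fin m' → RelDecl S k'⦄ ⦃p : Fin k → Fin k'⦄
    ⦃q : Fin n → Fin n'⦄ ⦃r : Fin m → Fin m'⦄, CxRen Γ Θ Γ' Θ' p q r →
      IsRel T Γ' Θ' (ρ.ren p q r) (σ.ren p) (τ.ren p)

/-- `ρ : AdmRel(σ,τ)` in the context and in all renamed contexts. -/
def StabAdm (T : Set (Form S 0 0 0)) (Γ : Fin n → Typ S k) (Θ : Fin m → RelDecl S k)
    (ρ : Rel S k n m) (σ τ : Typ S k) : Prop :=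
  ∀ ⦃k' n' m' : ℕ⦄ ⦃Γ' : Fin n' → Typ S k'⦄ ⦃Θ' : Fin m' → RelDecl S k'⦄ ⦃p : Fin k → Fin k'⦄
    ⦃q : Fin n → Fin n'⦄ ⦃r : Fin m → Fin m'⦄, CxRen Γ Θ Γ' Θ' p q r →
      IsAdm T Γ' Θ' (ρ.ren p q r) (σ.ren p) (τ.ren p)

theorem StabForm.wf {φ : Form S k n m} (h : StabForm T Γ Θ φ) : WfForm T Γ Θ φ := by
  simpa using h .refl

theorem StabRel.isRel {ρ : Rel S k n m} {σ τ : Typ S k} (h : StabRel T Γ Θ ρ σ τ) :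
    IsRel T Γ Θ ρ σ τ := by simpa using h .refl

theorem StabAdm.isAdm {ρ : Rel S k n m} {σ τ : Typ S k} (h : StabAdm T Γ Θ ρ σ τ) :
    IsAdm T Γ Θ ρ σ τ := by simpa using h .refl

theorem StabAdm.stabRel {ρ : Rel S k n m} {σ τ : Typ S k} (h : StabAdm T Γ Θ ρ σ τ) :
    StabRel T Γ Θ ρ σ τ := fun _ _ _ _ _ _ _ _ hc => .ofAdm (h hc)

theorem StabRel.ren {ρ : Rel S k n m} {σ τ : Typ S k} (h : StabRel T Γ Θ ρ σ τ)
    {p : Fin k → Fin k'} {q : Fin n → Fin n'} {r : Fin m → Fin m'}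
    (hc : CxRen Γ Θ Γ' Θ' p q r) : StabRel T Γ' Θ' (ρ.ren p q r) (σ.ren p) (τ.ren p) :=
  fun _ _ _ _ _ _ _ _ hc' => by
    rw [Rel.ren_ren, Ty.ren_ren, Ty.ren_ren]; exact h (hc.comp hc')

theorem StabAdm.ren {ρ : Rel S k n m} {σ τ : Typ S k} (h : StabAdm T Γ Θ ρ σ τ)
    {p : Fin k → Fin k'} {q : Fin n → Fin n'} {r : Fin m → Fin m'}
    (hc : CxRen Γ Θ Γ' Θ' p q r) : StabAdm T Γ' Θ' (ρ.ren p q r) (σ.ren p) (τ.ren p) :=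
  fun _ _ _ _ _ _ _ _ hc' => by
    rw [Rel.ren_ren, Ty.ren_ren, Ty.ren_ren]; exact h (hc.comp hc')

theorem StabForm.eq {σ : Typ S k} {t s : Tm S k n} (ht : HasType Γ allIntu t σ)
    (hs : HasType Γ allIntu s σ) : StabForm T Γ Θ (.eq σ t s) := fun _ _ _ _ _ _ _ _ hc => by
  rw [Form.ren]; exact .eq (ht.ren_intu hc.tm) (hs.ren_intu hc.tm)

theorem StabForm.rel {ρ : Rel S k n m} {σ τ : Typ S k} {t s : Tm S k n}
    (h : StabRel T Γ Θ ρ σ τ) (ht : HasType Γ allIntu t σ) (hs : HasType Γ allIntu s τ) :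
    StabForm T Γ Θ (.rel ρ t s) := fun _ _ _ _ _ _ _ _ hc => by
  rw [Form.ren]; exact .rel (h hc) (ht.ren_intu hc.tm) (hs.ren_intu hc.tm)

theorem StabForm.imp {φ ψ : Form S k n m} (h : StabForm T Γ Θ φ) (h' : StabForm T Γ Θ ψ) :
    StabForm T Γ Θ (.imp φ ψ) := fun _ _ _ _ _ _ _ _ hc => by
  rw [Form.ren]; exact .imp (h hc) (h' hc)

theorem StabForm.allTm {σ : Typ S k} {φ : Form S k (n + 1) m}
    (h : StabForm T (cons σ Γ) Θ φ) : StabForm T Γ Θ (.allTm σ φ) :=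
  fun _ _ _ _ _ _ _ _ hc => by rw [Form.ren]; exact .allTm (h (hc.lift_tm σ))

theorem StabForm.allTy {φ : Form S (k + 1) n m} (h : StabForm T (wkCx Γ 1) (wkRCx Θ 1) φ) :
    StabForm T Γ Θ (.allTy φ) :=
  fun _ _ _ _ _ _ _ _ hc => by rw [Form.ren]; exact .allTy (h hc.lift_ty)

theorem StabForm.allAdm {σ τ : Typ S k} {φ : Form S k n (m + 1)}
    (h : StabForm T Γ (cons ⟨true, σ, τ⟩ Θ) φ) : StabForm T Γ Θ (.allAdm σ τ φ) :=
  fun _ _ _ _ _ _ _ _ hc => by rw [Form.ren]; exact .allAdm (h (hc.lift_rel true σ τ))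

theorem StabRel.abs {σ τ : Typ S k} {φ : Form S k (n + 2) m}
    (h : StabForm T (cons τ (cons σ Γ)) Θ φ) : StabRel T Γ Θ (.abs σ τ φ) σ τ :=
  fun _ _ _ _ _ _ _ _ hc => by rw [Rel.ren]; exact .abs (h ((hc.lift_tm σ).lift_tm τ))

theorem StabAdm.var {j : Fin m} {σ τ : Typ S k} (h : Θ j = ⟨true, σ, τ⟩) :
    StabAdm T Γ Θ (.var j) σ τ := fun _ _ _ Γ' Θ' p q r hc => by
  have := hc.rel j
  rw [h] at this
  have h' := IsAdm.var (T := T) (Γ := Γ') (Θ := Θ') (r j) (by rw [this])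
  rw [this] at h'
  exact h'

theorem StabRel.var_adm {j : Fin m} {σ τ : Typ S k} (h : Θ j = ⟨true, σ, τ⟩) :
    StabRel T Γ Θ (.var j) σ τ := (StabAdm.var h).stabRel

theorem StabAdm.interp {a : ℕ} (σ : Typ S a) {ρs : Fin a → Rel S k n m}
    {τs τs' : Fin a → Typ S k} (h : ∀ i, StabAdm T Γ Θ (ρs i) (τs i) (τs' i)) :
    StabAdm T Γ Θ (.interp a σ ρs) (σ.sub τs) (σ.sub τs') := fun _ _ _ _ _ _ _ _ hc => by
  rw [Rel.ren, Ty.sub_ren, Ty.sub_ren]; exact .interp σ fun i => h i hc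

end Stability

section Rules

variable {S : Sig.{u, v}} {T : Set (Form S 0 0 0)} {k n m k' n' m' : ℕ}
  {Γ : Fin n → Typ S k} {Θ : Fin m → RelDecl S k} {Γ' : Fin n' → Typ S k'}
  {Θ' : Fin m' → RelDecl S k'} {Φ : List (Form S k n m)}

/-- All hypotheses are well-formed. -/
abbrev WfHyps (T : Set (Form S 0 0 0)) (Γ : Fin n → Typ S k) (Θ : Fin m → RelDecl S k)
    (Φ : List (Form S k n m)) : Prop := ∀ χ ∈ Φ, WfForm T Γ Θ χ

theorem WfHyps.nil : WfHyps T Γ Θ [] := fun _ h => absurd h List.not_mem_nil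

theorem WfHyps.singleton {φ : Form S k n m} (h : WfForm T Γ Θ φ) : WfHyps T Γ Θ [φ] := by
  intro χ hχ; rw [List.mem_singleton] at hχ; exact hχ ▸ h

theorem Prov.wkHyps {φ : Form S k n m} (h : Prov T Γ Θ [] φ) (hΦ : WfHyps T Γ Θ Φ) :
    Prov T Γ Θ Φ φ := .weaken h (List.nil_subset _) hΦ

/-- Substitution of types, terms and relation variables. -/
theorem Prov.subst_var {φ : Form S k n m} (h : Prov T Γ Θ Φ φ) (p : Fin k → Typ S k')
    (q : Fin n → Tm S k' n') (r : Fin m → Fin m')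
    (hq : ∀ i, HasType Γ' allIntu (q i) ((Γ i).sub p))
    (hr : ∀ j, Θ' (r j) = ⟨(Θ j).adm, (Θ j).dom.sub p, (Θ j).cod.sub p⟩) :
    Prov T Γ' Θ' (Φ.map fun χ => χ.sub p q fun j => .var (r j))
      (φ.sub p q fun j => .var (r j)) := by
  refine .subst p q _ h hq (fun j hj => ?_) (fun j hj => ?_)
  · have := IsRel.var (T := T) (Γ := Γ') (Θ := Θ') (r j) (by rw [hr]; exact hj)
    rwa [hr] at this
  · have := IsAdm.var (T := T) (Γ := Γ') (Θ := Θ') (r j) (by rw [hr]; exact hj)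
    rwa [hr] at this

theorem Prov.ren {φ : Form S k n m} (h : Prov T Γ Θ [] φ) {p : Fin k → Fin k'}
    {q : Fin n → Fin n'} {r : Fin m → Fin m'} (hc : CxRen Γ Θ Γ' Θ' p q r) :
    Prov T Γ' Θ' [] (φ.ren p q r) := by
  rw [Form.ren_eq_sub]
  refine h.subst_var (fun i => .var (p i)) (fun i => .var (q i)) r (fun i => ?_) (fun j => ?_)
  · exact .var_intu _ (by rw [hc.tm, Ty.ren_eq_sub])
  · rw [hc.rel, Ty.ren_eq_sub, Ty.ren_eq_sub]

/-- Substitution of a term for the most recent variable. -/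
theorem Prov.inst_tm {σ : Typ S k} {φ : Form S k (n + 1) m}
    (h : Prov T (cons σ Γ) Θ (Φ.map fun χ => χ.wk 0 1 0) φ) {t : Tm S k n}
    (ht : HasType Γ allIntu t σ) :
    Prov T Γ Θ Φ (φ.sub Ty.var (cons t Tm.var) Rel.var) := by
  have := h.subst_var (Γ' := Γ) (Θ' := Θ) Ty.var (cons t Tm.var) id
    (fun i => by
      rw [Ty.sub_var]
      exact Fin.cases ht (fun i => .var_intu i rfl) i)
    (fun j => by simp)
  rw [List.map_map] at this
  change Prov T Γ Θ _ (φ.sub Ty.var (cons t Tm.var) Rel.var) at this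
  convert this using 1
  conv_lhs => rw [← List.map_id Φ]
  refine List.map_congr_left fun χ _ => ?_
  simp only [id, Function.comp, Form.wk, Form.ren_sub]
  exact χ.sub_var.symm

theorem Prov.allTm_elim {σ : Typ S k} {φ : Form S k (n + 1) m}
    (h : Prov T Γ Θ Φ (.allTm σ φ)) {t : Tm S k n} (ht : HasType Γ allIntu t σ) :
    Prov T Γ Θ Φ (φ.sub Ty.var (cons t Tm.var) Rel.var) := h.allTmE.inst_tm ht

/-- Elimination of the quantifiers in `∀ α β. ∀ R : AdmRel(α,β). φ`. -/
theorem Prov.poly_elim {φ : Form S (k + 2) n (m + 1)}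
    (h : Prov T Γ Θ Φ (.allTy (.allTy (.allAdm (.var 1) (.var 0) φ)))) {A B : Typ S k}
    {R : Rel S k n m} (hR : IsAdm T Γ Θ R A B) :
    Prov T Γ Θ Φ (φ.sub (cons B (cons A Ty.var)) Tm.var (cons R Rel.var)) := by
  have hT : ∀ σ : Typ S k, (Ty.ren (Ty.ren σ (up 1)) (up 1)).sub (cons B (cons A Ty.var)) = σ := by
    intro σ; simp only [Ty.ren_sub, up_one, cons_succ]; exact σ.sub_var
  have := Prov.subst (Γ' := Γ) (Θ' := Θ) (cons B (cons A Ty.var)) Tm.var (cons R Rel.var)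
    h.allTyE.allTyE.allAdmE
    (fun i => by
      refine .var_intu i ?_
      simp only [wkCx, hT])
    (fun j hj => by
      revert hj
      refine Fin.cases (fun hj => nomatch hj) (fun j hj => ?_) j
      simp only [cons_succ, wkRCx, hT]
      exact .var j hj)
    (fun j hj => by
      revert hj
      refine Fin.cases (fun _ => hR) (fun j hj => ?_) j
      simp only [cons_succ, wkRCx, hT]
      exact .var j hj)
  rw [List.map_map, List.map_map, List.map_map] at this
  convert this using 1
  conv_lhs => rw [← List.map_id Φ]
  refine List.map_congr_left fun χ _ => ?_
  simp only [id, Function.comp, Form.wk, Form.ren_sub]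
  exact χ.sub_var.symm

/-- A relation `(x:σ, y:τ).φ` holds of `t` and `s` if and only if `φ[t/x, s/y]` does. -/
theorem Prov.abs_iff {σ τ : Typ S k} {φ : Form S k (n + 2) m} {t s : Tm S k n}
    (hΦ : WfHyps T Γ Θ Φ) (hφ : StabForm T (cons τ (cons σ Γ)) Θ φ)
    (ht : HasType Γ allIntu t σ) (hs : HasType Γ allIntu s τ) :
    Prov T Γ Θ Φ (.rel (.abs σ τ φ) t s) ↔
      Prov T Γ Θ Φ (φ.sub Ty.var (cons s (cons t Tm.var)) Rel.var) :=
  have h := Prov.wkHyps (Prov.defRel hφ.wf ht hs) hΦ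
  ⟨.impE h.andL, .impE h.andR⟩

/-- Equivalent relations hold of the same terms. -/
theorem Prov.equiv_iff {σ τ : Typ S k} {ρ ρ' : Rel S k n m} {t s : Tm S k n}
    (h : Prov T Γ Θ [] (Rel.equiv σ τ ρ ρ')) (hΦ : WfHyps T Γ Θ Φ)
    (ht : HasType Γ allIntu t σ) (hs : HasType Γ allIntu s τ) :
    Prov T Γ Θ Φ (.rel ρ t s) ↔ Prov T Γ Θ Φ (.rel ρ' t s) := by
  have h1 := h.allTm_elim ht
  rw [Form.sub, Ty.sub_var] at h1
  have h2 := h1.allTm_elim hs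
  have hρ : ∀ ρ : Rel S k n m,
      ((ρ.wk 0 2 0).sub Ty.var (Tm.lift (cons t Tm.var)) (fun j => (Rel.var j).wk 0 1 0)).sub
        Ty.var (cons s Tm.var) Rel.var = ρ := by
    intro ρ
    simp only [Rel.wk, Rel.ren_sub]
    have : ρ.sub Ty.var (fun i => .var i.succ) Rel.var = ρ.ren id (up 1) id :=
      (ρ.ren_eq_sub _ _ _).symm
    refine Eq.trans (congrArg (fun x => Rel.sub x Ty.var (cons s Tm.var) Rel.var) this) ?_
    rw [Rel.ren_sub]; exact ρ.sub_var
  simp only [Form.iff, Form.sub, Tm.sub] at h2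
  have e1 : (Tm.lift (cons t Tm.var) 1).sub Ty.var (cons s Tm.var) = t := by
    have : (1 : Fin (n + 2)) = Fin.succ 0 := rfl
    rw [this, Tm.lift_succ, Tm.ren_sub]; exact t.sub_var
  have e0 : (Tm.lift (cons t Tm.var) 0).sub Ty.var (cons s Tm.var) = s := rfl
  rw [e0, e1] at h2
  have h3 : Prov T Γ Θ Φ (.and (.imp (.rel ρ t s) (.rel ρ' t s))
      (.imp (.rel ρ' t s) (.rel ρ t s))) := by
    convert h2.wkHyps hΦ using 3 <;> exact congrArg (fun x => Form.rel x t s) (hρ _).symm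
  exact ⟨.impE h3.andL, .impE h3.andR⟩

/-- Related terms may be replaced by equal ones. -/
theorem Prov.rel_congr {σ τ : Typ S k} {ρ : Rel S k n m} {t t' s s' : Tm S k n}
    (hΦ : WfHyps T Γ Θ Φ) (hρ : IsRel T Γ Θ ρ σ τ) (h : Prov T Γ Θ Φ (.rel ρ t s))
    (ht : HasType Γ allIntu t σ) (ht' : HasType Γ allIntu t' σ)
    (hs : HasType Γ allIntu s τ) (hs' : HasType Γ allIntu s' τ)
    (h1 : Prov T Γ Θ Φ (.eq σ t t')) (h2 : Prov T Γ Θ Φ (.eq τ s s')) :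
    Prov T Γ Θ Φ (.rel ρ t' s') :=
  .impE (Prov.wkHyps (Prov.eqSubst hρ ht ht' hs hs') hΦ) (h.andI (h1.andI h2))

end Rules

/-! ## Equational reasoning -/

section Equality

variable {S : Sig.{u, v}} {T : Set (Form S 0 0 0)} {k n m k' n' m' : ℕ}
  {Γ : Fin n → Typ S k} {Θ : Fin m → RelDecl S k} {Γ' : Fin n' → Typ S k'}
  {Θ' : Fin m' → RelDecl S k'} {Φ : List (Form S k n m)}

/-- Provable equality of well-typed terms without linear variables. -/
structure PEq (T : Set (Form S 0 0 0)) (Γ : Fin n → Typ S k) (Θ : Fin m → RelDecl S k)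
    (Φ : List (Form S k n m)) (σ : Typ S k) (t s : Tm S k n) : Prop where
  left : HasType Γ allIntu t σ
  right : HasType Γ allIntu s σ
  prov : Prov T Γ Θ Φ (.eq σ t s)

namespace PEq

variable {σ τ : Typ S k} {t s r t' s' : Tm S k n}

theorem ofExtEq (hΦ : WfHyps T Γ Θ Φ) (ht : HasType Γ allIntu t σ) (hs : HasType Γ allIntu s σ)
    (h : ExtEq Γ allIntu σ t s) : PEq T Γ Θ Φ σ t s := ⟨ht, hs, (Prov.ofExtEq h).wkHyps hΦ⟩

theorem ofAx (hΦ : WfHyps T Γ Θ Φ) (ht : HasType Γ allIntu t σ) (hs : HasType Γ allIntu s σ)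
    (h : EqAx t s) : PEq T Γ Θ Φ σ t s := ofExtEq hΦ ht hs (.ax h ht hs)

theorem refl (hΦ : WfHyps T Γ Θ Φ) (ht : HasType Γ allIntu t σ) : PEq T Γ Θ Φ σ t t :=
  ofExtEq hΦ ht ht (.refl ht)

theorem symm (h : PEq T Γ Θ Φ σ t s) : PEq T Γ Θ Φ σ s t := ⟨h.right, h.left, h.prov.eqSymm⟩

theorem trans (h : PEq T Γ Θ Φ σ t s) (h' : PEq T Γ Θ Φ σ s r) : PEq T Γ Θ Φ σ t r :=
  ⟨h.left, h'.right, h.prov.eqTrans h'.prov⟩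

theorem wkHyps (h : PEq T Γ Θ [] σ t s) (hΦ : WfHyps T Γ Θ Φ) : PEq T Γ Θ Φ σ t s :=
  ⟨h.left, h.right, h.prov.wkHyps hΦ⟩

theorem ren (h : PEq T Γ Θ [] σ t s) {p : Fin k → Fin k'} {q : Fin n → Fin n'}
    {r : Fin m → Fin m'} (hc : CxRen Γ Θ Γ' Θ' p q r) :
    PEq T Γ' Θ' [] (σ.ren p) (t.ren p q) (s.ren p q) :=
  ⟨h.left.ren_intu hc.tm, h.right.ren_intu hc.tm, h.prov.ren hc⟩

theorem wk_tm (h : PEq T Γ Θ [] σ t s) (τ : Typ S k) :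
    PEq T (cons τ Γ) Θ [] σ (t.wk 0 1) (s.wk 0 1) := by
  have := h.ren (CxRen.tm_one τ)
  rw [up_zero, Ty.ren_id] at this
  exact this

/-- Equal terms may be substituted into a term. -/
theorem congr {C : Tm S k (n + 1)} (hΦ : WfHyps T Γ Θ Φ)
    (hC : HasType (cons σ Γ) allIntu C τ) (h : PEq T Γ Θ Φ σ t s) :
    PEq T Γ Θ Φ τ (C.inst t) (C.inst s) := by
  have hCt := hC.inst_intu h.left
  have hCs := hC.inst_intu h.right
  refine ⟨hCt, hCs, ?_⟩
  let φ : Form S k (n + 2) m := .eq τ ((C.inst t).wk 0 2) (C.ren id (cons 0 (up 2)))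
  have hφ : StabForm T (cons σ (cons σ Γ)) Θ φ := by
    refine .eq (hCt.wk_tm_two σ σ) ?_
    have := hC.ren_intu (Γ' := cons σ (cons σ Γ)) (p := id) (q := cons 0 (up 2))
      (fun i => by
        rw [Ty.ren_id]
        refine Fin.cases rfl (fun _ => rfl) i)
    rwa [Ty.ren_id] at this
  have key : ∀ x : Tm S k n, φ.sub Ty.var (cons x (cons t Tm.var)) Rel.var =
      .eq τ (C.inst t) (C.inst x) := by
    intro x
    simp only [φ, Form.sub, Ty.sub_var, Tm.wk, Tm.ren_sub]
    congr 1
    · exact Tm.sub_var _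
    · rw [Tm.inst]; congr 1; funext i; exact Fin.cases rfl (fun _ => rfl) i
  have h0 : Prov T Γ Θ Φ (.rel (.abs σ σ φ) t t) :=
    (Prov.abs_iff hΦ hφ h.left h.left).2 (by rw [key]; exact (refl hΦ hCt).prov)
  have h1 := Prov.rel_congr hΦ (StabRel.abs hφ).isRel h0 h.left h.left h.left h.right
    (refl hΦ h.left).prov h.prov
  have h2 := (Prov.abs_iff hΦ hφ h.left h.right).1 h1
  rwa [key] at h2

theorem app (hΦ : WfHyps T Γ Θ Φ) (h : PEq T Γ Θ Φ (.lolli σ τ) t t') (h' : PEq T Γ Θ Φ σ s s') :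
    PEq T Γ Θ Φ τ (.app t s) (.app t' s') := by
  have h1 := congr (C := .app (.var 0) (s.wk 0 1)) hΦ
    (.app_intu (.var_intu 0 rfl) (h'.left.wk_tm _)) h
  have h2 := congr (C := .app (t'.wk 0 1) (.var 0)) hΦ
    (.app_intu (h.right.wk_tm _) (.var_intu 0 rfl)) h'
  simp only [Tm.inst, Tm.sub, cons_zero, Tm.wk_sub_cons] at h1 h2
  exact h1.trans h2

theorem tensor (hΦ : WfHyps T Γ Θ Φ) (h : PEq T Γ Θ Φ σ t t') (h' : PEq T Γ Θ Φ τ s s') :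
    PEq T Γ Θ Φ (.tensor σ τ) (.tensor t s) (.tensor t' s') := by
  have h1 := congr (C := .tensor (.var 0) (s.wk 0 1)) hΦ
    (.tensor_intu (.var_intu 0 rfl) (h'.left.wk_tm _)) h
  have h2 := congr (C := .tensor (t'.wk 0 1) (.var 0)) hΦ
    (.tensor_intu (h.right.wk_tm _) (.var_intu 0 rfl)) h'
  simp only [Tm.inst, Tm.sub, cons_zero, Tm.wk_sub_cons] at h1 h2
  exact h1.trans h2

theorem bang (hΦ : WfHyps T Γ Θ Φ) (h : PEq T Γ Θ Φ σ t t') :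
    PEq T Γ Θ Φ (.bang σ) (.bang t) (.bang t') :=
  congr (C := .bang (.var 0)) hΦ (.bang_intu (.var_intu 0 rfl)) h

theorem tapp {σ : Typ S (k + 1)} (hΦ : WfHyps T Γ Θ Φ) (h : PEq T Γ Θ Φ (.all σ) t t')
    (A : Typ S k) (e : σ.inst A = τ) : PEq T Γ Θ Φ τ (.tapp t A) (.tapp t' A) := by
  have := congr (C := .tapp (.var 0) A) hΦ (.tapp_intu A (.var_intu 0 rfl) e) h
  simpa [Tm.inst, Tm.sub] using this

theorem beta {t : Tm S k (n + 1)} (hΦ : WfHyps T Γ Θ Φ)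
    (ht : HasType (cons σ Γ) (cons .lin allIntu) t τ) (hs : HasType Γ allIntu s σ) :
    PEq T Γ Θ Φ τ (.app (.lam σ t) s) (t.inst s) :=
  ofAx hΦ (.app_intu (.lam ht) hs) (ht.inst_lin hs) (.betaTerm σ t s)

theorem tbeta {t : Tm S (k + 1) n} {σ : Typ S (k + 1)} (hΦ : WfHyps T Γ Θ Φ)
    (ht : HasType (wkCx Γ 1) allIntu t σ) (A : Typ S k) (e : σ.inst A = τ) :
    PEq T Γ Θ Φ τ (.tapp (.tlam t) A) (t.tinst A) :=
  ofAx hΦ (.tapp_intu A (.tlam ht) e) (e ▸ ht.tinst_intu A) (.betaType t A)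

theorem beta_idTm (hΦ : WfHyps T Γ Θ Φ) (hs : HasType Γ allIntu s σ) :
    PEq T Γ Θ Φ σ (.app (Tm.idTm σ) s) s :=
  ofAx hΦ (.app_intu (.idTm noLin_allIntu σ) hs) hs (.betaTerm σ (.var 0) s)

theorem _root_.LAPL.HasType.comp_intu {ω : Typ S k} {f g : Tm S k n}
    (hf : HasType Γ allIntu f (.lolli σ τ)) (hg : HasType Γ allIntu g (.lolli ω σ)) :
    HasType Γ allIntu (Tm.comp ω f g) (.lolli ω τ) := by
  have w : ∀ {f : Tm S k n} {τ : Typ S k}, HasType Γ allIntu f τ →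
      HasType (cons ω Γ) (cons .off allIntu) (f.wk 0 1) τ := by
    intro f τ hf
    have := hf.ren_noLin (Γ' := cons ω Γ) (d' := cons .off allIntu) noLin_allIntu
      (noLin_allIntu.cons (by simp)) (p := id) (q := Fin.succ) (fun i => (Ty.ren_id _).symm)
      (fun i h => h)
    rwa [Ty.ren_id] at this
  refine .lam (.app (noLin_allIntu.splits.cons .right) (w hf)
    (.app (noLin_allIntu.splits.cons .right) (w hg) (.varLin 0 rfl fun j hj => ?_)))
  exact Fin.cases (fun h => absurd rfl h) (fun i _ => noLin_allIntu i) j hj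

theorem beta_comp {ω : Typ S k} {f g : Tm S k n} (hΦ : WfHyps T Γ Θ Φ)
    (hf : HasType Γ allIntu f (.lolli σ τ)) (hg : HasType Γ allIntu g (.lolli ω σ))
    (hs : HasType Γ allIntu s ω) :
    PEq T Γ Θ Φ τ (.app (Tm.comp ω f g) s) (.app f (.app g s)) := by
  have e : (Tm.app (f.wk 0 1) (.app (g.wk 0 1) (.var 0))).inst s = .app f (.app g s) := by
    simp only [Tm.inst, Tm.sub, cons_zero, Tm.wk_sub_cons]
  exact ofAx hΦ (.app_intu (hf.comp_intu hg) hs) (.app_intu hf (.app_intu hg hs))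
    (e ▸ .betaTerm ω _ s)

/-- Extensionality for linear functions. -/
theorem funext (hExt : Extensionality T) (ht : HasType Γ allIntu t (.lolli σ τ))
    (hs : HasType Γ allIntu s (.lolli σ τ))
    (h : PEq T (cons σ Γ) Θ [] τ (.app (t.wk 0 1) (.var 0)) (.app (s.wk 0 1) (.var 0))) :
    PEq T Γ Θ [] (.lolli σ τ) t s :=
  ⟨ht, hs, .impE (hExt.1 Γ Θ σ τ t s ht hs) (.allTmI WfHyps.nil h.prov)⟩

/-- Extensionality for polymorphic terms. -/
theorem tyext {τ : Typ S (k + 1)} (hExt : Extensionality T) (ht : HasType Γ allIntu t (.all τ))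
    (hs : HasType Γ allIntu s (.all τ))
    (h : PEq T (wkCx Γ 1) (wkRCx Θ 1) [] τ (.tapp (t.wk 1 0) (.var 0))
      (.tapp (s.wk 1 0) (.var 0))) :
    PEq T Γ Θ [] (.all τ) t s :=
  ⟨ht, hs, .impE (hExt.2 Γ Θ τ t s ht hs) (.allTyI WfHyps.nil h.prov)⟩

/-- Replacing related terms by equal ones. -/
theorem rel {ρ : Rel S k n m} (hΦ : WfHyps T Γ Θ Φ) (hρ : IsRel T Γ Θ ρ σ τ)
    (ht : PEq T Γ Θ Φ σ t t') (hs : PEq T Γ Θ Φ τ s s')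
    (h : Prov T Γ Θ Φ (.rel ρ t s)) : Prov T Γ Θ Φ (.rel ρ t' s') :=
  Prov.rel_congr hΦ hρ h ht.left ht.right hs.left hs.right ht.prov hs.prov

end PEq

end Equality

/-! ## Rules for the constructions on relations -/

section Substitution

variable {S : Sig.{u, v}} {k n m k' n' m' : ℕ}

theorem Rel.wk_tm_two_sub (ρ : Rel S k n m) (t s : Tm S k n) :
    (ρ.wk 0 2 0).sub Ty.var (cons s (cons t Tm.var)) Rel.var = ρ := by
  rw [Rel.wk, Rel.ren_sub]; exact ρ.sub_var

theorem Tm.wk_two_sub (f t s : Tm S k n) :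
    (f.wk 0 2).sub Ty.var (cons s (cons t Tm.var)) = f := by
  rw [Tm.wk, Tm.ren_sub]; exact f.sub_var

theorem Tm.lift_lift_lift_lift_up {l : ℕ} (q : Fin n → Tm S l m) (i : Fin n) :
    lift (lift (lift (lift q))) (up 4 i) = (q i).wk 0 4 := by
  simp only [up_four, lift_succ, ren_ren]; rfl

theorem Rel.wk_tm_four (ρ : Rel S k n m) :
    (((ρ.wk 0 2 0).wk 0 1 0).wk 0 1 0) = ρ.wk 0 4 0 := by
  simp only [Rel.wk, Rel.ren_ren]; rfl

theorem Rel.wk_tm_four_sub (ρ : Rel S k n m) (p : Fin k → Typ S k') (q : Fin n → Tm S k' n')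
    (r : Fin m → Rel S k' n' m') :
    Rel.sub (k := k) (n := n + 2 + 1 + 1) (m := m) (k' := k') (n' := n' + 2 + 1 + 1) (m' := m')
      (ρ.wk 0 4 0) p (Tm.lift (Tm.lift (Tm.lift (Tm.lift q))))
      (fun j => (((r j).wk 0 2 0).wk 0 1 0).wk 0 1 0) = (ρ.sub p q r).wk 0 4 0 :=
  ρ.wk_sub (fun i => (Ty.ren_id _).symm) (Tm.lift_lift_lift_lift_up q)
    (fun j => (r j).wk_tm_four)

theorem Rel.lolli_sub (σ τ σ' τ' : Typ S k) (ρ ρ' : Rel S k n m) (p : Fin k → Typ S k')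
    (q : Fin n → Tm S k' n') (r : Fin m → Rel S k' n' m') :
    (Rel.lolli σ τ σ' τ' ρ ρ').sub p q r =
      Rel.lolli (σ.sub p) (τ.sub p) (σ'.sub p) (τ'.sub p) (ρ.sub p q r) (ρ'.sub p q r) := by
  simp only [Rel.lolli, Rel.sub, Form.sub, Rel.wk_tm_four_sub]
  rfl

theorem Rel.arrow_sub (σ τ σ' τ' : Typ S k) (ρ ρ' : Rel S k n m) (p : Fin k → Typ S k')
    (q : Fin n → Tm S k' n') (r : Fin m → Rel S k' n' m') :
    (Rel.arrow σ τ σ' τ' ρ ρ').sub p q r =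
      Rel.arrow (σ.sub p) (τ.sub p) (σ'.sub p) (τ'.sub p) (ρ.sub p q r) (ρ'.sub p q r) := by
  simp only [Rel.arrow, Rel.sub, Form.sub, Rel.wk_tm_four_sub]
  rfl

theorem Rel.arrow_ren (σ τ σ' τ' : Typ S k) (ρ ρ' : Rel S k n m) (p : Fin k → Fin k')
    (q : Fin n → Fin n') (r : Fin m → Fin m') :
    (Rel.arrow σ τ σ' τ' ρ ρ').ren p q r =
      Rel.arrow (σ.ren p) (τ.ren p) (σ'.ren p) (τ'.ren p) (ρ.ren p q r) (ρ'.ren p q r) := by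
  simp only [Rel.ren_eq_sub, Rel.arrow_sub, Ty.ren_eq_sub]

theorem Rel.graph_sub (σ τ : Typ S k) (f : Tm S k n) (p : Fin k → Typ S k')
    (q : Fin n → Tm S k' n') (r : Fin m → Rel S k' n' m') :
    (Rel.graph σ τ f).sub p q r = Rel.graph (σ.sub p) (τ.sub p) (f.sub p q) := by
  have : (f.wk 0 2).sub p (Tm.lift (Tm.lift q)) = (f.sub p q).wk 0 2 :=
    f.wk_sub (fun i => (Ty.ren_id _).symm) (Tm.lift_lift_up q)
  simp only [Rel.graph, Rel.sub, Form.sub, Tm.sub, this]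
  rfl

theorem Rel.graph_ren (σ τ : Typ S k) (f : Tm S k n) (p : Fin k → Fin k') (q : Fin n → Fin n')
    (r : Fin m → Fin m') :
    (Rel.graph σ τ f).ren p q r = Rel.graph (σ.ren p) (τ.ren p) (f.ren p q) := by
  simp only [Rel.ren_eq_sub, Rel.graph_sub, Ty.ren_eq_sub, Tm.ren_eq_sub]

theorem Rel.eqRel_sub (σ : Typ S k) (p : Fin k → Typ S k')
    (q : Fin n → Tm S k' n') (r : Fin m → Rel S k' n' m') :
    (Rel.eqRel σ).sub p q r = Rel.eqRel (σ.sub p) := Rel.graph_sub ..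

theorem Rel.eqRel_ren (σ : Typ S k) (p : Fin k → Fin k') (q : Fin n → Fin n')
    (r : Fin m → Fin m') : (Rel.eqRel σ : Rel S k n m).ren p q r = Rel.eqRel (σ.ren p) :=
  Rel.graph_ren ..

end Substitution

section Relations

variable {S : Sig.{u, v}} {T : Set (Form S 0 0 0)} {k n m : ℕ}
  {Γ : Fin n → Typ S k} {Θ : Fin m → RelDecl S k} {Φ : List (Form S k n m)}

theorem StabRel.wk_tm_two {ρ : Rel S k n m} {σ τ : Typ S k} (h : StabRel T Γ Θ ρ σ τ)
    (A B : Typ S k) : StabRel T (cons B (cons A Γ)) Θ (ρ.wk 0 2 0) σ τ := by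
  have := h.ren (CxRen.tm_two A B)
  rwa [up_zero, Ty.ren_id, Ty.ren_id] at this

theorem StabRel.wk_tm_four {ρ : Rel S k n m} {σ τ : Typ S k} (h : StabRel T Γ Θ ρ σ τ)
    (A B C D : Typ S k) :
    StabRel T (cons D (cons C (cons B (cons A Γ)))) Θ (ρ.wk 0 4 0) σ τ := by
  have := h.ren (CxRen.tm_four (Γ := Γ) (Θ := Θ) A B C D)
  rwa [up_zero, Ty.ren_id, Ty.ren_id] at this

theorem StabAdm.wk_tm_two {ρ : Rel S k n m} {σ τ : Typ S k} (h : StabAdm T Γ Θ ρ σ τ)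
    (A B : Typ S k) : StabAdm T (cons B (cons A Γ)) Θ (ρ.wk 0 2 0) σ τ := by
  have := h.ren (CxRen.tm_two A B)
  rwa [up_zero, Ty.ren_id, Ty.ren_id] at this

theorem Prov.reindex_iff {σ τ σ' τ' : Typ S k} {f g : Tm S k n} {ρ : Rel S k n m}
    {t s : Tm S k n} (hΦ : WfHyps T Γ Θ Φ) (hρ : StabRel T Γ Θ ρ σ τ)
    (hf : HasType Γ allIntu f (.lolli σ' σ)) (hg : HasType Γ allIntu g (.lolli τ' τ))
    (ht : HasType Γ allIntu t σ') (hs : HasType Γ allIntu s τ') :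
    Prov T Γ Θ Φ (.rel (Rel.reindex σ' τ' f g ρ) t s) ↔
      Prov T Γ Θ Φ (.rel ρ (.app f t) (.app g s)) := by
  rw [Rel.reindex, Prov.abs_iff hΦ ?_ ht hs]
  · simp only [Form.sub, Tm.sub, Rel.wk_tm_two_sub, Tm.wk_two_sub, cons_zero, cons_one]
  · exact .rel (hρ.wk_tm_two _ _) (.app_intu (hf.wk_tm_two _ _) (.var_intu 1 rfl))
      (.app_intu (hg.wk_tm_two _ _) (.var_intu 0 rfl))

theorem Prov.graph_iff {σ τ : Typ S k} {f t s : Tm S k n} (hΦ : WfHyps T Γ Θ Φ)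
    (hf : HasType Γ allIntu f (.lolli σ τ)) (ht : HasType Γ allIntu t σ)
    (hs : HasType Γ allIntu s τ) :
    Prov T Γ Θ Φ (.rel (Rel.graph σ τ f) t s) ↔ PEq T Γ Θ Φ τ (.app f t) s := by
  rw [Rel.graph, Prov.abs_iff hΦ ?_ ht hs]
  · simp only [Form.sub, Tm.sub, Ty.sub_var, Tm.wk_two_sub, cons_zero, cons_one]
    exact ⟨fun h => ⟨.app_intu hf ht, hs, h⟩, fun h => h.prov⟩
  · exact .eq (.app_intu (hf.wk_tm_two _ _) (.var_intu 1 rfl)) (.var_intu 0 rfl)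

theorem Prov.eqRel_iff {σ : Typ S k} {t s : Tm S k n} (hΦ : WfHyps T Γ Θ Φ)
    (ht : HasType Γ allIntu t σ) (hs : HasType Γ allIntu s σ) :
    Prov T Γ Θ Φ (.rel (Rel.eqRel σ) t s) ↔ PEq T Γ Θ Φ σ t s := by
  rw [Rel.eqRel, Prov.graph_iff hΦ (.idTm noLin_allIntu σ) ht hs]
  have := PEq.beta_idTm (T := T) hΦ ht
  exact ⟨this.symm.trans, this.trans⟩

theorem StabAdm.eqRel (σ : Typ S k) : StabAdm T Γ Θ (Rel.eqRel σ) σ σ :=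
  fun _ _ _ _ _ _ _ _ _ => by rw [Rel.eqRel_ren]; exact .eqRel _

theorem IsRel.graph {σ τ : Typ S k} {f : Tm S k n} (hf : HasType Γ allIntu f (.lolli σ τ)) :
    IsRel T Γ Θ (Rel.graph σ τ f) σ τ :=
  .abs (.eq (.app_intu (hf.wk_tm_two _ _) (.var_intu 1 rfl)) (.var_intu 0 rfl))

theorem Prov.allTm_intro {σ : Typ S k} {φ : Form S k (n + 1) m}
    (h : Prov T (cons σ Γ) Θ [] φ) : Prov T Γ Θ [] (.allTm σ φ) := .allTmI WfHyps.nil h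

/-- The graph of a map is admissible, being equivalent to the inverse image of equality. -/
theorem IsAdm.graph {σ τ : Typ S k} {f : Tm S k n} (hf : HasType Γ allIntu f (.lolli σ τ)) :
    IsAdm T Γ Θ (Rel.graph σ τ f) σ τ := by
  refine .equiv (.reindex (.eqRel τ) hf (.idTm noLin_allIntu τ)) (.graph hf) ?_
  refine Prov.allTm_intro (Prov.allTm_intro ?_)
  have hf' := hf.wk_tm_two σ τ
  have ht : HasType (cons τ (cons σ Γ)) allIntu (Tm.var 1) σ := .var_intu 1 rfl
  have hs : HasType (cons τ (cons σ Γ)) allIntu (Tm.var 0) τ := .var_intu 0 rfl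
  have hid : HasType (cons τ (cons σ Γ)) allIntu (Tm.idTm τ) (.lolli τ τ) :=
    .idTm noLin_allIntu τ
  have hst : HasType (cons τ (cons σ Γ)) allIntu (.app (f.wk 0 2) (.var 1)) τ := .app_intu hf' ht
  have e1 : (Rel.reindex σ τ f (Tm.idTm τ) (Rel.eqRel τ) : Rel S k n m).wk 0 2 0 =
      Rel.reindex σ τ (f.wk 0 2) (Tm.idTm τ) (Rel.eqRel τ) := by
    have : (f.wk 0 2).ren (up 0) (liftR (liftR (up 2))) = (f.wk 0 2).wk 0 2 := by
      simp only [Tm.wk, Tm.ren_ren]; rfl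
    simp only [Rel.reindex, Rel.wk, Rel.ren, Form.ren, Rel.eqRel_ren, Tm.ren, this]
    simp only [up_zero, Ty.ren_id]
    simp only [Tm.wk, Tm.idTm, Tm.ren, up_zero, Ty.ren_id]
    rfl
  have e2 : (Rel.graph σ τ f : Rel S k n m).wk 0 2 0 = Rel.graph σ τ (f.wk 0 2) := by
    rw [Rel.wk, Rel.graph_ren, up_zero, Ty.ren_id, Ty.ren_id]; rfl
  have hR : StabRel T (cons τ (cons σ Γ)) Θ (Rel.eqRel τ) τ τ := (StabAdm.eqRel τ).stabRel
  have hw1 : WfForm T (cons τ (cons σ Γ)) Θ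
      (.rel (Rel.reindex σ τ (f.wk 0 2) (Tm.idTm τ) (Rel.eqRel τ)) (.var 1) (.var 0)) :=
    .rel (.ofAdm (.reindex (.eqRel τ) hf' hid)) ht hs
  have hw2 : WfForm T (cons τ (cons σ Γ)) Θ (.rel (Rel.graph σ τ (f.wk 0 2)) (.var 1) (.var 0)) :=
    .rel (.graph hf') ht hs
  rw [e1, e2]
  refine .andI (.impI ?_) (.impI ?_)
  · have hΦ := WfHyps.singleton hw1
    have h := Prov.hyp hΦ (List.mem_singleton_self _)
    rw [Prov.reindex_iff hΦ hR hf' hid ht hs, Prov.eqRel_iff hΦ hst (.app_intu hid hs)] at h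
    rw [Prov.graph_iff hΦ hf' ht hs]
    exact h.trans (.beta_idTm hΦ hs)
  · have hΦ := WfHyps.singleton hw2
    have h := Prov.hyp hΦ (List.mem_singleton_self _)
    rw [Prov.graph_iff hΦ hf' ht hs] at h
    rw [Prov.reindex_iff hΦ hR hf' hid ht hs, Prov.eqRel_iff hΦ hst (.app_intu hid hs)]
    exact h.trans (PEq.beta_idTm hΦ hs).symm

theorem StabAdm.graph {σ τ : Typ S k} {f : Tm S k n}
    (hf : HasType Γ allIntu f (.lolli σ τ)) : StabAdm T Γ Θ (Rel.graph σ τ f) σ τ :=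
  fun _ _ _ _ _ _ _ _ hc => by rw [Rel.graph_ren]; exact .graph (hf.ren_intu hc.tm)

theorem StabForm.lolli_body {σ τ σ' τ' : Typ S k} {ρ ρ' : Rel S k n m}
    (hρ : StabRel T Γ Θ ρ σ τ) (hρ' : StabRel T Γ Θ ρ' σ' τ') :
    StabForm T (cons (.lolli τ τ') (cons (.lolli σ σ') Γ)) Θ (.allTm σ (.allTm τ (.imp
      (.rel (ρ.wk 0 4 0) (.var 1) (.var 0))
      (.rel (ρ'.wk 0 4 0) (.app (.var 3) (.var 1)) (.app (.var 2) (.var 0)))))) :=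
  .allTm (.allTm (.imp (.rel (hρ.wk_tm_four _ _ _ _) (.var_intu 1 rfl) (.var_intu 0 rfl))
    (.rel (hρ'.wk_tm_four _ _ _ _) (.app_intu (.var_intu 3 rfl) (.var_intu 1 rfl))
      (.app_intu (.var_intu 2 rfl) (.var_intu 0 rfl)))))

theorem StabRel.lolli {σ τ σ' τ' : Typ S k} {ρ ρ' : Rel S k n m}
    (hρ : StabRel T Γ Θ ρ σ τ) (hρ' : StabRel T Γ Θ ρ' σ' τ') :
    StabRel T Γ Θ (Rel.lolli σ τ σ' τ' ρ ρ') (.lolli σ σ') (.lolli τ τ') :=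
  .abs (.lolli_body hρ hρ')

theorem StabForm.arrow_body {σ τ σ' τ' : Typ S k} {ρ ρ' : Rel S k n m}
    (hρ : StabRel T Γ Θ ρ σ τ) (hρ' : StabRel T Γ Θ ρ' σ' τ') :
    StabForm T (cons (.lolli (.bang τ) τ') (cons (.lolli (.bang σ) σ') Γ)) Θ
      (.allTm σ (.allTm τ (.imp (.rel (ρ.wk 0 4 0) (.var 1) (.var 0))
        (.rel (ρ'.wk 0 4 0) (.app (.var 3) (.bang (.var 1)))
          (.app (.var 2) (.bang (.var 0))))))) :=
  .allTm (.allTm (.imp (.rel (hρ.wk_tm_four _ _ _ _) (.var_intu 1 rfl) (.var_intu 0 rfl))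
    (.rel (hρ'.wk_tm_four _ _ _ _)
      (.app_intu (.var_intu 3 rfl) (.bang_intu (.var_intu 1 rfl)))
      (.app_intu (.var_intu 2 rfl) (.bang_intu (.var_intu 0 rfl))))))

theorem StabRel.arrow {σ τ σ' τ' : Typ S k} {ρ ρ' : Rel S k n m}
    (hρ : StabRel T Γ Θ ρ σ τ) (hρ' : StabRel T Γ Θ ρ' σ' τ') :
    StabRel T Γ Θ (Rel.arrow σ τ σ' τ' ρ ρ') (.lolli (.bang σ) σ') (.lolli (.bang τ) τ') :=
  .abs (.arrow_body hρ hρ')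

/-- Instantiation of two universally quantified term variables. -/
theorem Prov.allTm_elim_two {σ τ : Typ S k} {φ : Form S k (n + 2) m}
    (h : Prov T Γ Θ Φ (.allTm σ (.allTm τ φ))) {t s : Tm S k n} (ht : HasType Γ allIntu t σ)
    (hs : HasType Γ allIntu s τ) :
    Prov T Γ Θ Φ (φ.sub Ty.var (cons s (cons t Tm.var)) Rel.var) := by
  have := h.allTmE.allTmE.subst_var (Γ' := Γ) (Θ' := Θ) Ty.var (cons s (cons t Tm.var)) id
    (fun i => by
      rw [Ty.sub_var]
      exact Fin.cases hs (fun i => Fin.cases ht (fun i => .var_intu i rfl) i) i)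
    (fun j => by simp)
  rw [List.map_map, List.map_map] at this
  change Prov T Γ Θ _ (φ.sub Ty.var (cons s (cons t Tm.var)) Rel.var) at this
  convert this using 1
  conv_lhs => rw [← List.map_id Φ]
  refine List.map_congr_left fun χ _ => ?_
  simp only [id, Function.comp, Form.wk, Form.ren_sub]
  exact χ.sub_var.symm

/-- The substitution in the body of `ρ ⊸ ρ'` and `ρ → ρ'`. -/
theorem Rel.wk_four_sub_two (ρ : Rel S k n m) (t s : Tm S k n) :
    Rel.sub (k := k) (n := n + 2 + 1 + 1) (m := m) (k' := k) (n' := n + 1 + 1) (m' := m)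
      (ρ.wk 0 4 0) Ty.var (Tm.lift (Tm.lift (cons s (cons t Tm.var))))
      (fun j => ((Rel.var j).wk 0 1 0).wk 0 1 0) = ρ.wk 0 2 0 := by
  rw [Rel.wk, Rel.ren_sub, Rel.wk, Rel.ren_eq_sub]; rfl

theorem Tm.lift_lift_three (t s : Tm S k n) :
    Tm.lift (Tm.lift (cons s (cons t Tm.var))) 3 = t.wk 0 2 := by
  have : (3 : Fin (n + 4)) = (Fin.succ (Fin.succ 1)) := rfl
  rw [this, Tm.lift_succ, Tm.lift_succ, Tm.ren_ren]; rfl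

theorem Tm.lift_lift_two (t s : Tm S k n) :
    Tm.lift (Tm.lift (cons s (cons t Tm.var))) 2 = s.wk 0 2 := by
  have : (2 : Fin (n + 4)) = (Fin.succ (Fin.succ 0)) := rfl
  rw [this, Tm.lift_succ, Tm.lift_succ, Tm.ren_ren]; rfl

theorem Prov.lolli_iff {σ τ σ' τ' : Typ S k} {ρ ρ' : Rel S k n m} {t s : Tm S k n}
    (hΦ : WfHyps T Γ Θ Φ) (hρ : StabRel T Γ Θ ρ σ τ) (hρ' : StabRel T Γ Θ ρ' σ' τ')
    (ht : HasType Γ allIntu t (.lolli σ σ')) (hs : HasType Γ allIntu s (.lolli τ τ')) :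
    Prov T Γ Θ Φ (.rel (Rel.lolli σ τ σ' τ' ρ ρ') t s) ↔
      Prov T Γ Θ Φ (.allTm σ (.allTm τ (.imp (.rel (ρ.wk 0 2 0) (.var 1) (.var 0))
        (.rel (ρ'.wk 0 2 0) (.app (t.wk 0 2) (.var 1)) (.app (s.wk 0 2) (.var 0)))))) := by
  rw [Rel.lolli, Prov.abs_iff hΦ (.lolli_body hρ hρ') ht hs]
  simp only [Form.sub, Tm.sub, Ty.sub_var, Rel.wk_four_sub_two, Tm.lift_lift_two,
    Tm.lift_lift_three]
  rfl

theorem Prov.arrow_iff {σ τ σ' τ' : Typ S k} {ρ ρ' : Rel S k n m} {t s : Tm S k n}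
    (hΦ : WfHyps T Γ Θ Φ) (hρ : StabRel T Γ Θ ρ σ τ) (hρ' : StabRel T Γ Θ ρ' σ' τ')
    (ht : HasType Γ allIntu t (.lolli (.bang σ) σ'))
    (hs : HasType Γ allIntu s (.lolli (.bang τ) τ')) :
    Prov T Γ Θ Φ (.rel (Rel.arrow σ τ σ' τ' ρ ρ') t s) ↔
      Prov T Γ Θ Φ (.allTm σ (.allTm τ (.imp (.rel (ρ.wk 0 2 0) (.var 1) (.var 0))
        (.rel (ρ'.wk 0 2 0) (.app (t.wk 0 2) (.bang (.var 1)))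
          (.app (s.wk 0 2) (.bang (.var 0))))))) := by
  rw [Rel.arrow, Prov.abs_iff hΦ (.arrow_body hρ hρ') ht hs]
  simp only [Form.sub, Tm.sub, Ty.sub_var, Rel.wk_four_sub_two, Tm.lift_lift_two,
    Tm.lift_lift_three]
  rfl

theorem Prov.lolli_elim {σ τ σ' τ' : Typ S k} {ρ ρ' : Rel S k n m} {t s x y : Tm S k n}
    (hΦ : WfHyps T Γ Θ Φ) (hρ : StabRel T Γ Θ ρ σ τ) (hρ' : StabRel T Γ Θ ρ' σ' τ')
    (ht : HasType Γ allIntu t (.lolli σ σ')) (hs : HasType Γ allIntu s (.lolli τ τ'))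
    (h : Prov T Γ Θ Φ (.rel (Rel.lolli σ τ σ' τ' ρ ρ') t s))
    (hx : HasType Γ allIntu x σ) (hy : HasType Γ allIntu y τ)
    (hxy : Prov T Γ Θ Φ (.rel ρ x y)) : Prov T Γ Θ Φ (.rel ρ' (.app t x) (.app s y)) := by
  have := ((Prov.lolli_iff hΦ hρ hρ' ht hs).1 h).allTm_elim_two hx hy
  simp only [Form.sub, Tm.sub, Rel.wk_tm_two_sub, Tm.wk_two_sub, cons_zero, cons_one] at this
  exact .impE this hxy

theorem Prov.arrow_elim {σ τ σ' τ' : Typ S k} {ρ ρ' : Rel S k n m} {t s x y : Tm S k n}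
    (hΦ : WfHyps T Γ Θ Φ) (hρ : StabRel T Γ Θ ρ σ τ) (hρ' : StabRel T Γ Θ ρ' σ' τ')
    (ht : HasType Γ allIntu t (.lolli (.bang σ) σ'))
    (hs : HasType Γ allIntu s (.lolli (.bang τ) τ'))
    (h : Prov T Γ Θ Φ (.rel (Rel.arrow σ τ σ' τ' ρ ρ') t s))
    (hx : HasType Γ allIntu x σ) (hy : HasType Γ allIntu y τ)
    (hxy : Prov T Γ Θ Φ (.rel ρ x y)) :
    Prov T Γ Θ Φ (.rel ρ' (.app t (.bang x)) (.app s (.bang y))) := by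
  have := ((Prov.arrow_iff hΦ hρ hρ' ht hs).1 h).allTm_elim_two hx hy
  simp only [Form.sub, Tm.sub, Rel.wk_tm_two_sub, Tm.wk_two_sub, cons_zero, cons_one] at this
  exact .impE this hxy

/-- A form of the introduction rule for `∀ x y. φ ⊃ ψ`. -/
theorem Prov.allTm_imp_intro {σ τ : Typ S k} {φ ψ : Form S k (n + 2) m}
    (h : Prov T (cons τ (cons σ Γ)) Θ [φ] ψ) :
    Prov T Γ Θ [] (.allTm σ (.allTm τ (.imp φ ψ))) := .allTm_intro (.allTm_intro (.impI h))

/-! ### Polymorphic relations -/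

/-- `σ[α]` in the context `α, β`. -/
def Ty.instFst (σ : Typ S (k + 1)) : Typ S (k + 2) :=
  σ.sub (cons (.var 1) fun i => .var i.succ.succ)

/-- `σ[β]` in the context `α, β`. -/
def Ty.instSnd (σ : Typ S (k + 1)) : Typ S (k + 2) :=
  σ.sub (cons (.var 0) fun i => .var i.succ.succ)

theorem Ty.ren_inst_fst (σ : Typ S (k + 1)) :
    ((σ.ren (liftR (up 1))).ren (liftR (up 1))).inst (.var 1) = Ty.instFst σ := by
  rw [Ty.ren_ren, Ty.inst, Ty.ren_sub, Ty.instFst]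
  congr 1; funext i; exact Fin.cases rfl (fun _ => rfl) i

theorem Ty.ren_inst_snd (σ : Typ S (k + 1)) :
    ((σ.ren (liftR (up 1))).ren (liftR (up 1))).inst (.var 0) = Ty.instSnd σ := by
  rw [Ty.ren_ren, Ty.inst, Ty.ren_sub, Ty.instSnd]
  congr 1; funext i; exact Fin.cases rfl (fun _ => rfl) i

/-- The context `Γ` weakened by two type variables. -/
abbrev polyCx (Γ : Fin n → Typ S k) : Fin n → Typ S (k + 2) := wkCx (wkCx Γ 1) 1

/-- The relational context `Θ` weakened by two type variables, and a relation between them. -/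
abbrev polyRCx (Θ : Fin m → RelDecl S k) : Fin (m + 1) → RelDecl S (k + 2) :=
  cons ⟨true, .var 1, .var 0⟩ (wkRCx (wkRCx Θ 1) 1)

theorem HasType.wk_poly {t : Tm S k n} {τ : Typ S k} (h : HasType Γ allIntu t τ) :
    HasType (polyCx Γ) allIntu (t.wk 2 0) (τ.ren (up 2)) :=
  h.ren_intu fun i => by simp only [polyCx, wkCx, up_zero, id, Ty.ren_ren]; rfl

theorem StabForm.poly_body {σ τ : Typ S (k + 1)} {ρ : Rel S (k + 2) n (m + 1)}
    (hρ : StabRel T (polyCx Γ) (polyRCx Θ) ρ (Ty.instFst σ) (Ty.instSnd τ)) :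
    StabForm T (cons (.all τ) (cons (.all σ) Γ)) Θ
      (.allTy (.allTy (.allAdm (.var 1) (.var 0)
        (.rel (ρ.wk 0 2 0) (.tapp (.var 1) (.var 1)) (.tapp (.var 0) (.var 0)))))) := by
  refine .allTy (.allTy (.allAdm (.rel (σ := Ty.instFst σ) (τ := Ty.instSnd τ) ?_ ?_ ?_)))
  · have := hρ.ren (Γ' := polyCx (cons (.all τ) (cons (.all σ) Γ))) (Θ' := polyRCx Θ)
      (p := up 0) (q := up 2) (r := up 0) ⟨fun i => by rw [up_zero, Ty.ren_id]; rfl,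
        fun j => by simp⟩
    rwa [up_zero, Ty.ren_id, Ty.ren_id] at this
  · exact .tapp_intu (.var 1) (.var_intu 1 rfl) σ.ren_inst_fst
  · exact .tapp_intu (.var 0) (.var_intu 0 rfl) τ.ren_inst_snd

theorem StabRel.poly {σ τ : Typ S (k + 1)} {ρ : Rel S (k + 2) n (m + 1)}
    (hρ : StabRel T (polyCx Γ) (polyRCx Θ) ρ (Ty.instFst σ) (Ty.instSnd τ)) :
    StabRel T Γ Θ (Rel.poly σ τ ρ) (.all σ) (.all τ) := .abs (.poly_body hρ)

theorem Prov.poly_iff {σ τ : Typ S (k + 1)} {ρ : Rel S (k + 2) n (m + 1)} {t s : Tm S k n}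
    (hΦ : WfHyps T Γ Θ Φ)
    (hρ : StabRel T (polyCx Γ) (polyRCx Θ) ρ (Ty.instFst σ) (Ty.instSnd τ))
    (ht : HasType Γ allIntu t (.all σ)) (hs : HasType Γ allIntu s (.all τ)) :
    Prov T Γ Θ Φ (.rel (Rel.poly σ τ ρ) t s) ↔
      Prov T Γ Θ Φ (.allTy (.allTy (.allAdm (.var 1) (.var 0)
        (.rel ρ (.tapp (t.wk 2 0) (.var 1)) (.tapp (s.wk 2 0) (.var 0)))))) := by
  have e : Rel.sub (k := k + 1 + 1) (n := n + 2) (m := m + 1) (k' := k + 1 + 1) (n' := n)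
      (m' := m + 1) (ρ.wk 0 2 0) (Ty.lift (Ty.lift Ty.var))
      (fun i => (cons s (cons t Tm.var) i).wk 2 0)
      (Rel.lift fun j => ((Rel.var j).wk 1 0 0).wk 1 0 0) = ρ := by
    have h : (Rel.lift fun j => ((Rel.var j : Rel S k n m).wk 1 0 0).wk 1 0 0) = Rel.var :=
      Rel.lift_var
    rw [h, Rel.wk, Rel.ren_sub, Ty.lift_var, Ty.lift_var]; exact ρ.sub_var
  have e' : ∀ t : Tm S k n, (t.wk 1 0).wk 1 0 = t.wk 2 0 := by
    intro t; simp only [Tm.wk, Tm.ren_ren]; rfl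
  rw [Rel.poly, Prov.abs_iff hΦ (.poly_body hρ) ht hs]
  simp only [Form.sub, Tm.sub, cons_zero, cons_one, e, e']
  rfl

theorem Prov.poly_intro {σ τ : Typ S (k + 1)} {ρ : Rel S (k + 2) n (m + 1)} {t s : Tm S k n}
    (hρ : StabRel T (polyCx Γ) (polyRCx Θ) ρ (Ty.instFst σ) (Ty.instSnd τ))
    (ht : HasType Γ allIntu t (.all σ)) (hs : HasType Γ allIntu s (.all τ))
    (h : Prov T (polyCx Γ) (polyRCx Θ) []
      (.rel ρ (.tapp (t.wk 2 0) (.var 1)) (.tapp (s.wk 2 0) (.var 0)))) :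
    Prov T Γ Θ [] (.rel (Rel.poly σ τ ρ) t s) :=
  (Prov.poly_iff .nil hρ ht hs).2 (.allTyI WfHyps.nil (.allTyI WfHyps.nil (.allAdmI WfHyps.nil h)))

theorem Prov.poly_rel_elim {σ τ : Typ S (k + 1)} {ρ : Rel S (k + 2) n (m + 1)} {t s : Tm S k n}
    (hΦ : WfHyps T Γ Θ Φ)
    (hρ : StabRel T (polyCx Γ) (polyRCx Θ) ρ (Ty.instFst σ) (Ty.instSnd τ))
    (ht : HasType Γ allIntu t (.all σ)) (hs : HasType Γ allIntu s (.all τ))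
    (h : Prov T Γ Θ Φ (.rel (Rel.poly σ τ ρ) t s)) {A B : Typ S k} {R : Rel S k n m}
    (hR : IsAdm T Γ Θ R A B) :
    Prov T Γ Θ Φ (.rel (ρ.sub (cons B (cons A Ty.var)) Tm.var (cons R Rel.var))
      (.tapp t A) (.tapp s B)) := by
  have := ((Prov.poly_iff hΦ hρ ht hs).1 h).poly_elim hR
  have e : ∀ t : Tm S k n, (t.wk 2 0).sub (cons B (cons A Ty.var)) Tm.var = t := by
    intro t; rw [Tm.wk, Tm.ren_sub]; exact t.sub_var
  simp only [Form.sub, Tm.sub, e] at this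
  exact this

end Relations

/-! ## Rules for the relational interpretation of types -/

section Interp

variable {S : Sig.{u, v}} {T : Set (Form S 0 0 0)} {k n m a : ℕ}
  {Γ : Fin n → Typ S k} {Θ : Fin m → RelDecl S k} {Φ : List (Form S k n m)}
  {ρs : Fin a → Rel S k n m} {τs τs' : Fin a → Typ S k} {t s x y : Tm S k n}

theorem Prov.interp_var_iff (hΦ : WfHyps T Γ Θ Φ)
    (hρ : ∀ i, StabAdm T Γ Θ (ρs i) (τs i) (τs' i)) (i : Fin a)
    (ht : HasType Γ allIntu t (τs i)) (hs : HasType Γ allIntu s (τs' i)) :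
    Prov T Γ Θ Φ (.rel (.interp a (.var i) ρs) t s) ↔ Prov T Γ Θ Φ (.rel (ρs i) t s) :=
  Prov.equiv_iff (.interpVar i fun i => (hρ i).isAdm) hΦ ht hs

theorem Prov.interp_lolli_elim {σ σ' : Typ S a} (hΦ : WfHyps T Γ Θ Φ)
    (hρ : ∀ i, StabAdm T Γ Θ (ρs i) (τs i) (τs' i))
    (ht : HasType Γ allIntu t ((Ty.lolli σ σ').sub τs))
    (hs : HasType Γ allIntu s ((Ty.lolli σ σ').sub τs'))
    (h : Prov T Γ Θ Φ (.rel (.interp a (.lolli σ σ') ρs) t s))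
    (hx : HasType Γ allIntu x (σ.sub τs)) (hy : HasType Γ allIntu y (σ.sub τs'))
    (hxy : Prov T Γ Θ Φ (.rel (.interp a σ ρs) x y)) :
    Prov T Γ Θ Φ (.rel (.interp a σ' ρs) (.app t x) (.app s y)) :=
  Prov.lolli_elim hΦ (StabAdm.interp σ hρ).stabRel (StabAdm.interp σ' hρ).stabRel ht hs
    ((Prov.equiv_iff (.interpLolli σ σ' fun i => (hρ i).isAdm) hΦ ht hs).1 h) hx hy hxy

theorem Prov.interp_lolli_intro {σ σ' : Typ S a}
    (hρ : ∀ i, StabAdm T Γ Θ (ρs i) (τs i) (τs' i))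
    (ht : HasType Γ allIntu t ((Ty.lolli σ σ').sub τs))
    (hs : HasType Γ allIntu s ((Ty.lolli σ σ').sub τs'))
    (h : Prov T (cons (σ.sub τs') (cons (σ.sub τs) Γ)) Θ
      [.rel (.interp a σ fun i => (ρs i).wk 0 2 0) (.var 1) (.var 0)]
      (.rel (.interp a σ' fun i => (ρs i).wk 0 2 0) (.app (t.wk 0 2) (.var 1))
        (.app (s.wk 0 2) (.var 0)))) :
    Prov T Γ Θ [] (.rel (.interp a (.lolli σ σ') ρs) t s) := by
  rw [Prov.equiv_iff (.interpLolli σ σ' fun i => (hρ i).isAdm) .nil ht hs,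
    Prov.lolli_iff .nil (StabAdm.interp σ hρ).stabRel (StabAdm.interp σ' hρ).stabRel ht hs]
  exact .allTm_imp_intro h

theorem Ty.instFst_lift (σ : Typ S (a + 1)) (τs : Fin a → Typ S k) :
    (σ.sub (Ty.lift τs)).instFst = σ.sub (cons (.var 1) fun i => (τs i).ren (up 2)) := by
  rw [Ty.instFst, Ty.sub_sub]; congr 1; funext i
  refine Fin.cases rfl (fun i => ?_) i
  simp only [Ty.lift_succ, Ty.ren_sub, cons_succ]
  rw [Ty.ren_eq_sub]; rfl

theorem Ty.instSnd_lift (σ : Typ S (a + 1)) (τs : Fin a → Typ S k) :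
    (σ.sub (Ty.lift τs)).instSnd = σ.sub (cons (.var 0) fun i => (τs i).ren (up 2)) := by
  rw [Ty.instSnd, Ty.sub_sub]; congr 1; funext i
  refine Fin.cases rfl (fun i => ?_) i
  simp only [Ty.lift_succ, Ty.ren_sub, cons_succ]
  rw [Ty.ren_eq_sub]; rfl

theorem StabAdm.poly (hρ : ∀ i, StabAdm T Γ Θ (ρs i) (τs i) (τs' i)) (i : Fin (a + 1)) :
    StabAdm T (polyCx Γ) (polyRCx Θ)
      ((cons (.var 0) fun i => (ρs i).wk 2 0 1 : Fin (a + 1) → Rel S (k + 2) n (m + 1)) i)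
      ((cons (.var 1) fun i => (τs i).ren (up 2) : Fin (a + 1) → Typ S (k + 2)) i)
      ((cons (.var 0) fun i => (τs' i).ren (up 2) : Fin (a + 1) → Typ S (k + 2)) i) :=
  Fin.cases (.var rfl) (fun i => (hρ i).ren (.poly true)) i

theorem StabRel.interp_poly (hρ : ∀ i, StabAdm T Γ Θ (ρs i) (τs i) (τs' i))
    (σ : Typ S (a + 1)) :
    StabRel T (polyCx Γ) (polyRCx Θ)
      (.interp (a + 1) σ (cons (.var 0) fun i => (ρs i).wk 2 0 1))
      (σ.sub (Ty.lift τs)).instFst (σ.sub (Ty.lift τs')).instSnd := by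
  rw [Ty.instFst_lift, Ty.instSnd_lift]
  exact (StabAdm.interp σ (StabAdm.poly hρ)).stabRel

theorem Prov.interp_all_elim {σ : Typ S (a + 1)} (hΦ : WfHyps T Γ Θ Φ)
    (hρ : ∀ i, StabAdm T Γ Θ (ρs i) (τs i) (τs' i))
    (ht : HasType Γ allIntu t ((Ty.all σ).sub τs))
    (hs : HasType Γ allIntu s ((Ty.all σ).sub τs'))
    (h : Prov T Γ Θ Φ (.rel (.interp a (.all σ) ρs) t s)) {A B : Typ S k} {R : Rel S k n m}
    (hR : IsAdm T Γ Θ R A B) :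
    Prov T Γ Θ Φ (.rel (.interp (a + 1) σ (cons R ρs)) (.tapp t A) (.tapp s B)) := by
  rw [Prov.equiv_iff (.interpAll σ fun i => (hρ i).isAdm) hΦ ht hs] at h
  have := Prov.poly_rel_elim hΦ (StabRel.interp_poly hρ σ) ht hs h hR
  simp only [Rel.sub] at this
  convert this using 3
  funext i
  refine Fin.cases rfl (fun i => ?_) i
  simp only [cons_succ, Rel.wk, Rel.ren_sub]
  exact (Rel.sub_var _).symm

theorem Prov.interp_all_intro {σ : Typ S (a + 1)}
    (hρ : ∀ i, StabAdm T Γ Θ (ρs i) (τs i) (τs' i))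
    (ht : HasType Γ allIntu t ((Ty.all σ).sub τs))
    (hs : HasType Γ allIntu s ((Ty.all σ).sub τs'))
    (h : Prov T (polyCx Γ) (polyRCx Θ) []
      (.rel (.interp (a + 1) σ (cons (.var 0) fun i => (ρs i).wk 2 0 1))
        (.tapp (t.wk 2 0) (.var 1)) (.tapp (s.wk 2 0) (.var 0)))) :
    Prov T Γ Θ [] (.rel (.interp a (.all σ) ρs) t s) := by
  rw [Prov.equiv_iff (.interpAll σ fun i => (hρ i).isAdm) .nil ht hs]
  exact .poly_intro (StabRel.interp_poly hρ σ) ht hs h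

end Interp

section Bang

variable {S : Sig.{u, v}} {T : Set (Form S 0 0 0)} {k n m a k' n' m' : ℕ}
  {Γ : Fin n → Typ S k} {Θ : Fin m → RelDecl S k} {Φ : List (Form S k n m)}
  {σ τ A B : Typ S k} {ρ R : Rel S k n m} {t s g g' : Tm S k n}

/-- The type `Πα. (σ → α) ⊸ α`. -/
abbrev bangTy (σ : Typ S k) : Typ S k :=
  .all (.lolli (.lolli (.bang (σ.ren (up 1))) (.var 0)) (.var 0))

theorem HasType.bangMap (σ : Typ S k) :
    HasType Γ allIntu (Rel.bangMap σ) (.lolli (.bang σ) (bangTy σ)) := by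
  refine .lam (.tlam (.lam (.app (σ := .bang (σ.ren (up 1))) (d₁ := cons .lin (cons .off allIntu))
    (d₂ := cons .off (cons .lin allIntu)) ?_ ?_ ?_)))
  · exact (noLin_allIntu.splits.cons .right).cons .left
  · refine .varLin 0 rfl fun j => Fin.cases (fun h => absurd rfl h) (fun j _ => ?_) j
    exact (noLin_allIntu.cons (by simp)) j
  · exact .varLin 1 rfl fun j => Fin.cases (fun _ => by simp) (fun j =>
      Fin.cases (fun h => absurd rfl h) (fun j _ => noLin_allIntu j) j) j

theorem Rel.bangMap_ren (σ : Typ S k) (p : Fin k → Fin k') (q : Fin n → Fin n') :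
    (Rel.bangMap σ : Tm S k n).ren p q = Rel.bangMap (σ.ren p) := by
  simp only [Rel.bangMap, Tm.ren, Ty.ren, Ty.ren_ren]
  rfl

theorem bangTy_inst (σ A : Typ S k) :
    (Ty.lolli (.lolli (.bang (σ.ren (up 1))) (.var 0)) (.var 0)).inst A =
      .lolli (.lolli (.bang σ) A) A := by
  simp only [Ty.inst, Ty.sub, Ty.ren_sub, cons_zero]
  congr 3; exact σ.sub_var

theorem HasType.bangMap_app (ht : HasType Γ allIntu t (.bang σ)) (A : Typ S k) :
    HasType Γ allIntu (.tapp (.app (Rel.bangMap σ) t) A) (.lolli (.lolli (.bang σ) A) A) :=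
  .tapp_intu A (.app_intu (.bangMap σ) ht) (bangTy_inst σ A)

theorem PEq.bangMap (hΦ : WfHyps T Γ Θ Φ) (ht : HasType Γ allIntu t (.bang σ))
    (hg : HasType Γ allIntu g (.lolli (.bang σ) A)) :
    PEq T Γ Θ Φ A (.app (.tapp (.app (Rel.bangMap σ) t) A) g) (.app g t) := by
  have hm := HasType.bangMap (Γ := Γ) σ
  let b : Tm S (k + 1) n := .lam (.lolli (.bang (σ.ren (up 1))) (.var 0))
    (.app (.var 0) (t.wk 1 1))
  have hb : HasType (wkCx Γ 1) allIntu b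
      (.lolli (.lolli (.bang (σ.ren (up 1))) (.var 0)) (.var 0)) := by
    refine .lam (.app (σ := .bang (σ.ren (up 1))) (noLin_allIntu.splits.cons .left)
      (.varLin 0 rfl fun j => Fin.cases (fun h => absurd rfl h) (fun i _ => noLin_allIntu i) j) ?_)
    exact ht.ren_noLin (Γ' := cons _ (wkCx Γ 1)) noLin_allIntu (noLin_allIntu.cons (by simp))
      (fun i => rfl) fun i h => h
  have e1 : (Tm.tlam (.lam (.lolli (.bang (σ.ren (up 1))) (.var 0))
      (.app (.var 0) (.var 1))) : Tm S k (n + 1)).inst t = .tlam b := by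
    simp only [Tm.inst, Tm.sub, b, Ty.lift_var, Ty.sub_var]
    congr 3
    have : (1 : Fin (n + 2)) = Fin.succ 0 := rfl
    rw [this, Tm.lift_succ, cons_zero, Tm.wk, Tm.ren_ren]; rfl
  have h1 : PEq T Γ Θ Φ (bangTy σ) (.app (Rel.bangMap σ) t) (.tlam b) :=
    .ofAx hΦ (.app_intu hm ht) (.tlam hb) (e1 ▸ .betaTerm ..)
  have h2 := h1.tapp hΦ A (bangTy_inst σ A)
  have h3 : PEq T Γ Θ Φ (.lolli (.lolli (.bang σ) A) A) (.tapp (.tlam b) A) (b.tinst A) :=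
    .tbeta hΦ hb A (bangTy_inst σ A)
  have e2 : b.tinst A = .lam (.lolli (.bang σ) A) (.app (.var 0) (t.wk 0 1)) := by
    simp only [Tm.tinst, Tm.sub, b, Ty.sub, Ty.ren_sub, cons_zero, Tm.wk, Tm.ren_sub]
    congr 2
    · congr 2; exact σ.sub_var
    · rw [Tm.ren_eq_sub]; rfl
  have h4 := ((h2.trans h3).app hΦ (.refl hΦ hg))
  rw [e2] at h4
  refine h4.trans (.ofAx hΦ h4.right (.app_intu hg ht) ?_)
  have e3 : (Tm.app (.var 0) (t.wk 0 1)).inst g = .app g t := by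
    simp only [Tm.inst, Tm.sub, Tm.wk_sub_cons]; rfl
  exact e3 ▸ .betaTerm ..

theorem StabRel.bang_body (hρ : StabRel T Γ Θ ρ σ τ) :
    StabRel T (polyCx Γ) (polyRCx Θ)
      (Rel.arrow (σ.ren (up 2)) (τ.ren (up 2)) (.var 1) (.var 0) (ρ.wk 2 0 1) (.var 0))
      (.lolli (.bang (σ.ren (up 2))) (.var 1)) (.lolli (.bang (τ.ren (up 2))) (.var 0)) :=
  .arrow (hρ.ren (.poly true)) (.var_adm rfl)

theorem StabRel.bang_poly (hρ : StabRel T Γ Θ ρ σ τ) :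
    StabRel T (polyCx Γ) (polyRCx Θ)
      (Rel.lolli
        (.lolli (.bang (σ.ren (up 2))) (.var 1)) (.lolli (.bang (τ.ren (up 2))) (.var 0))
        (.var 1) (.var 0)
        (Rel.arrow (σ.ren (up 2)) (τ.ren (up 2)) (.var 1) (.var 0) (ρ.wk 2 0 1) (.var 0))
        (.var 0))
      (Ty.instFst (.lolli (.lolli (.bang (σ.ren (up 1))) (.var 0)) (.var 0)))
      (Ty.instSnd (.lolli (.lolli (.bang (τ.ren (up 1))) (.var 0)) (.var 0))) := by
  have h1 : ∀ (σ : Typ S k) (x : Typ S (k + 2)),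
      (σ.ren (up 1)).sub (cons x fun i => .var i.succ.succ) = σ.ren (up 2) := by
    intro σ x; rw [Ty.ren_sub, Ty.ren_eq_sub]; rfl
  simp only [Ty.instFst, Ty.instSnd, Ty.sub, h1]
  exact .lolli (.bang_body hρ) (.var_adm rfl)

theorem Prov.bang_elim (hΦ : WfHyps T Γ Θ Φ) (hρ : StabRel T Γ Θ ρ σ τ)
    (ht : HasType Γ allIntu t (.bang σ)) (hs : HasType Γ allIntu s (.bang τ))
    (h : Prov T Γ Θ Φ (.rel (Rel.bang σ τ ρ) t s)) (hR : StabAdm T Γ Θ R A B)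
    (hg : HasType Γ allIntu g (.lolli (.bang σ) A))
    (hg' : HasType Γ allIntu g' (.lolli (.bang τ) B))
    (hgg : Prov T Γ Θ Φ (.rel (Rel.arrow σ τ A B ρ R) g g')) :
    Prov T Γ Θ Φ (.rel R (.app g t) (.app g' s)) := by
  have h0 := (Prov.reindex_iff hΦ (.poly hρ.bang_poly) (.bangMap σ) (.bangMap τ) ht hs).1 h
  have h1 := Prov.poly_rel_elim hΦ hρ.bang_poly (.app_intu (.bangMap σ) ht)
    (.app_intu (.bangMap τ) hs) h0 hR.isAdm
  have e1 : ∀ σ : Typ S k, (σ.ren (up 2)).sub (cons B (cons A Ty.var)) = σ := by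
    intro σ; rw [Ty.ren_sub]; exact σ.sub_var
  have e2 : (ρ.wk 2 0 1).sub (cons B (cons A Ty.var)) Tm.var (cons R Rel.var) = ρ := by
    rw [Rel.wk, Rel.ren_sub]; exact ρ.sub_var
  simp only [Rel.lolli_sub, Rel.arrow_sub, Ty.sub, Rel.sub, e1, e2, cons_zero, cons_one] at h1
  have h2 := Prov.lolli_elim hΦ (.arrow hρ hR.stabRel) hR.stabRel (ht.bangMap_app A)
    (hs.bangMap_app B) h1 hg hg' hgg
  exact PEq.rel hΦ hR.stabRel.isRel (.bangMap hΦ ht hg) (.bangMap hΦ hs hg') h2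

theorem Prov.bang_intro (hρ : StabRel T Γ Θ ρ σ τ)
    (ht : HasType Γ allIntu t σ) (hs : HasType Γ allIntu s τ)
    (h : Prov T Γ Θ [] (.rel ρ t s)) :
    Prov T Γ Θ [] (.rel (Rel.bang σ τ ρ) (.bang t) (.bang s)) := by
  have hm := ht.bang_intu
  have hm' := hs.bang_intu
  refine (Prov.reindex_iff .nil (.poly hρ.bang_poly) (.bangMap σ) (.bangMap τ) hm hm').2 ?_
  refine .poly_intro hρ.bang_poly (.app_intu (.bangMap σ) hm) (.app_intu (.bangMap τ) hm') ?_
  have e : ∀ (σ : Typ S k) (t : Tm S k n),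
      (Tm.app (Rel.bangMap σ) t).wk 2 0 = .app (Rel.bangMap (σ.ren (up 2))) (t.wk 2 0) := by
    intro σ t; simp only [Tm.wk, Tm.ren, Rel.bangMap_ren]
  rw [e, e]
  have hp : HasType (polyCx Γ) allIntu ((Tm.bang t).wk 2 0) (.bang (σ.ren (up 2))) := hm.wk_poly
  have hp' : HasType (polyCx Γ) allIntu ((Tm.bang s).wk 2 0) (.bang (τ.ren (up 2))) :=
    hm'.wk_poly
  have hv1 : StabRel T (polyCx Γ) (polyRCx Θ) (.var 0) (.var 1) (.var 0) := .var_adm rfl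
  refine (Prov.lolli_iff .nil (.bang_body hρ) hv1 (hp.bangMap_app _) (hp'.bangMap_app _)).2 ?_
  refine .allTm_imp_intro ?_
  set X : Typ S (k + 2) := .lolli (.bang (σ.ren (up 2))) (.var 1)
  set X' : Typ S (k + 2) := .lolli (.bang (τ.ren (up 2))) (.var 0)
  have e' : ∀ (σ A : Typ S (k + 2)) (t : Tm S (k + 2) n), (Tm.tapp (.app (Rel.bangMap σ) t) A).wk 0 2 =
      .tapp (.app (Rel.bangMap σ) (t.wk 0 2)) A := by
    intro σ A t; simp only [Tm.wk, Tm.ren, Rel.bangMap_ren, up_zero, Ty.ren_id]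
  rw [e', e']
  have hg : HasType (cons X' (cons X (polyCx Γ))) allIntu (.var 1) X := .var_intu 1 rfl
  have hg' : HasType (cons X' (cons X (polyCx Γ))) allIntu (.var 0) X' := .var_intu 0 rfl
  have hρ4 : StabRel T (cons X' (cons X (polyCx Γ))) (polyRCx Θ) ((ρ.wk 2 0 1).wk 0 2 0)
      (σ.ren (up 2)) (τ.ren (up 2)) := (hρ.ren (.poly true)).wk_tm_two X X'
  have hv : StabRel T (cons X' (cons X (polyCx Γ))) (polyRCx Θ) (.var 0) (.var 1) (.var 0) :=
    .var_adm rfl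
  have ht2 : HasType (polyCx Γ) allIntu (t.wk 2 0) (σ.ren (up 2)) := ht.wk_poly
  have hs2 : HasType (polyCx Γ) allIntu (s.wk 2 0) (τ.ren (up 2)) := hs.wk_poly
  have hyp : Prov T (cons X' (cons X (polyCx Γ))) (polyRCx Θ) []
      (.rel ((ρ.wk 2 0 1).wk 0 2 0) ((t.wk 2 0).wk 0 2) ((s.wk 2 0).wk 0 2)) :=
    (h.ren (CxRen.poly true)).ren (CxRen.tm_two X X')
  have e3 : (Rel.arrow (σ.ren (up 2)) (τ.ren (up 2)) (.var 1) (.var 0) (ρ.wk 2 0 1)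
      (.var 0)).wk 0 2 0 = Rel.arrow (σ.ren (up 2)) (τ.ren (up 2)) (.var 1) (.var 0)
        ((ρ.wk 2 0 1).wk 0 2 0) (.var 0) := by
    rw [Rel.wk, Rel.arrow_ren, up_zero, Ty.ren_id, Ty.ren_id, Ty.ren_id, Ty.ren_id]; rfl
  rw [e3]
  have hΦ : WfHyps T (cons X' (cons X (polyCx Γ))) (polyRCx Θ)
      [.rel (Rel.arrow (σ.ren (up 2)) (τ.ren (up 2)) (.var 1) (.var 0)
        ((ρ.wk 2 0 1).wk 0 2 0) (.var 0)) (.var 1) (.var 0)] :=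
    .singleton (.rel (StabRel.arrow hρ4 hv).isRel hg hg')
  have h3 := Prov.arrow_elim hΦ hρ4 hv hg hg' (Prov.hyp hΦ (List.mem_singleton_self _))
    (ht2.wk_tm_two X X') (hs2.wk_tm_two X X') (hyp.wkHyps hΦ)
  exact PEq.rel hΦ hv.isRel (PEq.bangMap hΦ (hp.wk_tm_two X X') hg).symm
    (PEq.bangMap hΦ (hp'.wk_tm_two X X') hg').symm h3

variable {ρs : Fin a → Rel S k n m} {τs τs' : Fin a → Typ S k}

theorem Prov.interp_bang_intro {σ : Typ S a}
    (hρ : ∀ i, StabAdm T Γ Θ (ρs i) (τs i) (τs' i))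
    (ht : HasType Γ allIntu t (σ.sub τs)) (hs : HasType Γ allIntu s (σ.sub τs'))
    (h : Prov T Γ Θ [] (.rel (.interp a σ ρs) t s)) :
    Prov T Γ Θ [] (.rel (.interp a (.bang σ) ρs) (.bang t) (.bang s)) :=
  (Prov.equiv_iff (.interpBang σ fun i => (hρ i).isAdm) .nil ht.bang_intu hs.bang_intu).2
    (.bang_intro (StabAdm.interp σ hρ).stabRel ht hs h)

end Bang

/-! ## The functorial action -/

section Typing

variable {S : Sig.{u, v}} {k n : ℕ} {Γ : Fin n → Typ S k} {d : Fin n → Mode}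

theorem NoLin.off (hd : NoLin d) : NoLin (LAPL.cons .off d) := hd.cons (by simp)

theorem NoLin.intu (hd : NoLin d) : NoLin (LAPL.cons .intu d) := hd.cons (by simp)

theorem HasType.var_lin_zero (hd : NoLin d) (σ : Typ S k) :
    HasType (cons σ Γ) (cons .lin d) (.var 0) σ :=
  .varLin 0 rfl fun j => Fin.cases (fun h => absurd rfl h) (fun i _ => hd i) j

theorem HasType.var_lin_one (hd : NoLin d) {a : Mode} (ha : a ≠ .lin) (σ τ : Typ S k) :
    HasType (cons τ (cons σ Γ)) (cons a (cons .lin d)) (.var 1) σ :=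
  .varLin 1 rfl fun j => Fin.cases (fun _ => ha) (fun j =>
    Fin.cases (fun h => absurd rfl h) (fun j _ => hd j) j) j

theorem HasType.wk_off {b : ℕ} {Γ' : Fin (n + b) → Typ S k} {d' : Fin (n + b) → Mode}
    {t : Tm S k n} {τ : Typ S k} (h : HasType Γ d t τ) (hd : NoLin d) (hd' : NoLin d')
    (hΓ : ∀ i, Γ' (up b i) = Γ i) (hi : ∀ i, d' (up b i) = d i) :
    HasType Γ' d' (t.wk 0 b) τ := by
  have := h.ren_noLin (Γ' := Γ') (d' := d') hd hd' (p := up 0) (q := up b)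
    (fun i => by rw [up_zero, Ty.ren_id, hΓ]) (fun i h => by rw [hi, h])
  rwa [up_zero, Ty.ren_id] at this

theorem Ty.sub_congr {a : ℕ} (σ : Typ S a) : ∀ {k : ℕ} {s s' : Fin a → Typ S k},
    (∀ i p, σ.Occurs p i → s i = s' i) → σ.sub s = σ.sub s' := by
  induction σ with
  | var i => intro k s s' h; exact h i true ⟨rfl, rfl⟩
  | con c args ih =>
    intro k s s' h
    simp only [Ty.sub]; congr 1; funext j
    exact ih j fun i p hp => h i p ⟨j, p, hp⟩
  | one => intros; rfl
  | tensor σ τ ih₁ ih₂ =>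
    intro k s s' h
    simp only [Ty.sub]
    rw [ih₁ fun i p hp => h i p (.inl hp), ih₂ fun i p hp => h i p (.inr hp)]
  | lolli σ τ ih₁ ih₂ =>
    intro k s s' h
    simp only [Ty.sub]
    rw [ih₁ fun i p hp => h i (!p) (.inl (by rwa [Bool.not_not])),
      ih₂ fun i p hp => h i p (.inr hp)]
  | bang σ ih => intro k s s' h; simp only [Ty.sub]; rw [ih h]
  | all σ ih =>
    intro k s s' h
    simp only [Ty.sub]
    rw [ih (s := Ty.lift s) (s' := Ty.lift s')]
    intro i
    refine Fin.cases (fun _ _ => rfl) (fun i p hp => ?_) i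
    rw [Ty.lift_succ, Ty.lift_succ, h i p hp]

/-- The functorial action of a type on maps that go forwards at its positive variables and
backwards at its negative ones. -/
theorem HasType.act {a : ℕ} (σ : Typ S a) :
    ∀ {k n : ℕ} {Γ : Fin n → Typ S k} {d : Fin n → Mode} {dom cod : Fin a → Typ S k}
      {g : Fin a → Tm S k n}, NoLin d →
      (∀ i, σ.Occurs true i → HasType Γ d (g i) (.lolli (dom i) (cod i))) →
      (∀ i, σ.Occurs false i → HasType Γ d (g i) (.lolli (cod i) (dom i))) →
      (∀ i, σ.Occurs true i → σ.Occurs false i → dom i = cod i) →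
      HasType Γ d (LAPL.act σ dom cod g) (.lolli (σ.sub dom) (σ.sub cod)) := by
  induction σ with
  | var i => intro k n Γ d dom cod g _ hp _ _; exact hp i ⟨rfl, rfl⟩
  | con c args ih =>
    intro k n Γ d dom cod g hd hp hn he
    rw [← Ty.sub_congr (.con c args) (s := dom) (s' := cod) fun i p hi => he i hi hi]
    exact .idTm hd _
  | one => intro k n Γ d dom cod g hd _ _ _; exact .idTm hd _
  | tensor σ τ ih₁ ih₂ =>
    intro k n Γ d dom cod g hd hp hn he
    have w : ∀ {A B C D : Typ S k} {t : Tm S k n}, HasType Γ d t D →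
        HasType (cons C (cons B (cons A Γ))) (cons .off (cons .off (cons .off d)))
          (t.wk 0 3) D := fun h =>
      h.wk_off (b := 3) hd hd.off.off.off (fun _ => rfl) (fun _ => rfl)
    have hd1 : NoLin (cons Mode.off d) := hd.off
    have hd2 : NoLin (cons Mode.off (cons Mode.off d)) := hd1.off
    have hd3 : NoLin (cons Mode.off (cons Mode.off (cons Mode.off d))) := hd2.off
    refine .lam (.letTensor (hd.splits.cons .left) (.var_lin_zero hd _)
      (.tensor (((hd1.splits).cons .left).cons .right)
        (.app ((hd1.splits.cons .right).cons .off) (ih₁ hd3 ?_ ?_ ?_)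
          (.var_lin_one hd1 (by simp) _ _))
        (.app ((hd2.splits).cons .right) (ih₂ hd3 ?_ ?_ ?_) (.var_lin_zero hd2 _))))
    · exact fun i hi => w (hp i (.inl hi))
    · exact fun i hi => w (hn i (.inl hi))
    · exact fun i hi hi' => he i (.inl hi) (.inl hi')
    · exact fun i hi => w (hp i (.inr hi))
    · exact fun i hi => w (hn i (.inr hi))
    · exact fun i hi hi' => he i (.inr hi) (.inr hi')
  | lolli σ τ ih₁ ih₂ =>
    intro k n Γ d dom cod g hd hp hn he
    have w : ∀ {A B D : Typ S k} {t : Tm S k n}, HasType Γ d t D →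
        HasType (cons B (cons A Γ)) (cons .off (cons .off d)) (t.wk 0 2) D := fun h =>
      h.wk_off (b := 2) hd hd.off.off (fun _ => rfl) (fun _ => rfl)
    have hd1 : NoLin (cons Mode.off d) := hd.off
    have hd2 : NoLin (cons Mode.off (cons Mode.off d)) := hd1.off
    refine .lam (.lam (.app ((hd.splits.cons .right).cons .right) (ih₂ hd2 ?_ ?_ ?_)
      (.app ((hd.splits.cons .left).cons .right) (.var_lin_one hd (by simp) _ _)
        (.app (hd1.splits.cons .right) (ih₁ hd2 ?_ ?_ ?_) (.var_lin_zero hd1 _)))))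
    · exact fun i hi => w (hp i (.inr hi))
    · exact fun i hi => w (hn i (.inr hi))
    · exact fun i hi hi' => he i (.inr hi) (.inr hi')
    · exact fun i hi => w (hn i (.inl hi))
    · exact fun i hi => w (hp i (.inl hi))
    · exact fun i hi hi' => (he i (.inl hi') (.inl hi)).symm
  | bang σ ih =>
    intro k n Γ d dom cod g hd hp hn he
    have hd1 : NoLin (cons Mode.off d) := hd.off
    have hd2 : NoLin (cons Mode.intu (cons Mode.off d)) := hd1.intu
    have w : ∀ {A B D : Typ S k} {t : Tm S k n}, HasType Γ d t D →
        HasType (cons B (cons A Γ)) (cons .intu (cons .off d)) (t.wk 0 2) D := fun h =>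
      h.wk_off (b := 2) hd hd2 (fun _ => rfl) (fun _ => rfl)
    refine .lam (.letBang (hd.splits.cons .left) (.var_lin_zero hd _)
      (.bang hd2 (.app hd2.splits (ih hd2 ?_ ?_ he) (.varIntu 0 rfl hd2))))
    · exact fun i hi => w (hp i hi)
    · exact fun i hi => w (hn i hi)
  | all σ ih =>
    intro k n Γ d dom cod g hd hp hn he
    have hd1 : NoLin (cons Mode.off d) := hd.off
    have w : ∀ {A D : Typ S k} {t : Tm S k n}, HasType Γ d t D →
        HasType (wkCx (cons A Γ) 1) (cons .off d) (t.wk 1 1) (D.ren (up 1)) := fun h =>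
      h.ren_noLin hd hd1 (fun _ => rfl) (fun _ h => h)
    have hz : HasType (wkCx (cons ((Ty.all σ).sub dom) Γ) 1) (cons .lin d) (.var 0)
        (.all ((σ.sub (Ty.lift dom)).ren (liftR (up 1)))) :=
      .varLin 0 rfl fun j => Fin.cases (fun h => absurd rfl h) (fun i _ => hd i) j
    have e : ((σ.sub (Ty.lift dom)).ren (liftR (up 1))).inst (.var 0) = σ.sub (Ty.lift dom) := by
      rw [Ty.inst, Ty.ren_sub]
      conv_rhs => rw [← Ty.sub_var (σ.sub (Ty.lift dom))]
      congr 1; funext i; exact Fin.cases rfl (fun _ => rfl) i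
    refine .lam (.tlam (.app (hd.splits.cons .right) (ih hd1 ?_ ?_ ?_) (e ▸ .tapp (.var 0) hz)))
    · exact fun i => Fin.cases (fun _ => .idTm hd1 _) (fun i hi => w (hp i hi)) i
    · exact fun i => Fin.cases (fun _ => .idTm hd1 _) (fun i hi => w (hn i hi)) i
    · refine fun i => Fin.cases (fun _ _ => rfl) (fun i hi hi' => ?_) i
      rw [Ty.lift_succ, Ty.lift_succ, he i hi hi']

end Typing

section ActId

variable {S : Sig.{u, v}} {T : Set (Form S 0 0 0)} {k n m a : ℕ}
  {Γ : Fin n → Typ S k} {Θ : Fin m → RelDecl S k}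

/-- The action of a type on identities. -/
abbrev actId (σ : Typ S a) (dom : Fin a → Typ S k) : Tm S k n :=
  act σ dom dom fun i => Tm.idTm (dom i)

theorem actId_sub (σ : Typ S a) (dom : Fin a → Typ S k) {l n' : ℕ} (p : Fin k → Typ S l)
    (q : Fin n → Tm S l n') :
    (actId σ dom).sub p q = actId σ fun i => (dom i).sub p := act_sub ..

theorem actId_ren (σ : Typ S a) (dom : Fin a → Typ S k) {l n' : ℕ} (p : Fin k → Fin l)
    (q : Fin n → Fin n') :
    (actId σ dom).ren p q = actId σ fun i => (dom i).ren p := by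
  simp only [Tm.ren_eq_sub, actId_sub, Ty.ren_eq_sub]

theorem HasType.actId (σ : Typ S a) (dom : Fin a → Typ S k) {d : Fin n → Mode} (hd : NoLin d) :
    HasType Γ d (LAPL.actId σ dom) (.lolli (σ.sub dom) (σ.sub dom)) :=
  .act σ hd (fun _ _ => .idTm hd _) (fun _ _ => .idTm hd _) fun _ _ _ => rfl

end ActId

/-! ## Consequences of identity extension and extensionality -/

section Computation

variable {S : Sig.{u, v}} {T : Set (Form S 0 0 0)} {k n m : ℕ}
  {Γ : Fin n → Typ S k} {Θ : Fin m → RelDecl S k} {Φ : List (Form S k n m)}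
  {σ τ : Typ S k} {s r : Tm S k n}

theorem PEq.beta_eq {t : Tm S k (n + 1)} (hΦ : WfHyps T Γ Θ Φ)
    (ht : HasType (cons σ Γ) (cons .lin allIntu) t τ) (hs : HasType Γ allIntu s σ)
    (e : t.inst s = r) : PEq T Γ Θ Φ τ (.app (.lam σ t) s) r := e ▸ .beta hΦ ht hs

theorem HasType.lin_to_intu {t : Tm S k (n + 1)} {a : Mode}
    (ht : HasType (cons σ Γ) (cons a allIntu) t τ) : HasType (cons σ Γ) allIntu t τ := by
  have := ht.sub_noLin (Γ' := cons σ Γ) noLin_allIntu (p := Ty.var) (q := Tm.var)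
    (fun i _ => .var_intu i (Ty.sub_var _).symm)
  rwa [Ty.sub_var, Tm.sub_var] at this

theorem Tm.ren_lift_inst (t : Tm S k (n + 1)) :
    (t.ren (up 0) (liftR (up 1))).inst (.var 0) = t := by
  rw [Tm.inst, Tm.ren_sub]
  refine Eq.trans ?_ t.sub_var
  congr 1; funext i; exact Fin.cases rfl (fun _ => rfl) i

theorem Tm.ren_lift_tinst (t : Tm S (k + 1) n) :
    (t.ren (liftR (up 1)) (up 0)).tinst (.var 0) = t := by
  rw [Tm.tinst, Tm.ren_sub]
  refine Eq.trans ?_ t.sub_var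
  congr 1; funext i; exact Fin.cases rfl (fun _ => rfl) i

theorem Ty.ren_lift_inst (σ : Typ S (k + 1)) : (σ.ren (liftR (up 1))).inst (.var 0) = σ := by
  rw [Ty.inst, Ty.ren_sub]
  refine Eq.trans ?_ σ.sub_var
  congr 1; funext i; exact Fin.cases rfl (fun _ => rfl) i

theorem PEq.beta_wk {t : Tm S k (n + 1)}
    (ht : HasType (cons σ Γ) (cons .lin allIntu) t τ) :
    PEq T (cons σ Γ) Θ [] τ (.app ((Tm.lam σ t).wk 0 1) (.var 0)) t := by
  refine .ofAx .nil (.app_intu ((HasType.lam ht).wk_tm σ) (.var_intu 0 rfl)) ht.lin_to_intu ?_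
  have := EqAx.betaTerm σ (t.ren (up 0) (liftR (up 1))) (.var 0 : Tm S k (n + 1))
  rw [t.ren_lift_inst] at this
  have e : (Tm.lam σ t).wk 0 1 = .lam σ (t.ren (up 0) (liftR (up 1))) := by
    rw [Tm.wk, Tm.ren, up_zero, Ty.ren_id]
  rwa [e]

theorem PEq.lam_ext {t : Tm S k (n + 1)} (hExt : Extensionality T)
    (ht : HasType (cons σ Γ) (cons .lin allIntu) t τ) (hs : HasType Γ allIntu s (.lolli σ τ))
    (h : PEq T (cons σ Γ) Θ [] τ t (.app (s.wk 0 1) (.var 0))) :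
    PEq T Γ Θ [] (.lolli σ τ) (.lam σ t) s :=
  .funext hExt (.lam ht) hs ((PEq.beta_wk ht).trans h)

theorem PEq.lam_congr {t t' : Tm S k (n + 1)} (hExt : Extensionality T)
    (ht : HasType (cons σ Γ) (cons .lin allIntu) t τ)
    (ht' : HasType (cons σ Γ) (cons .lin allIntu) t' τ) (h : PEq T (cons σ Γ) Θ [] τ t t') :
    PEq T Γ Θ [] (.lolli σ τ) (.lam σ t) (.lam σ t') :=
  .lam_ext hExt ht (.lam ht') (h.trans (PEq.beta_wk ht').symm)

theorem PEq.tlam_ext {t : Tm S (k + 1) n} {τ : Typ S (k + 1)} (hExt : Extensionality T)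
    (ht : HasType (wkCx Γ 1) allIntu t τ) (hs : HasType Γ allIntu s (.all τ))
    (h : PEq T (wkCx Γ 1) (wkRCx Θ 1) [] τ t (.tapp (s.wk 1 0) (.var 0))) :
    PEq T Γ Θ [] (.all τ) (.tlam t) s := by
  refine .tyext hExt (.tlam ht) hs (.trans (.ofAx .nil ?_ h.left ?_) h)
  · exact .tapp_intu _ (HasType.tlam ht).wk_ty τ.ren_lift_inst
  · have := EqAx.betaType (t.ren (liftR (up 1)) (up 0)) (.var 0 : Typ S (k + 1))
    rwa [t.ren_lift_tinst] at this

end Computation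

section IdentityExtension

variable {S : Sig.{u, v}} {T : Set (Form S 0 0 0)} {k n m a : ℕ}
  {Γ : Fin n → Typ S k} {Θ : Fin m → RelDecl S k}

theorem Rel.equiv_sub {k' n' m' : ℕ} (σ τ : Typ S k) (ρ ρ' : Rel S k n m) (p : Fin k → Typ S k')
    (q : Fin n → Tm S k' n') (r : Fin m → Rel S k' n' m') :
    (Rel.equiv σ τ ρ ρ').sub p q r =
      Rel.equiv (σ.sub p) (τ.sub p) (ρ.sub p q r) (ρ'.sub p q r) := by
  have h : ∀ ρ : Rel S k n m, Rel.sub (k := k) (n := n + 1 + 1) (m := m) (k' := k')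
      (n' := n' + 1 + 1) (m' := m') (ρ.wk 0 2 0) p (Tm.lift (Tm.lift q))
      (fun j => ((r j).wk 0 1 0).wk 0 1 0) = (ρ.sub p q r).wk 0 2 0 := fun ρ =>
    ρ.wk_sub (fun i => (Ty.ren_id _).symm) (Tm.lift_lift_up q)
      (fun j => by simp only [Rel.wk, Rel.ren_ren]; rfl)
  simp only [Rel.equiv, Form.iff, Form.sub, Tm.sub, h]
  rfl

/-- Logical relations at equality relations are reflexive. -/
theorem Prov.interp_eqRel (hId : IdentityExtension T) (σ : Typ S a) (τs : Fin a → Typ S k)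
    {t : Tm S k n} (ht : HasType Γ allIntu t (σ.sub τs)) :
    Prov T Γ Θ [] (.rel (.interp a σ fun i => Rel.eqRel (τs i)) t t) := by
  have h := Prov.subst (Γ' := Γ) (Θ' := Θ) τs nil nil (hId a σ) (fun i => i.elim0)
    (fun j => j.elim0) (fun j => j.elim0)
  rw [Rel.equiv_sub, Rel.eqRel_sub, Rel.sub] at h
  simp only [Rel.eqRel_sub, Ty.sub] at h
  exact (Prov.equiv_iff h .nil ht ht).2 ((Prov.eqRel_iff .nil ht ht).2 (.refl .nil ht))

theorem PEq.bang_ext (hExt : Extensionality T) (hId : IdentityExtension T) {C E : Typ S k}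
    {t s : Tm S k n} (ht : HasType Γ allIntu t (.lolli (.bang C) E))
    (hs : HasType Γ allIntu s (.lolli (.bang C) E))
    (h : PEq T (cons C Γ) Θ [] E (.app (t.wk 0 1) (.bang (.var 0)))
      (.app (s.wk 0 1) (.bang (.var 0)))) :
    PEq T Γ Θ [] (.lolli (.bang C) E) t s := by
  refine .funext hExt ht hs ?_
  have ht1 := ht.wk_tm (.bang C)
  have hs1 := hs.wk_tm (.bang C)
  have hw : HasType (cons (.bang C) Γ) allIntu (Tm.var 0) (.bang C) := .var_intu 0 rfl
  have hρ : ∀ i : Fin 1, StabAdm T (cons (.bang C) Γ) Θ (Rel.eqRel C) C C := fun _ => .eqRel C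
  have h0 := Prov.interp_eqRel (Θ := Θ) hId (.bang (.var 0) : Typ S 1) (fun _ => C) hw
  have h1 := (Prov.equiv_iff (.interpBang (.var 0) fun i => (hρ i).isAdm) .nil hw hw).1 h0
  have hR : StabRel T (cons (.bang C) Γ) Θ (.interp 1 (.var 0) fun _ => Rel.eqRel C) C C :=
    (StabAdm.interp (.var 0) hρ).stabRel
  have hE : StabAdm T (cons (.bang C) Γ) Θ (Rel.eqRel E) E E := .eqRel E
  refine (Prov.eqRel_iff .nil (.app_intu ht1 hw) (.app_intu hs1 hw)).1
    (Prov.bang_elim .nil hR hw hw h1 hE ht1 hs1 ?_)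
  refine (Prov.arrow_iff .nil hR hE.stabRel ht1 hs1).2 (.allTm_imp_intro ?_)
  have hx : HasType (cons C (cons C (cons (.bang C) Γ))) allIntu (Tm.var 1) C := .var_intu 1 rfl
  have hy : HasType (cons C (cons C (cons (.bang C) Γ))) allIntu (Tm.var 0) C := .var_intu 0 rfl
  have hρ' : ∀ i : Fin 1, StabAdm T (cons C (cons C (cons (.bang C) Γ))) Θ
    (Rel.eqRel C) C C := fun _ => .eqRel C
  have e1 : (Rel.interp 1 (.var 0) fun _ => Rel.eqRel C : Rel S k (n + 1) m).wk 0 2 0 =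
      .interp 1 (.var 0) fun _ => Rel.eqRel C := by
    rw [Rel.wk, Rel.ren, Rel.eqRel_ren, up_zero, Ty.ren_id]
  have e2 : (Rel.eqRel E : Rel S k (n + 1) m).wk 0 2 0 = Rel.eqRel E := by
    rw [Rel.wk, Rel.eqRel_ren, up_zero, Ty.ren_id]
  rw [e1, e2]
  have hΦ : WfHyps T (cons C (cons C (cons (.bang C) Γ))) Θ
      [.rel (.interp 1 (.var 0) fun _ => Rel.eqRel C) (.var 1) (.var 0)] :=
    .singleton (.rel (StabAdm.interp (.var 0) hρ').stabRel.isRel hx hy)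
  have hxy := (Prov.eqRel_iff hΦ hx hy).1 ((Prov.interp_var_iff hΦ hρ' 0 hx hy).1
    (Prov.hyp hΦ (List.mem_singleton_self _)))
  have hty := (ht1.wk_tm_two C C)
  have h2 := h.ren (Γ' := cons C (cons C (cons (.bang C) Γ))) (Θ' := Θ) (p := id)
    (q := cons 0 (up 3)) (r := id)
    ⟨fun i => Fin.cases (Ty.ren_id _).symm (fun i => (Ty.ren_id _).symm) i, fun j => by simp⟩
  have e3 : ∀ t : Tm S k n, (Tm.app (t.wk 0 1) (.bang (.var 0))).ren id
      (cons (0 : Fin (n + 3)) (up 3)) = .app ((t.wk 0 1).wk 0 2) (.bang (.var 0)) := by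
    intro t; simp only [Tm.ren, Tm.wk, Tm.ren_ren]; rfl
  rw [Ty.ren_id, e3, e3] at h2
  exact (Prov.eqRel_iff hΦ (.app_intu hty (.bang_intu hx))
    (.app_intu (hs1.wk_tm_two C C) (.bang_intu hy))).2
    (.trans (.app hΦ (.refl hΦ hty) (.bang hΦ hxy)) (h2.wkHyps hΦ))

/-- The curried form `λ°x. λ°y. t (x ⊗ y)` of a map out of a tensor product. -/
abbrev curryTm (A B : Typ S k) (t : Tm S k n) : Tm S k n :=
  .lam A (.lam B (.app (t.wk 0 2) (.tensor (.var 1) (.var 0))))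

variable {A B E : Typ S k} {t s y : Tm S k n}

theorem HasType.curry_body {d : Fin n → Mode} (hd : NoLin d)
    (ht : HasType Γ d t (.lolli (.tensor A B) E)) :
    HasType (cons B (cons A Γ)) (cons .lin (cons .lin d))
      (.app (t.wk 0 2) (.tensor (.var 1) (.var 0))) E :=
  .app ((hd.splits.cons .right).cons .right)
    (ht.wk_off (b := 2) hd hd.off.off (fun _ => rfl) (fun _ => rfl))
    (.tensor ((hd.splits.cons .left).cons .right) (.var_lin_one hd (by simp) _ _)
      (.var_lin_zero hd.off _))

theorem HasType.curryTm {d : Fin n → Mode} (hd : NoLin d)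
    (ht : HasType Γ d t (.lolli (.tensor A B) E)) :
    HasType Γ d (LAPL.curryTm A B t) (.lolli A (.lolli B E)) := .lam (.lam (ht.curry_body hd))

theorem curryTm_ren {l n' : ℕ} (p : Fin k → Fin l) (q : Fin n → Fin n') :
    (curryTm A B t).ren p q = curryTm (A.ren p) (B.ren p) (t.ren p q) := by
  simp only [curryTm, Tm.ren, Tm.wk, Tm.ren_ren]; rfl

theorem ExtEq.curryTm_app (ht : HasType Γ allIntu t (.lolli (.tensor A B) E)) :
    ExtEq (cons B (cons A Γ)) (cons .lin (cons .lin allIntu)) E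
      (.app (.app ((curryTm A B t).wk 0 2) (.var 1)) (.var 0))
      (.app (t.wk 0 2) (.tensor (.var 1) (.var 0))) := by
  have hd : NoLin (allIntu : Fin n → Mode) := noLin_allIntu
  have e0 : (curryTm A B t).wk 0 2 = curryTm A B (t.wk 0 2) := by
    rw [Tm.wk, curryTm_ren, up_zero, Ty.ren_id, Ty.ren_id]; rfl
  have ht2 : HasType (cons B (cons A Γ)) (cons .off (cons .off allIntu)) (t.wk 0 2)
      (.lolli (.tensor A B) E) := ht.wk_off (b := 2) hd hd.off.off (fun _ => rfl) (fun _ => rfl)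
  let b : Tm S k (n + 2) := .lam B (.app ((t.wk 0 2).wk 0 1) (.tensor (.var 2) (.var 0)))
  have hb : HasType (cons B (cons A Γ)) (cons .off (cons .lin allIntu)) b (.lolli B E) :=
    .lam (.app (((hd.splits.cons .right).cons .off).cons .right)
      (ht2.wk_off (b := 1) hd.off.off hd.off.off.off (fun _ => rfl) (fun _ => rfl))
      (.tensor (((hd.splits.cons .left).cons .off).cons .right)
        (.varLin 2 rfl fun j => Fin.cases (fun _ => by simp) (fun j => Fin.cases (fun _ => by simp)
          (fun j => Fin.cases (fun h => absurd rfl h) (fun j _ => hd j) j) j) j)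
        (.var_lin_zero hd.off.off _)))
  have e1 : (Tm.lam B (.app ((t.wk 0 2).wk 0 2) (.tensor (.var 1) (.var 0)))).inst
      (.var 1) = b := by
    simp only [Tm.inst, Tm.sub, Ty.sub_var, b]
    congr 2
    simp only [Tm.wk, Tm.ren_sub, Tm.ren_eq_sub, Tm.sub_sub]
    rfl
  have e2 : (Tm.app ((t.wk 0 2).wk 0 1) (.tensor (.var 2) (.var 0))).inst (.var 0) =
      .app (t.wk 0 2) (.tensor (.var 1) (.var 0)) := by
    simp only [Tm.inst, Tm.sub, Tm.wk_sub_cons]; rfl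
  rw [e0]
  have hv1 : HasType (cons B (cons A Γ)) (cons .off (cons .lin allIntu)) (Tm.var 1) A :=
    .var_lin_one hd (by simp) _ _
  have hv0 : HasType (cons B (cons A Γ)) (cons .lin (cons .off allIntu)) (Tm.var 0) B :=
    .var_lin_zero hd.off _
  have hsp : Splits (cons Mode.lin (cons Mode.lin (allIntu : Fin n → Mode)))
    (cons .off (cons .lin allIntu)) (cons .lin (cons .off allIntu)) :=
    (hd.splits.cons .left).cons .right
  refine .trans (.app hsp (.ax (e1 ▸ .betaTerm ..)
    (.app ((hd.splits.cons .right).cons .off) (ht2.curryTm hd.off.off) hv1) hb) (.refl hv0)) ?_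
  exact .ax (e2 ▸ .betaTerm ..) (.app hsp hb hv0) (ht.curry_body hd)

theorem HasType.letTensor_var {F : Typ S k} (hF : F = .lolli A (.lolli B E))
    (hy : HasType Γ allIntu y (.tensor A B)) :
    HasType (cons F Γ) allIntu
      (.letTensor A B (y.wk 0 1) (.app (.app (.var 2) (.var 1)) (.var 0))) E := by
  subst hF
  have hd : NoLin (allIntu : Fin (n + 1) → Mode) := noLin_allIntu
  exact .letTensor hd.splits (hy.wk_tm _) (.app ((hd.splits.cons .left).cons .right)
    (.app ((hd.splits.cons .right).cons .off) (.varIntu 2 rfl hd.off.off)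
      (.var_lin_one hd (by simp) _ _)) (.var_lin_zero hd.off _))

theorem Tm.letTensor_var_inst (f : Tm S k n) :
    (Tm.letTensor A B (y.wk 0 1) (.app (.app (.var 2) (.var 1)) (.var 0))).inst f =
      .letTensor A B y (.app (.app (f.wk 0 2) (.var 1)) (.var 0)) := by
  have e : Tm.lift (Tm.lift (cons f Tm.var)) 2 = f.wk 0 2 := Tm.lift_lift_up (cons f Tm.var) 0
  simp only [Tm.inst, Tm.sub, Tm.wk_sub_cons, Ty.sub_var, e]; rfl

theorem PEq.letTensor_curry (ht : HasType Γ allIntu t (.lolli (.tensor A B) E))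
    (hy : HasType Γ allIntu y (.tensor A B)) :
    PEq T Γ Θ [] E
      (.letTensor A B y (.app (.app ((curryTm A B t).wk 0 2) (.var 1)) (.var 0)))
      (.app t y) := by
  have hd : NoLin (allIntu : Fin n → Mode) := noLin_allIntu
  have h1 : HasType Γ allIntu
      (.letTensor A B y (.app (.app ((curryTm A B t).wk 0 2) (.var 1)) (.var 0))) E := by
    rw [← Tm.letTensor_var_inst]
    exact (HasType.letTensor_var rfl hy).inst_intu (ht.curryTm hd)
  have h2 : HasType Γ allIntu
      (.letTensor A B y (.app (t.wk 0 2) (.tensor (.var 1) (.var 0)))) E :=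
    .letTensor hd.splits hy (ht.curry_body hd)
  have h3 : HasType Γ allIntu (.letTensor A B y (.tensor (.var 1) (.var 0))) (.tensor A B) :=
    .letTensor hd.splits hy (.tensor ((hd.splits.cons .left).cons .right)
      (.var_lin_one hd (by simp) _ _) (.var_lin_zero hd.off _))
  have hc := EqAx.commTensor (.appR t) A B y (.tensor (.var 1) (.var 0))
  have e : ∀ i : Fin (n + 2), swap 2 0 n i = i := by
    intro i; apply Fin.ext; simp only [swap]; split
    · omega
    · simp
  simp only [Frame.wk, Frame.plug, Tm.ren, e, up_zero, Ty.ren_id, Tm.wk, Tm.ren_id] at hc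
  exact .trans (.ofExtEq .nil h1 h2 (.letTensor hd.splits (.refl hy) (.curryTm_app ht)))
    (.trans (.ofAx .nil h2 (.app_intu ht h3) hc)
      (.app .nil (.refl .nil ht) (.ofAx .nil h3 hy (.etaTensor A B y))))

theorem PEq.of_curryTm (hExt : Extensionality T)
    (ht : HasType Γ allIntu t (.lolli (.tensor A B) E))
    (hs : HasType Γ allIntu s (.lolli (.tensor A B) E))
    (h : PEq T Γ Θ [] (.lolli A (.lolli B E)) (curryTm A B t) (curryTm A B s)) :
    PEq T Γ Θ [] (.lolli (.tensor A B) E) t s := by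
  have h' := h.wk_tm (.tensor A B)
  have hy : HasType (cons (.tensor A B) Γ) allIntu (Tm.var 0) (.tensor A B) := .var_intu 0 rfl
  have e : ∀ t : Tm S k n, (curryTm A B t).wk 0 1 = curryTm A B (t.wk 0 1) := by
    intro t; rw [Tm.wk, curryTm_ren, up_zero, Ty.ren_id, Ty.ren_id]; rfl
  have hcg := PEq.congr .nil (HasType.letTensor_var rfl hy) h'
  rw [Tm.letTensor_var_inst, Tm.letTensor_var_inst, e, e] at hcg
  exact .funext hExt ht hs
    (.trans (PEq.letTensor_curry (ht.wk_tm _) hy).symm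
      (hcg.trans (.letTensor_curry (hs.wk_tm _) hy)))

theorem PEq.tensor_ext (hExt : Extensionality T)
    (ht : HasType Γ allIntu t (.lolli (.tensor A B) E))
    (hs : HasType Γ allIntu s (.lolli (.tensor A B) E))
    (h : PEq T (cons B (cons A Γ)) Θ [] E (.app (t.wk 0 2) (.tensor (.var 1) (.var 0)))
      (.app (s.wk 0 2) (.tensor (.var 1) (.var 0)))) :
    PEq T Γ Θ [] (.lolli (.tensor A B) E) t s := by
  have hd : NoLin (allIntu : Fin n → Mode) := noLin_allIntu
  have hd1 : NoLin (allIntu : Fin (n + 1) → Mode) := noLin_allIntu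
  have w : ∀ {t : Tm S k n}, HasType Γ allIntu t (.lolli (.tensor A B) E) →
      HasType (cons B (cons A Γ)) (cons .lin allIntu)
        (.app (t.wk 0 2) (.tensor (.var 1) (.var 0))) E := fun ht =>
    .app (hd1.splits.cons .right)
      (ht.wk_off (b := 2) hd hd1.off (fun _ => rfl) (fun _ => rfl))
      (.tensor (hd1.splits.cons .right) (.varIntu 1 rfl hd1.off) (.var_lin_zero hd1 _))
  exact .of_curryTm hExt ht hs (.lam_congr hExt (.lam (ht.curry_body hd))
    (.lam (hs.curry_body hd)) (.lam_congr hExt (w ht) (w hs) h))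

end IdentityExtension

section ActId

variable {S : Sig.{u, v}} {T : Set (Form S 0 0 0)} {k n m a : ℕ}
  {Γ : Fin n → Typ S k} {Θ : Fin m → RelDecl S k} {A B E : Typ S k} {x y : Tm S k n}

theorem HasType.lam_inv {d : Fin n → Mode} {t : Tm S k (n + 1)}
    (h : HasType Γ d (.lam A t) (.lolli A B)) : HasType (cons A Γ) (cons .lin d) t B := by
  cases h with | lam h => exact h

theorem HasType.tlam_inv {d : Fin n → Mode} {t : Tm S (k + 1) n} {σ : Typ S (k + 1)}
    (h : HasType Γ d (.tlam t) (.all σ)) : HasType (wkCx Γ 1) d t σ := by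
  cases h with | tlam h => exact h

theorem PEq.beta_tensor {t : Tm S k (n + 2)} (hx : HasType Γ allIntu x A)
    (hy : HasType Γ allIntu y B)
    (ht : HasType (cons B (cons A Γ)) (cons .lin (cons .lin allIntu)) t E) :
    PEq T Γ Θ [] E (.letTensor A B (.tensor x y) t)
      (t.sub Ty.var (cons y (cons x Tm.var))) := by
  refine .ofAx .nil (.letTensor noLin_allIntu.splits (.tensor_intu hx hy) ht) ?_
    (.betaTensor A B x y t)
  have := ht.sub_noLin (Γ' := Γ) noLin_allIntu (p := Ty.var) (q := cons y (cons x Tm.var))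
    (fun i _ => by
      rw [Ty.sub_var]
      exact Fin.cases hy (fun i => Fin.cases hx (fun i => .var_intu i rfl) i) i)
  rwa [Ty.sub_var] at this

theorem PEq.beta_bang {t : Tm S k (n + 1)} (hx : HasType Γ allIntu x A)
    (ht : HasType (cons A Γ) allIntu t E) :
    PEq T Γ Θ [] E (.letBang A (.bang x) t) (t.inst x) :=
  .ofAx .nil (.letBang noLin_allIntu.splits (.bang_intu hx) (cons_allIntu ▸ ht))
    (ht.inst_intu hx) (.betaBang A x t)

theorem Tm.idTm_wk (A : Typ S k) (b : ℕ) : (Tm.idTm A : Tm S k n).wk 0 b = Tm.idTm A := by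
  rw [Tm.wk, Tm.idTm_ren, up_zero, Ty.ren_id]

theorem actId_wk (σ : Typ S a) (dom : Fin a → Typ S k) (b : ℕ) :
    (actId σ dom : Tm S k n).wk 0 b = actId σ dom := by
  rw [Tm.wk, actId_ren, up_zero]; simp only [Ty.ren_id]

/-- The functorial action preserves identities. -/
theorem PEq.actId (hExt : Extensionality T) (hId : IdentityExtension T) (σ : Typ S a) :
    ∀ {k n m : ℕ} {Γ : Fin n → Typ S k} {Θ : Fin m → RelDecl S k} (dom : Fin a → Typ S k),
      PEq T Γ Θ [] (.lolli (σ.sub dom) (σ.sub dom)) (LAPL.actId σ dom)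
        (Tm.idTm (σ.sub dom)) := by
  have app : ∀ {a k n m : ℕ} {σ : Typ S a} {dom : Fin a → Typ S k} {Γ : Fin n → Typ S k}
      {Θ : Fin m → RelDecl S k} {x : Tm S k n},
      PEq T Γ Θ [] (.lolli (σ.sub dom) (σ.sub dom)) (LAPL.actId σ dom) (Tm.idTm (σ.sub dom)) →
      HasType Γ allIntu x (σ.sub dom) →
      PEq T Γ Θ [] (σ.sub dom) (.app (LAPL.actId σ dom) x) x := fun h hx =>
    (PEq.app .nil h (.refl .nil hx)).trans (.beta_idTm .nil hx)
  induction σ with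
  | var i => intro k n m Γ Θ dom; exact .refl .nil (.idTm noLin_allIntu _)
  | con c args ih => intro k n m Γ Θ dom; exact .refl .nil (.idTm noLin_allIntu _)
  | one => intro k n m Γ Θ dom; exact .refl .nil (.idTm noLin_allIntu _)
  | tensor σ τ ih₁ ih₂ =>
    intro k n m Γ Θ dom
    have hd : ∀ {n : ℕ}, NoLin (allIntu : Fin n → Mode) := noLin_allIntu
    refine .tensor_ext hExt (.actId _ dom hd) (.idTm hd _) ?_
    have hx : HasType (cons (τ.sub dom) (cons (σ.sub dom) Γ)) allIntu (Tm.var 1) (σ.sub dom) :=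
      .var_intu 1 rfl
    have hy : HasType (cons (τ.sub dom) (cons (σ.sub dom) Γ)) allIntu (Tm.var 0) (τ.sub dom) :=
      .var_intu 0 rfl
    have hxy := hx.tensor_intu hy
    rw [actId_wk, Tm.idTm_wk]
    have hb := (HasType.actId (Γ := cons (τ.sub dom) (cons (σ.sub dom) Γ)) (.tensor σ τ) dom
      hd).lam_inv
    simp only [Tm.idTm_wk] at hb
    have h1 := PEq.beta_eq (T := T) (Θ := Θ) .nil hb hxy (r := .letTensor (σ.sub dom) (τ.sub dom)
      (.tensor (.var 1) (.var 0)) (.tensor (.app (LAPL.actId σ dom) (.var 1))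
        (.app (LAPL.actId τ dom) (.var 0)))) (by
      simp only [Tm.inst, Tm.sub, actId_sub, Ty.sub_var]; rfl)
    have h2 := PEq.beta_tensor (T := T) (Θ := Θ) hx hy (E := .tensor (σ.sub dom) (τ.sub dom))
      (t := .tensor (.app (LAPL.actId σ dom) (.var 1)) (.app (LAPL.actId τ dom) (.var 0)))
      (.tensor ((hd.splits.cons .left).cons .right)
        (.app ((hd.splits.cons .right).cons .off) (.actId _ _ hd.off.off)
          (.var_lin_one hd (by simp) _ _))
        (.app (hd.off.splits.cons .right) (.actId _ _ hd.off.off) (.var_lin_zero hd.off _)))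
    simp only [Tm.sub, actId_sub, Ty.sub_var] at h2
    simp only [LAPL.actId, act, Tm.idTm_wk] at h1 ⊢
    exact (h1.trans (h2.trans (.tensor .nil (app (ih₁ dom) hx) (app (ih₂ dom) hy)))).trans
      (PEq.beta_idTm .nil hxy).symm
  | lolli σ τ ih₁ ih₂ =>
    intro k n m Γ Θ dom
    have hb := (HasType.actId (Γ := Γ) (.lolli σ τ) dom noLin_allIntu).lam_inv
    simp only [Tm.idTm_wk] at hb
    have hf : HasType (cons ((Ty.lolli σ τ).sub dom) Γ) allIntu (Tm.var 0)
      ((Ty.lolli σ τ).sub dom) := .var_intu 0 rfl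
    have hx : HasType (cons (σ.sub dom) (cons ((Ty.lolli σ τ).sub dom) Γ)) allIntu (Tm.var 0)
      (σ.sub dom) := .var_intu 0 rfl
    have hf' : HasType (cons (σ.sub dom) (cons ((Ty.lolli σ τ).sub dom) Γ)) allIntu (Tm.var 1)
      (.lolli (σ.sub dom) (τ.sub dom)) := .var_intu 1 rfl
    have h1 := PEq.app (T := T) (Θ := Θ) .nil (.refl .nil hf') (app (ih₁ dom) hx)
    have h2 := ((PEq.app .nil (.refl .nil (.actId τ dom noLin_allIntu)) h1).trans
      (app (ih₂ dom) h1.right))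
    simp only [LAPL.actId, act, Tm.idTm_wk]
    exact .lam_ext hExt hb (.idTm noLin_allIntu _)
      ((PEq.lam_ext hExt hb.lin_to_intu.lam_inv hf h2).trans (by rw [Tm.idTm_wk]; exact (PEq.beta_idTm .nil hf).symm))
  | bang σ ih =>
    intro k n m Γ Θ dom
    refine .bang_ext hExt hId (.actId (.bang σ) dom noLin_allIntu) (.idTm noLin_allIntu _) ?_
    have hx : HasType (cons (σ.sub dom) Γ) allIntu (Tm.var 0) (σ.sub dom) := .var_intu 0 rfl
    rw [actId_wk, Tm.idTm_wk]
    have hb := (HasType.actId (Γ := cons (σ.sub dom) Γ) (.bang σ) dom noLin_allIntu).lam_inv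
    simp only [Tm.idTm_wk] at hb
    have h1 := PEq.beta_eq (T := T) (Θ := Θ) .nil hb (.bang_intu hx) (r := .letBang (σ.sub dom)
      (.bang (.var 0)) (.bang (.app (LAPL.actId σ dom) (.var 0)))) (by
      simp only [Tm.inst, Tm.sub, actId_sub, Ty.sub_var]; rfl)
    have h2 := PEq.beta_bang (T := T) (Θ := Θ) hx (E := .bang (σ.sub dom))
      (t := .bang (.app (LAPL.actId σ dom) (.var 0)))
      (.bang_intu (.app_intu (.actId _ _ noLin_allIntu) (.var_intu 0 rfl)))
    simp only [Tm.inst, Tm.sub, actId_sub, Ty.sub_var] at h2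
    simp only [LAPL.actId, act, Tm.idTm_wk] at h1 ⊢
    exact (h1.trans (h2.trans (.bang .nil (app (ih dom) hx)))).trans
      (PEq.beta_idTm .nil (.bang_intu hx)).symm
  | all σ ih =>
    intro k n m Γ Θ dom
    have hb := (HasType.actId (Γ := Γ) (.all σ) dom noLin_allIntu).lam_inv
    have e : (cons (Tm.idTm (.var 0)) fun i => (Tm.idTm (dom i) : Tm S k n).wk 1 1) =
        fun i => Tm.idTm (Ty.lift dom i) := by
      funext i; exact Fin.cases rfl (fun _ => rfl) i
    have hz : HasType (cons ((Ty.all σ).sub dom) Γ) allIntu (Tm.var 0) ((Ty.all σ).sub dom) :=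
      .var_intu 0 rfl
    have hz' : HasType (wkCx (cons ((Ty.all σ).sub dom) Γ) 1) allIntu
        (.tapp (.var 0) (.var 0)) (σ.sub (Ty.lift dom)) :=
      .tapp_intu _ hz.wk_ty (Ty.ren_lift_inst _)
    simp only [e] at hb
    simp only [LAPL.actId, act, e]
    exact .lam_ext hExt hb (.idTm noLin_allIntu _)
      ((PEq.tlam_ext hExt hb.lin_to_intu.tlam_inv hz (app (ih _) hz')).trans
        (by rw [Tm.idTm_wk]; exact (PEq.beta_idTm .nil hz).symm))

end ActId

/-! ## Computation rules for coinductive types -/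

section Environment

variable {S : Sig.{u, v}} {T : Set (Form S 0 0 0)} {k n m k' n' : ℕ}
  {Γ : Fin n → Typ S k} {Γ' : Fin n' → Typ S k'} {Θ : Fin m → RelDecl S k'}
  {d : Fin n → Mode} {p : Fin k → Typ S k'} {q : Fin n → Tm S k' n'}

/-- The substitution `p, q` is well-typed, with respect to intuitionistic contexts. -/
def EnvOk (Γ : Fin n → Typ S k) (Γ' : Fin n' → Typ S k') (p : Fin k → Typ S k')
    (q : Fin n → Tm S k' n') : Prop := ∀ i, HasType Γ' allIntu (q i) ((Γ i).sub p)

theorem EnvOk.nil {p : Fin 0 → Typ S k'} {q : Fin 0 → Tm S k' n'} :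
    EnvOk (LAPL.nil : Fin 0 → Typ S 0) Γ' p q := fun i => i.elim0

theorem EnvOk.cons (h : EnvOk Γ Γ' p q) {σ : Typ S k} {s : Tm S k' n'}
    (hs : HasType Γ' allIntu s (σ.sub p)) : EnvOk (cons σ Γ) Γ' p (cons s q) :=
  fun i => Fin.cases hs h i

theorem EnvOk.ty (h : EnvOk Γ Γ' p q) (A : Typ S k') :
    EnvOk (wkCx Γ 1) Γ' (LAPL.cons A p) q := fun i => by
  rw [wkCx, Ty.ren_sub]; exact h i

theorem HasType.env {t : Tm S k n} {τ : Typ S k} (ht : HasType Γ d t τ)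
    (h : EnvOk Γ Γ' p q) : HasType Γ' allIntu (t.sub p q) (τ.sub p) :=
  ht.sub_noLin noLin_allIntu fun i _ => h i

theorem PEq.beta_env {t : Tm S k (n + 1)} {σ τ : Typ S k} {τ' : Typ S k'} {s : Tm S k' n'}
    (ht : HasType Γ d (.lam σ t) (.lolli σ τ)) (h : EnvOk Γ Γ' p q)
    (hs : HasType Γ' allIntu s (σ.sub p)) (e : τ.sub p = τ') :
    PEq T Γ' Θ [] τ' (.app ((Tm.lam σ t).sub p q) s) (t.sub p (cons s q)) := by
  subst e
  have e : (t.sub p (Tm.lift q)).inst s = t.sub p (cons s q) := by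
    rw [Tm.inst, Tm.sub_sub]
    simp only [Ty.sub_var]
    congr 1; funext i; exact Fin.cases rfl (fun i => Tm.ren_succ_sub _ _) i
  exact .ofAx .nil (.app_intu (ht.env h) hs) (ht.lam_inv.env (h.cons hs))
    (e ▸ EqAx.betaTerm _ _ _)

theorem PEq.tbeta_env {t : Tm S (k + 1) n} {τ : Typ S (k + 1)} {τ' : Typ S k'}
    (ht : HasType Γ d (.tlam t) (.all τ)) (h : EnvOk Γ Γ' p q) (A : Typ S k')
    (e : τ.sub (cons A p) = τ') :
    PEq T Γ' Θ [] τ' (.tapp ((Tm.tlam t).sub p q) A) (t.sub (cons A p) q) := by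
  subst e
  have e1 : (t.sub (Ty.lift p) fun i => (q i).wk 1 0).tinst A = t.sub (cons A p) q := by
    rw [Tm.tinst, Tm.sub_sub]
    congr 1
    · funext i; exact Fin.cases rfl (fun i => Ty.ren_succ_inst _ _) i
    · funext i; exact Tm.wk_tinst _ _
  have e2 : (τ.sub (Ty.lift p)).inst A = τ.sub (cons A p) := by
    rw [Ty.inst, Ty.sub_sub]
    congr 1; funext i; exact Fin.cases rfl (fun i => Ty.ren_succ_inst _ _) i
  exact .ofAx .nil (.tapp_intu A (ht.env h) e2) (ht.tlam_inv.env (h.ty A))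
    (e1 ▸ EqAx.betaType _ _)

theorem PEq.beta_tensor_env {t : Tm S k (n + 2)} {A B τ : Typ S k} {τ' : Typ S k'}
    {z : Tm S k n} {x y : Tm S k' n'} (ht : HasType Γ d (.letTensor A B z t) τ)
    (h : EnvOk Γ Γ' p q) (hx : HasType Γ' allIntu x (A.sub p))
    (hy : HasType Γ' allIntu y (B.sub p)) (ez : z.sub p q = .tensor x y) (e : τ.sub p = τ') :
    PEq T Γ' Θ [] τ' ((Tm.letTensor A B z t).sub p q) (t.sub p (cons y (cons x q))) := by
  subst e
  have h1 : (t.sub p (Tm.lift (Tm.lift q))).sub Ty.var (cons y (cons x Tm.var)) =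
      t.sub p (cons y (cons x q)) := by
    rw [Tm.sub_sub]
    simp only [Ty.sub_var]
    congr 1; funext i
    refine Fin.cases rfl (fun i => Fin.cases rfl (fun i => ?_) i) i
    rw [Tm.lift_succ, Tm.lift_succ, Tm.ren_ren, Tm.ren_sub]
    exact (q i).sub_var
  have h2 : HasType Γ' allIntu (t.sub p (cons y (cons x q))) (τ.sub p) := by
    cases ht with | letTensor _ _ ht => exact ht.env ((h.cons hx).cons hy)
  refine .ofAx .nil (ht.env h) h2 ?_
  rw [Tm.sub, ez]
  exact h1 ▸ EqAx.betaTensor _ _ _ _ _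

theorem PEq.beta_bang_env {t : Tm S k (n + 1)} {A τ : Typ S k} {τ' : Typ S k'}
    {z : Tm S k n} {x : Tm S k' n'} (ht : HasType Γ d (.letBang A z t) τ)
    (h : EnvOk Γ Γ' p q) (hx : HasType Γ' allIntu x (A.sub p)) (ez : z.sub p q = .bang x)
    (e : τ.sub p = τ') :
    PEq T Γ' Θ [] τ' ((Tm.letBang A z t).sub p q) (t.sub p (cons x q)) := by
  subst e
  have h1 : (t.sub p (Tm.lift q)).inst x = t.sub p (cons x q) := by
    rw [Tm.inst, Tm.sub_sub]
    simp only [Ty.sub_var]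
    congr 1; funext i; exact Fin.cases rfl (fun i => Tm.ren_succ_sub _ _) i
  have h2 : HasType Γ' allIntu (t.sub p (cons x q)) (τ.sub p) := by
    cases ht with | letBang _ _ ht => exact ht.env (h.cons hx)
  refine .ofAx .nil (ht.env h) h2 ?_
  rw [Tm.sub, ez]
  exact h1 ▸ EqAx.betaBang _ _ _

end Environment

section Typing

variable {S : Sig.{u, v}} {k n : ℕ} {Γ : Fin n → Typ S k} {d : Fin n → Mode} {σ ρ : Typ S 1}

theorem Ty.ren_eq_ap {l : ℕ} (σ : Typ S 1) (r : Fin 1 → Fin l) : σ.ren r = σ.ap (.var (r 0)) := by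
  rw [Ty.ren_eq_sub, Ty.ap]; congr 1; funext i; rw [Subsingleton.elim i 0]

theorem Ty.sub_eq_ap {l : ℕ} (σ : Typ S 1) (s : Fin 1 → Typ S l) : σ.sub s = σ.ap (s 0) := by
  rw [Ty.ap]; congr 1; funext i; rw [Subsingleton.elim i 0]

theorem Ty.wk0_ap (τ : Typ S 0) (A : Typ S k) : (τ.wk0 1).ap A = τ.wk0 k := Ty.wk0_sub ..

theorem HasType.functorTm (hPos : σ.OnlyPositive 0) :
    HasType nil allIntu (functorTm σ) (.all (.all (.lolli (.bang (.lolli (.var 1) (.var 0)))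
      (.lolli (σ.ap (.var 1)) (σ.ap (.var 0)))))) := by
  have hd : NoLin (allIntu : Fin 0 → Mode) := noLin_allIntu
  refine .tlam (.tlam (.lam (.letBang (hd.splits.cons .left) (.var_lin_zero hd _)
    (.act σ hd.off.intu ?_ ?_ ?_))))
  · exact fun _ _ => .varIntu 0 rfl hd.off.intu
  · intro i hi; rw [Subsingleton.elim i 0] at hi; exact absurd hi hPos
  · intro i _ hi; rw [Subsingleton.elim i 0] at hi; exact absurd hi hPos

theorem HasType.tapp_eq {t : Tm S k n} {τ : Typ S (k + 1)} (A : Typ S k) {τ' : Typ S k}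
    (ht : HasType Γ d t (.all τ)) (e : τ.inst A = τ') : HasType Γ d (.tapp t A) τ' :=
  e ▸ .tapp A ht

theorem HasType.fmap (hPos : σ.OnlyPositive 0) (hd : NoLin d) {A B : Typ S k} {f : Tm S k n}
    (hf : HasType Γ d f (.lolli A B)) :
    HasType Γ d (LAPL.fmap σ A B f) (.lolli (σ.ap A) (σ.ap B)) := by
  refine .app hd.splits (.tapp_eq B (τ := .lolli (.bang (.lolli (A.ren (up 1)) (.var 0)))
    (.lolli (σ.ap (A.ren (up 1))) (σ.ap (.var 0)))) (.tapp_eq A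
      ((HasType.functorTm hPos).wk0 hd) ?_) ?_) (.bang hd hf)
  · simp only [Ty.inst, Ty.ren, Ty.sub, Ty.ap_ren, Ty.ap_sub]; rfl
  · simp only [Ty.inst, Ty.sub, Ty.ap_sub, Ty.ren_sub, up_one, cons_succ, Ty.sub_var]; rfl

theorem coprod_wk0 (ρ : Typ S 1) : (coprod ρ).wk0 k =
    .all (.lolli (.all (.lolli (ρ.ap (.var 0)) (.var 1))) (.var 0)) := by
  simp only [coprod, Ty.wk0, Ty.ren, Ty.ap_ren]; rfl

theorem coprod_inst (ρ : Typ S 1) (B : Typ S k) :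
    (Ty.lolli (.all (.lolli (ρ.ap (.var 0)) (.var 1))) (.var 0)).inst B =
      .lolli (.all (.lolli (ρ.ap (.var 0)) (B.ren (up 1)))) B := by
  simp only [Ty.inst, Ty.sub, Ty.ap_sub]; rfl

theorem HasType.pack (ρ : Typ S 1) :
    HasType nil allIntu (pack ρ) (.all (.lolli ρ ((coprod ρ).wk0 1))) := by
  have hd : NoLin (allIntu : Fin 0 → Mode) := noLin_allIntu
  rw [coprod_wk0]
  refine .tlam (.lam (.tlam (.lam (.app (σ := ρ.ap (.var 1)) (d₁ := cons .lin (cons .off allIntu))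
    (d₂ := cons .off (cons .lin allIntu)) ((hd.splits.cons .right).cons .left)
      (.tapp_eq _ (.var_lin_zero hd.off _) ?_) ?_))))
  · simp only [Ty.inst, Ty.sub, Ty.ap_sub]; rfl
  · have e : ρ.ap (.var 1) = ρ.ren (up 1) := (ρ.ren_eq_ap (up 1)).symm
    rw [e]
    exact .varLin 1 rfl fun j => Fin.cases (fun _ => by simp) (fun j =>
      Fin.cases (fun h => absurd rfl h) (fun j _ => hd j) j) j

theorem HasType.pack_tapp (ρ : Typ S 1) (hd : NoLin d) (A : Typ S k) :
    HasType Γ d (.tapp ((LAPL.pack ρ).wk0 k n) A) (.lolli (ρ.ap A) ((coprod ρ).wk0 k)) := by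
  refine .tapp_eq A ((HasType.pack ρ).wk0 hd) ?_
  simp only [Ty.inst, Ty.sub, Ty.ren, Ty.wk0_ren, Ty.wk0_sub, Ty.ren_eq_ap, Ty.ap_sub,
    Ty.wk0_ap]; rfl

theorem coalgTy_ap (σ : Typ S 1) (A : Typ S k) :
    (coalgTy σ).ap A = .tensor (.bang (.lolli A (σ.ap A))) A := rfl

theorem HasType.unfold (σ : Typ S 1) :
    HasType nil allIntu (unfold σ)
      (.all (.lolli (.bang (.lolli (.var 0) σ)) (.lolli (.var 0) ((nu σ).wk0 1)))) := by
  have hd : NoLin (allIntu : Fin 0 → Mode) := noLin_allIntu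
  refine .tlam (.lam (.lam (.app ((hd.splits.cons .right).cons .right)
    (.pack_tapp _ hd.off.off _) ?_)))
  rw [coalgTy_ap, Ty.ap_var]
  exact .tensor ((hd.splits.cons .left).cons .right) (.var_lin_one hd (by simp) _ _)
    (.var_lin_zero hd.off _)

/-- The map `unfold A !f : A ⊸ να.σ(α)`. -/
def unf (σ : Typ S 1) (A : Typ S k) (f : Tm S k n) : Tm S k n :=
  .app (.tapp ((LAPL.unfold σ).wk0 k n) A) (.bang f)

theorem HasType.unf {A : Typ S k} {f : Tm S k n} (hd : NoLin d)
    (hf : HasType Γ d f (.lolli A (σ.ap A))) :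
    HasType Γ d (LAPL.unf σ A f) (.lolli A ((nu σ).wk0 k)) := by
  refine .app hd.splits (.tapp_eq A ((HasType.unfold σ).wk0 hd) ?_) (.bang hd hf)
  simp only [Ty.inst, Ty.sub, Ty.ren, Ty.wk0_ren, Ty.wk0_sub, Ty.ren_eq_ap, Ty.ap_sub,
    Ty.wk0_ap]; rfl

theorem HasType.outStep (hPos : σ.OnlyPositive 0) :
    HasType nil allIntu (outStep σ) (.all (.lolli (coalgTy σ) (σ.ap ((nu σ).wk0 1)))) := by
  have hd : NoLin (allIntu : Fin 0 → Mode) := noLin_allIntu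
  have hf : HasType (cons (.lolli (.var 0) σ) (cons (.var 0) (cons (.bang (.lolli (.var 0) σ))
      (cons (coalgTy σ) (wkCx nil 1))))) (cons .intu (cons .off (cons .off (cons .off allIntu))))
      (Tm.var 0) (.lolli (.var 0) (σ.ap (.var 0))) := by
    rw [Ty.ap_var]; exact .varIntu 0 rfl hd.off.off.off.intu
  refine .tlam (.lam (.letTensor (hd.splits.cons .left) (.var_lin_zero hd _)
    (.letBang (((hd.off.splits).cons .left).cons .right) (.var_lin_one hd.off (by simp) _ _)
      (.app (((hd.off.off.splits).cons .right).cons .intu)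
        (.fmap hPos hd.off.off.off.intu (.unf hd.off.off.off.intu hf))
        (.app (((hd.off.off.splits).cons .right).cons .intu) hf
          (.varLin 1 rfl fun j => Fin.cases (fun _ => by simp) (fun j =>
            Fin.cases (fun h => absurd rfl h) (fun j _ => hd.off.off j) j) j))))))

theorem HasType.outStep_wk0 (hPos : σ.OnlyPositive 0) (hd : NoLin d) :
    HasType Γ d ((LAPL.outStep σ).wk0 k n)
      (.all (.lolli ((coalgTy σ).ap (.var 0)) ((σ.ap ((nu σ).wk0 k)).ren (up 1)))) := by
  have := (HasType.outStep hPos).wk0 (Γ := Γ) (k := k) hd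
  rw [Ty.wk0, Ty.ren, Ty.ren, Ty.ap_ren, Ty.wk0_ren, Ty.ren_eq_ap] at this
  rw [Ty.ap_ren, Ty.wk0_ren]
  exact this

theorem HasType.out (hPos : σ.OnlyPositive 0) :
    HasType nil allIntu (out σ) (.lolli (nu σ) (σ.ap (nu σ))) := by
  have hd : NoLin (allIntu : Fin 0 → Mode) := noLin_allIntu
  have hr := HasType.outStep_wk0 (Γ := cons (nu σ) nil) (k := 0) hPos hd.off
  rw [Ty.wk0_zero] at hr
  exact .lam (.app (hd.splits.cons .left)
    (.tapp_eq _ (.var_lin_zero hd _) (coprod_inst _ _)) hr)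

theorem HasType.out_wk0 (hPos : σ.OnlyPositive 0) (hd : NoLin d) :
    HasType Γ d ((LAPL.out σ).wk0 k n) (.lolli ((nu σ).wk0 k) (σ.ap ((nu σ).wk0 k))) := by
  have := (HasType.out hPos).wk0 (Γ := Γ) (k := k) hd
  rwa [Ty.wk0, Ty.ren, Ty.ap_ren] at this

end Typing

section Computation

variable {S : Sig.{u, v}} {T : Set (Form S 0 0 0)} {k n m : ℕ}
  {Γ : Fin n → Typ S k} {Θ : Fin m → RelDecl S k} {σ ρ : Typ S 1} {A B : Typ S k}
  {f x y g h : Tm S k n}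

theorem Tm.wk0_eq_sub (t : Tm S 0 0) : t.wk0 k n = t.sub nil nil := by
  rw [Tm.wk0, Tm.ren_eq_sub]; congr 1 <;> exact Subsingleton.elim _ _

theorem unf_wk (b : ℕ) : (unf σ A f).wk 0 b = unf σ A (f.wk 0 b) := by
  simp only [unf, Tm.wk, Tm.ren, Tm.wk0_ren, up_zero, Ty.ren_id]
  rfl

theorem fmap_wk (b : ℕ) : (fmap σ A B f).wk 0 b = fmap σ A B (f.wk 0 b) := by
  simp only [Tm.wk, fmap_ren, up_zero, Ty.ren_id]

theorem Tm.comp_wk (b : ℕ) : (Tm.comp A g f).wk 0 b = Tm.comp A (g.wk 0 b) (f.wk 0 b) := by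
  simp only [Tm.comp, Tm.wk, Tm.ren, Tm.ren_ren, up_zero, Ty.ren_id]; rfl

theorem PEq.pack_beta (hy : HasType Γ allIntu y (ρ.ap A))
    (hg : HasType Γ allIntu g (.all (.lolli (ρ.ap (.var 0)) (B.ren (up 1))))) :
    PEq T Γ Θ [] B (.app (.tapp (.app (.tapp ((pack ρ).wk0 k n) A) y) B) g)
      (.app (.tapp g A) y) := by
  have hp := HasType.pack ρ
  rw [coprod_wk0] at hp
  have hp1 := hp.tlam_inv.lam_inv
  let C : Typ S (k + 1) := .lolli (.all (.lolli (ρ.ap (.var 0)) (.var 1))) (.var 0)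
  let C' : Typ S k := .lolli (.all (.lolli (ρ.ap (.var 0)) (B.ren (up 1)))) B
  have env0 : EnvOk (nil : Fin 0 → Typ S 0) Γ (nil : Fin 0 → Typ S k) nil := .nil
  have env1 := env0.ty A
  have hy' : HasType Γ allIntu y (ρ.sub (cons A nil)) := by rwa [Ty.sub_eq_ap]
  have h1 := PEq.tbeta_env (T := T) (Θ := Θ) (τ' := .lolli (ρ.ap A) (.all C)) hp env0 A (by
    simp only [Ty.sub, Ty.ap_sub, Ty.sub_eq_ap]; rfl)
  have h2 := PEq.beta_env (T := T) (Θ := Θ) (τ' := .all C) hp.tlam_inv env1 hy' (by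
    simp only [Ty.sub, Ty.ap_sub]; rfl)
  have h3 := PEq.tbeta_env (T := T) (Θ := Θ) (τ' := C') hp1 (env1.cons hy') B (by
    simp only [Ty.sub, Ty.ap_sub]; rfl)
  have h4 := PEq.beta_env (T := T) (Θ := Θ) (s := g) (τ' := B) hp1.tlam_inv
    ((env1.cons hy').ty B) (by simp only [Ty.sub, Ty.ap_sub]; exact hg) rfl
  rw [← Tm.wk0_eq_sub] at h1
  exact (PEq.app .nil ((PEq.tapp .nil ((PEq.app .nil h1 (.refl .nil hy)).trans h2) B
    (coprod_inst ρ B)).trans h3) (.refl .nil hg)).trans h4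

theorem PEq.unfold_beta (hf : HasType Γ allIntu f (.lolli A (σ.ap A)))
    (hx : HasType Γ allIntu x A) :
    PEq T Γ Θ [] ((nu σ).wk0 k) (.app (unf σ A f) x)
      (.app (.tapp ((pack (coalgTy σ)).wk0 k n) A) (.tensor (.bang f) x)) := by
  have hp := HasType.unfold σ
  have hp1 := hp.tlam_inv.lam_inv
  have env0 : EnvOk (nil : Fin 0 → Typ S 0) Γ (nil : Fin 0 → Typ S k) nil := .nil
  have env1 := env0.ty A
  have eC : (Ty.lolli (.var 0) σ).sub (cons A nil) = .lolli A (σ.ap A) := by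
    simp only [Ty.sub, Ty.sub_eq_ap]; rfl
  have eN : (Ty.lolli (.var 0) ((nu σ).wk0 1)).sub (cons A nil) = .lolli A ((nu σ).wk0 k) := by
    simp only [Ty.sub, Ty.wk0_sub]; rfl
  have hf' : HasType Γ allIntu (.bang f) (.bang ((Ty.lolli (.var 0) σ).sub (cons A nil))) := by
    rw [eC]; exact .bang_intu hf
  have h1 := PEq.tbeta_env (T := T) (Θ := Θ) hp env0 A (congrArg (Ty.lolli _) eN)
  have h2 := PEq.beta_env (T := T) (Θ := Θ) hp.tlam_inv env1 hf' eN
  have h3 := PEq.beta_env (T := T) (Θ := Θ) (s := x) hp1 (env1.cons hf') hx (Ty.wk0_sub ..)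
  rw [← Tm.wk0_eq_sub] at h1
  have h12 := (PEq.app .nil h1 (.refl .nil hf')).trans h2
  have h := (PEq.app .nil h12 (.refl .nil hx)).trans h3
  simp only [Tm.sub, Tm.wk0_sub] at h
  exact h

theorem PEq.out_beta (hPos : σ.OnlyPositive 0) (hx : HasType Γ allIntu x ((nu σ).wk0 k)) :
    PEq T Γ Θ [] (σ.ap ((nu σ).wk0 k)) (.app ((out σ).wk0 k n) x)
      (.app (.tapp x (σ.ap ((nu σ).wk0 k))) ((outStep σ).wk0 k n)) := by
  have env0 : EnvOk (nil : Fin 0 → Typ S 0) Γ (nil : Fin 0 → Typ S k) nil := .nil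
  have h := PEq.beta_env (T := T) (Θ := Θ) (s := x) (HasType.out hPos) env0
    (by rwa [Ty.wk0_eq_sub]) (τ' := σ.ap ((nu σ).wk0 k)) (by rw [Ty.ap_sub, Ty.wk0_eq_sub])
  rw [← Tm.wk0_eq_sub] at h
  have e : (σ.ap (nu σ)).sub nil = σ.ap ((nu σ).wk0 k) := by rw [Ty.ap_sub, Ty.wk0_eq_sub]
  simp only [Tm.sub, Tm.wk0_sub, e] at h
  exact h

theorem PEq.fmap_beta (hPos : σ.OnlyPositive 0) (hh : HasType Γ allIntu h (.lolli A B)) :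
    PEq T Γ Θ [] (.lolli (σ.ap A) (σ.ap B)) (fmap σ A B h)
      (act σ (fun _ => A) (fun _ => B) (fun _ => h)) := by
  have hp := HasType.functorTm hPos
  have env0 : EnvOk (nil : Fin 0 → Typ S 0) Γ (nil : Fin 0 → Typ S k) nil := .nil
  have env2 := (env0.ty A).ty B
  have hp3 := hp.tlam_inv.tlam_inv.lam_inv
  have h1 := PEq.tbeta_env (T := T) (Θ := Θ) hp env0 A (τ' := .all (.lolli (.bang (.lolli
    (A.ren (up 1)) (.var 0))) (.lolli (σ.ap (A.ren (up 1))) (σ.ap (.var 0))))) (by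
      simp only [Ty.sub, Ty.ap_sub]; rfl)
  have h2 := PEq.tbeta_env (T := T) (Θ := Θ) (τ' := .lolli (.bang (.lolli A B))
    (.lolli (σ.ap A) (σ.ap B))) hp.tlam_inv (env0.ty A) B (by
      simp only [Ty.sub, Ty.ap_sub]; rfl)
  have hb := hh.bang_intu
  have h3 := PEq.beta_env (T := T) (Θ := Θ) (s := .bang h) (τ' := .lolli (σ.ap A) (σ.ap B))
    hp.tlam_inv.tlam_inv env2 hb (by simp only [Ty.sub, Ty.ap_sub]; rfl)
  have h4 := PEq.beta_bang_env (T := T) (Θ := Θ) (x := h) (τ' := .lolli (σ.ap A) (σ.ap B))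
    hp3 (env2.cons hb) hh rfl (by simp only [Ty.sub, Ty.ap_sub]; rfl)
  rw [← Tm.wk0_eq_sub] at h1
  have h12 := (PEq.tapp .nil h1 B (by
    simp only [Ty.inst, Ty.sub, Ty.ap_sub, Ty.ren_sub, up_one, cons_succ, Ty.sub_var]
    rfl)).trans h2
  have h' := ((PEq.app .nil h12 (.refl .nil hb)).trans h3).trans h4
  simp only [act_sub] at h'
  exact h'

theorem PEq.outStep_beta (hPos : σ.OnlyPositive 0)
    (hf : HasType Γ allIntu f (.lolli A (σ.ap A))) (hx : HasType Γ allIntu x A) :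
    PEq T Γ Θ [] (σ.ap ((nu σ).wk0 k))
      (.app (.tapp ((outStep σ).wk0 k n) A) (.tensor (.bang f) x))
      (.app (fmap σ A ((nu σ).wk0 k) (unf σ A f)) (.app f x)) := by
  have hp := HasType.outStep hPos
  have env0 : EnvOk (nil : Fin 0 → Typ S 0) Γ (nil : Fin 0 → Typ S k) nil := .nil
  have env1 := env0.ty A
  have eC : (Ty.lolli (.var 0) σ).sub (cons A nil) = .lolli A (σ.ap A) := by
    simp only [Ty.sub, Ty.sub_eq_ap]; rfl
  have eN : (σ.ap ((nu σ).wk0 1)).sub (cons A nil) = σ.ap ((nu σ).wk0 k) := by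
    rw [Ty.ap_sub, Ty.wk0_sub]
  have hf1 : HasType Γ allIntu f ((Ty.lolli (.var 0) σ).sub (cons A nil)) := by rwa [eC]
  have hfx : HasType Γ allIntu (.tensor (.bang f) x) ((coalgTy σ).sub (cons A nil)) :=
    .tensor_intu hf1.bang_intu hx
  have h1 := PEq.tbeta_env (T := T) (Θ := Θ) hp env0 A (congrArg (Ty.lolli _) eN)
  have h2 := PEq.beta_env (T := T) (Θ := Θ) hp.tlam_inv env1 hfx eN
  have hp2 := hp.tlam_inv.lam_inv
  have h3 := PEq.beta_tensor_env (T := T) (Θ := Θ) hp2 (env1.cons hfx) hf1.bang_intu hx rfl eN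
  rw [← Tm.wk0_eq_sub] at h1
  have h12 := (PEq.app .nil h1 (.refl .nil hfx)).trans (h2.trans h3)
  cases hp2 with
  | letTensor _ _ hp3 =>
    have h4 := PEq.beta_bang_env (T := T) (Θ := Θ) hp3
      ((((env1.cons hfx)).cons hf1.bang_intu).cons hx) hf1 rfl eN
    have h := h12.trans h4
    simp only [Tm.sub, fmap_sub, Tm.wk0_sub, Ty.wk0_sub] at h
    exact h

/-- `unfold A !f` is a map of coalgebras from `f` to `out`. -/
theorem PEq.out_unf (hExt : Extensionality T) (hPos : σ.OnlyPositive 0)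
    (hf : HasType Γ allIntu f (.lolli A (σ.ap A))) :
    PEq T Γ Θ [] (.lolli A (σ.ap ((nu σ).wk0 k)))
      (Tm.comp A ((out σ).wk0 k n) (unf σ A f))
      (Tm.comp A (fmap σ A ((nu σ).wk0 k) (unf σ A f)) f) := by
  have hd : ∀ {n : ℕ}, NoLin (allIntu : Fin n → Mode) := noLin_allIntu
  have hu := HasType.unf hd hf
  have ho := HasType.out_wk0 (Γ := Γ) (k := k) hPos hd
  have hm := HasType.fmap hPos hd hu
  have key : ∀ {n : ℕ} {Γ : Fin n → Typ S k} {f x : Tm S k n},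
      HasType Γ allIntu f (.lolli A (σ.ap A)) → HasType Γ allIntu x A →
      PEq T Γ Θ [] (σ.ap ((nu σ).wk0 k)) (.app (Tm.comp A ((out σ).wk0 k n) (unf σ A f)) x)
        (.app (Tm.comp A (fmap σ A ((nu σ).wk0 k) (unf σ A f)) f) x) := by
    intro n Γ f x hf hx
    have hu := HasType.unf hd hf
    have ho := HasType.out_wk0 (Γ := Γ) (k := k) hPos hd
    have hm := HasType.fmap hPos hd hu
    have hr := HasType.outStep_wk0 (Γ := Γ) (k := k) hPos hd
    have hc : HasType Γ allIntu (.tensor (.bang f) x) ((coalgTy σ).ap A) :=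
      .tensor_intu hf.bang_intu hx
    have h1 := PEq.beta_comp (T := T) (Θ := Θ) .nil ho hu hx
    have h2 := PEq.out_beta (T := T) (Θ := Θ) hPos (.app_intu hu hx)
    have h3 := PEq.unfold_beta (T := T) (Θ := Θ) hf hx
    rw [nu, coprod_wk0] at h3
    have h4 := PEq.app .nil (PEq.tapp .nil h3 (σ.ap ((nu σ).wk0 k)) (coprod_inst _ _))
      (.refl .nil hr)
    have h5 := PEq.pack_beta (T := T) (Θ := Θ) hc hr
    exact (h1.trans (h2.trans (h4.trans (h5.trans (.outStep_beta hPos hf hx))))).trans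
      (PEq.beta_comp .nil hm hf hx).symm
  have hk := key (hf.wk_tm A) (x := .var 0) (.var_intu 0 rfl)
  refine .funext hExt (ho.comp_intu hu) (hm.comp_intu hf) ?_
  have e1 : (Tm.comp A ((out σ).wk0 k n) (unf σ A f)).wk 0 1 =
      Tm.comp A ((out σ).wk0 k (n + 1)) (unf σ A (f.wk 0 1)) := by
    rw [Tm.comp_wk, unf_wk, Tm.wk, Tm.wk0_ren]; rfl
  have e2 : (Tm.comp A (fmap σ A ((nu σ).wk0 k) (unf σ A f)) f).wk 0 1 =
      Tm.comp A (fmap σ A ((nu σ).wk0 k) (unf σ A (f.wk 0 1))) (f.wk 0 1) := by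
    rw [Tm.comp_wk, fmap_wk, unf_wk]
  rwa [e1, e2]

end Computation

/-! ## Naturality of `unfold` -/

section Naturality

variable {S : Sig.{u, v}} {T : Set (Form S 0 0 0)} {k n m : ℕ}
  {Γ : Fin n → Typ S k} {Θ : Fin m → RelDecl S k} {σ : Typ S 1} {A B : Typ S k}
  {f g h x z : Tm S k n}

/-- The types `A`, `να.σ(α)` and `σ(A)`. -/
abbrev paramTy (σ : Typ S 1) (A : Typ S k) : Fin 3 → Typ S k :=
  cons A (cons ((nu σ).wk0 k) (cons (σ.ap A) nil))

/-- The graph of `h`, and the equality relations on `A`, `να.σ(α)` and `σ(A)`. -/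
abbrev graphEnv (σ : Typ S 1) (A B : Typ S k) (h : Tm S k n) : Fin 4 → Rel S k n m :=
  cons (Rel.graph A B h) fun i => Rel.eqRel (paramTy σ A i)

theorem StabAdm.graphEnv (hh : HasType Γ allIntu h (.lolli A B)) (i : Fin 4) :
    StabAdm T Γ Θ (LAPL.graphEnv σ A B h i) ((cons A (paramTy σ A) : Fin 4 → Typ S k) i)
      ((cons B (paramTy σ A) : Fin 4 → Typ S k) i) :=
  Fin.cases (.graph hh) (fun _ => .eqRel _) i

theorem graphEnv_wk (i : Fin 4) :
    (graphEnv σ A B h i : Rel S k n m).wk 0 2 0 = graphEnv σ A B (h.wk 0 2) i := by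
  refine Fin.cases ?_ (fun i => ?_) i
  · simp only [graphEnv, cons_zero, Rel.wk, Rel.graph_ren, up_zero, Ty.ren_id]; rfl
  · simp only [graphEnv, cons_succ, Rel.wk, Rel.eqRel_ren, up_zero, Ty.ren_id]

/-- The instantiation at the graph of `h` of the parametricity of a polymorphic term. -/
theorem Prov.interp_graphEnv (hId : IdentityExtension T) {P : Typ S 4} {t : Tm S k n}
    (hh : HasType Γ allIntu h (.lolli A B))
    (ht : HasType Γ allIntu t ((Ty.all P).sub (paramTy σ A))) :
    Prov T Γ Θ [] (.rel (.interp 4 P (graphEnv σ A B h)) (.tapp t A) (.tapp t B)) :=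
  Prov.interp_all_elim .nil (fun i => .eqRel (paramTy σ A i)) ht ht
    (Prov.interp_eqRel hId (.all P) (paramTy σ A) ht) (.graph hh)

theorem Prov.graphEnv_zero {Φ : List (Form S k n m)} (hΦ : WfHyps T Γ Θ Φ)
    (hh : HasType Γ allIntu h (.lolli A B)) (hx : HasType Γ allIntu x A)
    (hz : HasType Γ allIntu z B) :
    Prov T Γ Θ Φ (.rel (.interp 4 (.var 0) (graphEnv σ A B h)) x z) ↔
      PEq T Γ Θ Φ B (.app h x) z :=
  (Prov.interp_var_iff hΦ (.graphEnv hh) 0 hx hz).trans (Prov.graph_iff hΦ hh hx hz)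

theorem Prov.graphEnv_succ {Φ : List (Form S k n m)} (hΦ : WfHyps T Γ Θ Φ)
    (hh : HasType Γ allIntu h (.lolli A B)) (i : Fin 3)
    (hx : HasType Γ allIntu x (paramTy σ A i)) (hz : HasType Γ allIntu z (paramTy σ A i)) :
    Prov T Γ Θ Φ (.rel (.interp 4 (.var i.succ) (graphEnv σ A B h)) x z) ↔
      PEq T Γ Θ Φ (paramTy σ A i) x z :=
  (Prov.interp_var_iff hΦ (.graphEnv hh) i.succ hx hz).trans (Prov.eqRel_iff hΦ hx hz)

/-- The relational interpretation of `σ` at the graph of `h` contains the graph of `σ(h)`. -/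
theorem Prov.fmap_graph (hExt : Extensionality T) (hId : IdentityExtension T)
    (hPos : σ.OnlyPositive 0) (hh : HasType Γ allIntu h (.lolli A B))
    (hz : HasType Γ allIntu z (σ.ap A)) :
    Prov T Γ Θ [] (.rel (.interp 4 (σ.ap (.var 0)) (graphEnv σ A B h)) z
      (.app (fmap σ A B h) z)) := by
  have hid := HasType.idTm (Γ := Γ) noLin_allIntu A
  have hρ := StabAdm.graphEnv (T := T) (Θ := Θ) (σ := σ) hh
  have hM : HasType Γ allIntu (.tapp ((functorTm σ).wk0 k n) A)
      ((Ty.all (.lolli (.bang (.lolli (.var 1) (.var 0))) (.lolli (.var 3)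
        (σ.ap (.var 0))))).sub (paramTy σ A)) := by
    refine .tapp_eq A ((HasType.functorTm hPos).wk0 noLin_allIntu) ?_
    have e : Ty.lift (paramTy σ A) 3 = σ.ap (A.ren (up 1)) := Ty.ap_ren ..
    simp only [Ty.inst, Ty.ren, Ty.sub, Ty.ap_ren, Ty.ap_sub, e]; rfl
  have hMX : ∀ X : Typ S k, HasType Γ allIntu (.tapp (.tapp ((functorTm σ).wk0 k n) A) X)
      ((Ty.lolli (.bang (.lolli (.var 1) (.var 0))) (.lolli (.var 3) (σ.ap (.var 0)))).sub
        (cons X (paramTy σ A))) := by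
    intro X
    refine .tapp_eq X hM ?_
    rw [Ty.inst, Ty.sub_sub]
    congr 1; funext i
    exact Fin.cases rfl (fun i => Ty.ren_succ_inst _ _) i
  have h1 := Prov.interp_graphEnv (Θ := Θ) hId hh hM
  have hb : Prov T Γ Θ [] (.rel (.interp 4 (.lolli (.var 1) (.var 0)) (graphEnv σ A B h))
      (Tm.idTm A) h) := by
    refine .interp_lolli_intro hρ hid hh ?_
    simp only [graphEnv_wk]
    have hh' := hh.wk_tm_two A A
    have hx : HasType (cons A (cons A Γ)) allIntu (Tm.var 1) A := .var_intu 1 rfl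
    have hy : HasType (cons A (cons A Γ)) allIntu (Tm.var 0) A := .var_intu 0 rfl
    have hΦ : WfHyps T (cons A (cons A Γ)) Θ
        [.rel (.interp 4 (.var 1) (graphEnv σ A B (h.wk 0 2))) (.var 1) (.var 0)] :=
      .singleton (.rel (StabAdm.interp (.var 1) (.graphEnv hh')).stabRel.isRel hx hy)
    have hxy := (Prov.graphEnv_succ hΦ hh' 0 hx hy).1
      (Prov.hyp hΦ (List.mem_singleton_self _))
    have hix := PEq.beta_idTm (T := T) (Θ := Θ) hΦ hx
    rw [Tm.idTm_wk]
    exact (Prov.graphEnv_zero hΦ hh' hix.left (.app_intu hh' hy)).2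
      (.app hΦ (.refl hΦ hh') (hix.trans hxy))
  have eap : ∀ X : Typ S k, (σ.ap (.var 0)).sub (cons X (paramTy σ A)) = σ.ap X :=
    fun X => Ty.ap_sub ..
  have h2 := Prov.interp_lolli_elim .nil hρ (hMX A) (hMX B) h1 hid.bang_intu hh.bang_intu
    (.interp_bang_intro hρ hid hh hb)
  have h3 := Prov.interp_lolli_elim .nil hρ ((HasType.app_intu (hMX A) hid.bang_intu))
    ((HasType.app_intu (hMX B) hh.bang_intu)) h2 hz hz
    ((Prov.graphEnv_succ .nil hh 2 hz hz).2 (.refl .nil hz))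
  have hfh := HasType.fmap hPos noLin_allIntu hh
  have e1 := (PEq.app .nil (PEq.fmap_beta (T := T) (Θ := Θ) hPos hid) (.refl .nil hz)).trans
    ((PEq.app .nil (PEq.actId hExt hId σ fun _ => A) (.refl .nil hz)).trans
      (.beta_idTm .nil hz))
  refine PEq.rel .nil (StabAdm.interp (σ.ap (.var 0)) hρ).stabRel.isRel ?_ ?_ h3
  · rw [eap]; exact e1
  · rw [eap]; exact .refl .nil (.app_intu hfh hz)

/-- A map of coalgebras commutes with the maps to the coinductive type. -/
theorem PEq.unf_natural (hExt : Extensionality T) (hId : IdentityExtension T)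
    (hPos : σ.OnlyPositive 0) (hf : HasType Γ allIntu f (.lolli A (σ.ap A)))
    (hg : HasType Γ allIntu g (.lolli B (σ.ap B))) (hh : HasType Γ allIntu h (.lolli A B))
    (hc : PEq T Γ Θ [] (.lolli A (σ.ap B)) (Tm.comp A g h) (Tm.comp A (fmap σ A B h) f))
    (hx : HasType Γ allIntu x A) :
    PEq T Γ Θ [] ((nu σ).wk0 k) (.app (unf σ A f) x) (.app (unf σ B g) (.app h x)) := by
  have hρ := StabAdm.graphEnv (T := T) (Θ := Θ) (σ := σ) hh
  let P : Typ S 4 := .lolli (.bang (.lolli (.var 0) (σ.ap (.var 0)))) (.lolli (.var 0) (.var 2))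
  have hU : HasType Γ allIntu ((unfold σ).wk0 k n) ((Ty.all P).sub (paramTy σ A)) := by
    have := (HasType.unfold σ).wk0 (Γ := Γ) (k := k) noLin_allIntu
    have e : Ty.lift (paramTy σ A) 2 = (nu σ).wk0 (k + 1) := Ty.wk0_ren ..
    rw [Ty.wk0, Ty.ren, Ty.ren, Ty.ren, Ty.ren, Ty.ren, Ty.ren, Ty.wk0_ren, Ty.ren_eq_ap σ]
      at this
    simp only [P, Ty.sub, Ty.ap_sub, e]
    exact this
  have hUX : ∀ X : Typ S k, HasType Γ allIntu (.tapp ((unfold σ).wk0 k n) X)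
      (P.sub (cons X (paramTy σ A))) := by
    intro X
    refine .tapp_eq X hU ?_
    rw [Ty.inst, Ty.sub_sub]
    congr 1; funext i
    exact Fin.cases rfl (fun i => Ty.ren_succ_inst _ _) i
  have eap : ∀ X : Typ S k, (Ty.lolli (.var 0) (σ.ap (.var 0))).sub (cons X (paramTy σ A)) =
      .lolli X (σ.ap X) := fun X => by rw [Ty.sub, Ty.ap_sub]; rfl
  have h1 := Prov.interp_graphEnv (Θ := Θ) hId hh hU
  have hf' : HasType Γ allIntu f ((Ty.lolli (.var 0) (σ.ap (.var 0))).sub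
    (cons A (paramTy σ A))) := by rwa [eap]
  have hg' : HasType Γ allIntu g ((Ty.lolli (.var 0) (σ.ap (.var 0))).sub
    (cons B (paramTy σ A))) := by rwa [eap]
  have hb : Prov T Γ Θ [] (.rel (.interp 4 (.lolli (.var 0) (σ.ap (.var 0)))
      (graphEnv σ A B h)) f g) := by
    refine .interp_lolli_intro hρ hf' hg' ?_
    simp only [graphEnv_wk]
    have hf2 := hf.wk_tm_two A B
    have hg2 := hg.wk_tm_two A B
    have hh2 := hh.wk_tm_two A B
    have hx2 : HasType (cons B (cons A Γ)) allIntu (Tm.var 1) A := .var_intu 1 rfl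
    have hy2 : HasType (cons B (cons A Γ)) allIntu (Tm.var 0) B := .var_intu 0 rfl
    have hΦ : WfHyps T (cons B (cons A Γ)) Θ
        [.rel (.interp 4 (.var 0) (graphEnv σ A B (h.wk 0 2))) (.var 1) (.var 0)] :=
      .singleton (.rel (StabAdm.interp (.var 0) (.graphEnv hh2)).stabRel.isRel hx2 hy2)
    have hxy := (Prov.graphEnv_zero hΦ hh2 hx2 hy2).1
      (Prov.hyp hΦ (List.mem_singleton_self _))
    have hfx := hf2.app_intu hx2
    have hm2 := HasType.fmap hPos noLin_allIntu hh2
    have hc2 := hc.ren (CxRen.tm_two A B)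
    simp only [up_zero, Ty.ren_id] at hc2
    change PEq T _ _ _ _ ((Tm.comp A g h).wk 0 2) ((Tm.comp A (fmap σ A B h) f).wk 0 2) at hc2
    rw [Tm.comp_wk, Tm.comp_wk, fmap_wk] at hc2
    have e := ((PEq.beta_comp .nil hm2 hf2 hx2).symm.trans
      ((PEq.app .nil hc2 (.refl .nil hx2)).symm.trans (.beta_comp .nil hg2 hh2 hx2)))
    have e' := (e.wkHyps hΦ).trans (.app hΦ (.refl hΦ hg2) hxy)
    have eap : ∀ X : Typ S k, (σ.ap (.var 0)).sub (cons X (paramTy σ A)) = σ.ap X :=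
      fun X => Ty.ap_sub ..
    refine PEq.rel hΦ (StabAdm.interp (σ.ap (.var 0)) (.graphEnv hh2)).stabRel.isRel ?_ ?_
      ((Prov.fmap_graph hExt hId hPos hh2 hfx).wkHyps hΦ)
    · rw [eap]; exact .refl hΦ hfx
    · rw [eap]; exact e'
  have h2 := Prov.interp_lolli_elim .nil hρ (hUX A) (hUX B) h1 hf'.bang_intu hg'.bang_intu
    (.interp_bang_intro hρ hf' hg' hb)
  have hhx := hh.app_intu hx
  have h3 := Prov.interp_lolli_elim .nil hρ ((HasType.app_intu (hUX A) hf'.bang_intu))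
    ((HasType.app_intu (hUX B) hg'.bang_intu)) h2 hx hhx
    ((Prov.graphEnv_zero .nil hh hx hhx).2 (.refl .nil hhx))
  exact (Prov.graphEnv_succ .nil hh 1 (.app_intu (.unf noLin_allIntu hf) hx)
    (.app_intu (.unf noLin_allIntu hg) hhx)).1 h3

end Naturality

/-! ## Elements of existential types -/

section Coproduct

variable {S : Sig.{u, v}} {T : Set (Form S 0 0 0)} {k n m : ℕ}
  {Γ : Fin n → Typ S k} {Θ : Fin m → RelDecl S k} {σ ρ : Typ S 1} {A B : Typ S k}
  {p q κ x : Tm S k n}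

/-- The type `Πα.(ρ(α) ⊸ A)`. -/
abbrev coconeTy (ρ : Typ S 1) (A : Typ S k) : Typ S k :=
  .all (.lolli (ρ.ap (.var 0)) (A.ren (up 1)))

theorem HasType.cocone_tapp (hp : HasType Γ allIntu p (coconeTy ρ A)) (C : Typ S k) :
    HasType Γ allIntu (.tapp p C) (.lolli (ρ.ap C) A) := by
  refine .tapp_eq C hp ?_
  simp only [Ty.inst, Ty.sub, Ty.ap_sub, Ty.ren_sub, up_one, cons_succ, Ty.sub_var]; rfl

theorem HasType.cocone_wk_poly (hp : HasType Γ allIntu p (coconeTy ρ A)) :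
    HasType (polyCx Γ) allIntu (p.wk 2 0) (coconeTy ρ (A.ren (up 2))) := by
  have := hp.wk_poly
  simp only [Ty.ren, Ty.ap_ren, Ty.ren_ren] at this
  simp only [coconeTy, Ty.ren_ren]
  exact this

theorem PEq.tbeta_wk (hp : HasType Γ allIntu p (coconeTy ρ A)) (C : Typ S k) :
    PEq T Γ Θ [] (coconeTy ρ A) (.tapp (.tlam (p.wk 1 0)) C) p := by
  have e : (p.wk 1 0).tinst C = p := Tm.wk_tinst _ _
  have h := PEq.tbeta (T := T) (Θ := Θ) .nil hp.wk_ty C (Ty.ren_succ_inst _ _)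
  rwa [e] at h

/-- Elements of `∐α.ρ` are natural with respect to the maps out of the codomain of a cocone. -/
theorem PEq.coprod_natural (hId : IdentityExtension T)
    (hp : HasType Γ allIntu p (coconeTy ρ A)) (hq : HasType Γ allIntu q (coconeTy ρ B))
    (hκ : HasType Γ allIntu κ (.lolli A B)) (hx : HasType Γ allIntu x ((coprod ρ).wk0 k))
    (hc : PEq T (wkCx Γ 1) (wkRCx Θ 1) [] (.lolli (ρ.ap (.var 0)) (B.ren (up 1)))
      (.tapp (q.wk 1 0) (.var 0))
      (Tm.comp (ρ.ap (.var 0)) (κ.wk 1 0) (.tapp (p.wk 1 0) (.var 0)))) :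
    PEq T Γ Θ [] B (.app κ (.app (.tapp x A) p)) (.app (.tapp x B) q) := by
  let E : Fin 2 → Rel S k n m := cons (Rel.graph A B κ) fun _ => Rel.eqRel A
  let τs : Fin 2 → Typ S k := cons A fun _ => A
  let τs' : Fin 2 → Typ S k := cons B fun _ => A
  have hE : ∀ i, StabAdm T Γ Θ (E i) (τs i) (τs' i) :=
    fun i => Fin.cases (.graph hκ) (fun _ => .eqRel A) i
  let P : Typ S 3 := .lolli (ρ.ap (.var 0)) (.var 2)
  let Q : Typ S 3 := .lolli (ρ.ap (.var 0)) (.var 1)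
  have hpP : ∀ C : Typ S k, (Ty.all P).sub (cons C fun _ => A) = coconeTy ρ A := fun C => by
    simp only [P, Ty.sub, Ty.ap_sub]; rfl
  have hpQ : ∀ C : Typ S k, (Ty.all Q).sub (cons C fun _ => A) = coconeTy ρ C := fun C => by
    simp only [Q, Ty.sub, Ty.ap_sub]; rfl
  have hpad : HasType Γ allIntu (.tlam (p.wk 1 0)) ((Ty.all (.all P)).sub fun _ : Fin 1 => A) := by
    refine .tlam ?_
    have := hp.wk_ty
    simp only [Ty.ren, Ty.ap_ren, Ty.ren_ren] at this
    have e : Ty.lift (Ty.lift fun _ : Fin 1 => A) 2 = (A.ren (up 1)).ren (up 1) := rfl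
    simp only [P, Ty.sub, Ty.ap_sub, e, Ty.ren_ren]
    exact this
  have h1 := Prov.interp_all_elim .nil (fun _ => .eqRel A) hpad hpad
    (Prov.interp_eqRel (Θ := Θ) hId (.all (.all P)) (fun _ => A) hpad) (.graph hκ)
  have h2 : Prov T Γ Θ [] (.rel (.interp 2 (.all P) E) p p) := by
    refine PEq.rel .nil (StabAdm.interp (.all P) hE).stabRel.isRel ?_ ?_ h1
    · rw [hpP]; exact .tbeta_wk hp A
    · rw [hpP]; exact .tbeta_wk hp B
  have hE2 : ∀ i, StabAdm T (polyCx Γ) (polyRCx Θ) ((E i).wk 2 0 1) ((τs i).ren (up 2))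
    ((τs' i).ren (up 2)) := fun i => (hE i).ren (CxRen.poly true)
  have hp2 := hp.cocone_wk_poly
  have hq2 := hq.cocone_wk_poly
  have hpP2 : ∀ C : Typ S k, HasType (polyCx Γ) allIntu (p.wk 2 0)
      ((Ty.all P).sub fun i => ((cons C fun _ => A : Fin 2 → Typ S k) i).ren (up 2)) :=
    fun C => by rw [← Ty.sub_ren, hpP]; exact hp.wk_poly
  have h3 := Prov.interp_all_elim (T := T) (Γ := polyCx Γ) (Θ := polyRCx Θ) (σ := P) .nil hE2
    (t := p.wk 2 0) (s := p.wk 2 0) (hpP2 _) (hpP2 _) (h2.ren (CxRen.poly true))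
    (R := .var 0) (A := .var 1) (B := .var 0) (.var 0 rfl)
  have hqq : Prov T Γ Θ [] (.rel (.interp 2 (.all Q) E) p q) := by
    refine .interp_all_intro hE (by rw [hpQ]; exact hp) (by rw [hpQ]; exact hq) ?_
    refine .interp_lolli_intro (StabAdm.poly hE) ?_ ?_ ?_
    · have := hp2.cocone_tapp (.var 1)
      simp only [Q, Ty.sub, Ty.ap_sub]
      exact this
    · have := hq2.cocone_tapp (.var 0)
      simp only [Q, Ty.sub, Ty.ap_sub]
      exact this
    · rw [Ty.ap_sub, Ty.ap_sub]
      have hE4 := fun i => (StabAdm.poly hE i).wk_tm_two (ρ.ap (.var 1)) (ρ.ap (.var 0))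
      have hy : HasType (cons (ρ.ap (.var 0)) (cons (ρ.ap (.var 1)) (polyCx Γ))) allIntu
        (Tm.var 1) (ρ.ap (.var 1)) := .var_intu 1 rfl
      have hz : HasType (cons (ρ.ap (.var 0)) (cons (ρ.ap (.var 1)) (polyCx Γ))) allIntu
        (Tm.var 0) (ρ.ap (.var 0)) := .var_intu 0 rfl
      have eap : ∀ (C : Typ S (k + 2)) (r : Fin 2 → Typ S (k + 2)),
        (ρ.ap (.var 0)).sub (cons C r) = ρ.ap C := fun C r => Ty.ap_sub ..
      have hp4 : ∀ C, HasType (cons (ρ.ap (.var 0)) (cons (ρ.ap (.var 1)) (polyCx Γ))) allIntu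
        ((Tm.tapp (p.wk 2 0) C).wk 0 2) (.lolli (ρ.ap C) (A.ren (up 2))) :=
        fun C => (hp2.cocone_tapp C).wk_tm_two _ _
      have hq4 := (hq2.cocone_tapp (.var 0)).wk_tm_two (ρ.ap (.var 1)) (ρ.ap (.var 0))
      have hκ4 : HasType (cons (ρ.ap (.var 0)) (cons (ρ.ap (.var 1)) (polyCx Γ))) allIntu
        ((κ.wk 2 0).wk 0 2) (.lolli (A.ren (up 2)) (B.ren (up 2))) := hκ.wk_poly.wk_tm_two _ _
      have hΦ : WfHyps T (cons (ρ.ap (.var 0)) (cons (ρ.ap (.var 1)) (polyCx Γ))) (polyRCx Θ)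
          [.rel (.interp 3 (ρ.ap (.var 0)) fun i =>
            ((cons (.var 0) fun i => (E i).wk 2 0 1 : Fin 3 → _) i).wk 0 2 0)
              (.var 1) (.var 0)] :=
        .singleton (.rel (StabAdm.interp (ρ.ap (.var 0)) hE4).stabRel.isRel
          (by rw [eap]; exact hy) (by rw [eap]; exact hz))
      have hpe : ∀ C r, r 1 = A.ren (up 2) →
          HasType (cons (ρ.ap (.var 0)) (cons (ρ.ap (.var 1)) (polyCx Γ))) allIntu
            ((Tm.tapp (p.wk 2 0) C).wk 0 2) (P.sub (cons C r)) := fun C r h => by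
        have := hp4 C
        simp only [P, Ty.sub, Ty.ap_sub]
        rw [← h] at this; exact this
      have h6 := Prov.interp_lolli_elim hΦ hE4 (hpe _ _ rfl) (hpe _ _ rfl)
        ((h3.ren (CxRen.tm_two _ _)).wkHyps hΦ) (by rw [eap]; exact hy) (by rw [eap]; exact hz)
        (Prov.hyp hΦ (List.mem_singleton_self _))
      have h7 := (Prov.interp_var_iff hΦ hE4 2 (.app_intu (hp4 _) hy) (.app_intu (hp4 _) hz)).1 h6
      have e2 : ((Rel.eqRel A : Rel S k n m).wk 2 0 1).wk 0 2 0 = Rel.eqRel (A.ren (up 2)) := by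
        rw [Rel.wk, Rel.wk, Rel.eqRel_ren, Rel.eqRel_ren, up_zero, Ty.ren_id]
      have e1 : ((Rel.graph A B κ : Rel S k n m).wk 2 0 1).wk 0 2 0 =
          Rel.graph (A.ren (up 2)) (B.ren (up 2)) ((κ.wk 2 0).wk 0 2) := by
        rw [Rel.wk, Rel.wk, Rel.graph_ren, Rel.graph_ren, up_zero, Ty.ren_id, Ty.ren_id]; rfl
      have h8 := (Prov.eqRel_iff hΦ (.app_intu (hp4 _) hy) (.app_intu (hp4 _) hz)).1
        (by rw [← e2]; exact h7)
      have h9 := ((hc.ren (CxRen.lift_ty CxRen.ty_one)).ren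
        (CxRen.rel_one ⟨true, .var 1, .var 0⟩)).ren (CxRen.tm_two (ρ.ap (.var 1)) (ρ.ap (.var 0)))
      have h10 : PEq T (cons (ρ.ap (.var 0)) (cons (ρ.ap (.var 1)) (polyCx Γ))) (polyRCx Θ) []
          (.lolli (ρ.ap (.var 0)) (B.ren (up 2))) ((Tm.tapp (q.wk 2 0) (.var 0)).wk 0 2)
          (Tm.comp (ρ.ap (.var 0)) ((κ.wk 2 0).wk 0 2) ((Tm.tapp (p.wk 2 0) (.var 0)).wk 0 2)) := by
        rw [← Tm.comp_wk]
        convert h9 using 1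
        · simp only [Ty.ren, Ty.ap_ren, Ty.ren_ren]; rfl
        · simp only [Tm.wk, Tm.ren, Tm.ren_ren]; rfl
        · simp only [Tm.comp, Tm.wk, Tm.ren, Tm.ren_ren, Ty.ap_ren]; rfl
      have h11 := (PEq.app .nil h10 (.refl .nil hz)).trans (.beta_comp .nil hκ4 (hp4 _) hz)
      refine (Prov.interp_var_iff hΦ hE4 1 (.app_intu (hp4 _) hy) (.app_intu hq4 hz)).2 ?_
      have h12 := (Prov.graph_iff hΦ hκ4 (.app_intu (hp4 _) hy) (.app_intu hq4 hz)).2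
        ((PEq.app hΦ (.refl hΦ hκ4) h8).trans (h11.symm.wkHyps hΦ))
      rw [← e1] at h12
      exact h12
  have hx' : HasType Γ allIntu x ((Ty.all (.lolli (.all Q) (.var 0))).sub fun _ : Fin 1 => A) := by
    rw [coprod_wk0] at hx
    simp only [Q, Ty.sub, Ty.ap_sub]
    exact hx
  have h4 := Prov.interp_all_elim .nil (fun _ => .eqRel A) hx' hx'
    (Prov.interp_eqRel (Θ := Θ) hId _ (fun _ => A) hx') (.graph hκ)
  have hxC : ∀ C : Typ S k, HasType Γ allIntu (.tapp x C)
      ((Ty.lolli (.all Q) (.var 0)).sub (cons C fun _ : Fin 1 => A)) := fun C => by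
    refine .tapp_eq C hx' ?_
    rw [Ty.inst, Ty.sub_sub]
    congr 1; funext i
    exact Fin.cases rfl (fun i => Ty.ren_succ_inst _ _) i
  have h5 := Prov.interp_lolli_elim .nil hE (hxC A) (hxC B) h4 (by rw [hpQ]; exact hp)
    (by rw [hpQ]; exact hq) hqq
  have hxC' : ∀ C : Typ S k, HasType Γ allIntu (.tapp x C) (.lolli (coconeTy ρ C) C) :=
    fun C => by rw [← hpQ]; exact hxC C
  exact (Prov.graph_iff .nil hκ (.app_intu (hxC' A) hp) (.app_intu (hxC' B) hq)).1
    ((Prov.interp_var_iff .nil hE 0 (.app_intu (hxC' A) hp) (.app_intu (hxC' B) hq)).1 h5)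

end Coproduct

/-! ## Finality of `out` -/

section Extensionality

variable {S : Sig.{u, v}} {T : Set (Form S 0 0 0)} {k n m : ℕ}
  {Γ : Fin n → Typ S k} {Θ : Fin m → RelDecl S k} {A B C E : Typ S k} {t s x y : Tm S k n}

theorem PEq.curryTm_beta (ht : HasType Γ allIntu t (.lolli (.tensor A B) E))
    (hx : HasType Γ allIntu x A) (hy : HasType Γ allIntu y B) :
    PEq T Γ Θ [] E (.app (.app (curryTm A B t) x) y) (.app t (.tensor x y)) := by
  have hd : NoLin (allIntu : Fin n → Mode) := noLin_allIntu
  have e1 : (Tm.lam B (.app (t.wk 0 2) (.tensor (.var 1) (.var 0)))).inst x =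
      .lam B (.app (t.wk 0 1) (.tensor (x.wk 0 1) (.var 0))) := by
    simp only [Tm.inst, Tm.sub, Ty.sub_var]
    congr 2
    simp only [Tm.wk, Tm.ren_sub, Tm.ren_eq_sub, Tm.sub_sub]
    rfl
  have e2 : (Tm.app (t.wk 0 1) (.tensor (x.wk 0 1) (.var 0))).inst y = .app t (.tensor x y) := by
    simp only [Tm.inst, Tm.sub, Tm.wk_sub_cons]; rfl
  have h1 := PEq.beta_eq (T := T) (Θ := Θ) .nil (.lam (ht.curry_body hd)) hx e1
  exact (PEq.app .nil h1 (.refl .nil hy)).trans (.ofAx .nil (.app_intu h1.right hy)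
    (.app_intu ht (.tensor_intu hx hy)) (e2 ▸ EqAx.betaTerm _ _ _))

theorem PEq.bang_tensor_ext (hExt : Extensionality T) (hId : IdentityExtension T)
    (ht : HasType Γ allIntu t (.lolli (.tensor (.bang C) B) E))
    (hs : HasType Γ allIntu s (.lolli (.tensor (.bang C) B) E))
    (h : PEq T (cons B (cons C Γ)) Θ [] E (.app (t.wk 0 2) (.tensor (.bang (.var 1)) (.var 0)))
      (.app (s.wk 0 2) (.tensor (.bang (.var 1)) (.var 0)))) :
    PEq T Γ Θ [] (.lolli (.tensor (.bang C) B) E) t s := by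
  have hct := ht.curryTm noLin_allIntu
  have hcs := hs.curryTm noLin_allIntu
  have hv : HasType (cons C Γ) allIntu (Tm.bang (.var 0)) (.bang C) :=
    .bang_intu (.var_intu 0 rfl)
  have hv1 : HasType (cons B (cons C Γ)) allIntu (Tm.bang (.var 1)) (.bang C) :=
    .bang_intu (.var_intu 1 rfl)
  have hv0 : HasType (cons B (cons C Γ)) allIntu (Tm.var 0) B := .var_intu 0 rfl
  refine .of_curryTm hExt ht hs (.bang_ext hExt hId hct hcs (.funext hExt
    (.app_intu (hct.wk_tm C) hv) (.app_intu (hcs.wk_tm C) hv) ?_))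
  have e : ∀ t : Tm S k n, (Tm.app ((curryTm (.bang C) B t).wk 0 1) (.bang (.var 0))).wk 0 1 =
      .app (curryTm (.bang C) B (t.wk 0 2)) (.bang (.var 1)) := by
    intro t
    rw [Tm.wk, Tm.ren, Tm.wk, curryTm_ren, curryTm_ren]
    simp only [up_zero, Ty.ren_id, Tm.ren_ren]; rfl
  rw [e, e]
  exact (PEq.curryTm_beta (ht.wk_tm_two C B) hv1 hv0).trans
    (h.trans (PEq.curryTm_beta (hs.wk_tm_two C B) hv1 hv0).symm)

end Extensionality

section Evaluation

variable {S : Sig.{u, v}} {T : Set (Form S 0 0 0)} {k n m k' n' : ℕ}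
  {Γ : Fin n → Typ S k} {Θ : Fin m → RelDecl S k} {σ ρ : Typ S 1} {A B C : Typ S k}
  {g x y : Tm S k n}

/-- The map `λ°x. x C g : ∐α.ρ ⊸ C`. -/
abbrev coprodElim (ρ : Typ S 1) (C : Typ S k) (g : Tm S k n) : Tm S k n :=
  .lam ((coprod ρ).wk0 k) (.app (.tapp (.var 0) C) (g.wk 0 1))

theorem coprodElim_ren (p : Fin k → Fin k') (q : Fin n → Fin n') :
    (coprodElim ρ C g).ren p q = coprodElim ρ (C.ren p) (g.ren p q) := by
  simp only [coprodElim, Tm.ren, Tm.wk, Tm.ren_ren, Ty.wk0_ren]; rfl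

theorem HasType.coprod_app (hx : HasType Γ allIntu x ((coprod ρ).wk0 k))
    (hg : HasType Γ allIntu g (coconeTy ρ C)) : HasType Γ allIntu (.app (.tapp x C) g) C := by
  rw [coprod_wk0] at hx
  exact .app_intu (.tapp_eq C hx (coprod_inst ρ C)) hg

theorem HasType.coprodElim (hg : HasType Γ allIntu g (coconeTy ρ C)) :
    HasType Γ allIntu (LAPL.coprodElim ρ C g) (.lolli ((coprod ρ).wk0 k) C) := by
  have hd : NoLin (allIntu : Fin n → Mode) := noLin_allIntu
  refine .lam (.app (hd.splits.cons .left) ?_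
    (hg.wk_off (b := 1) hd hd.off (fun _ => rfl) (fun _ => rfl)))
  have := HasType.var_lin_zero (Γ := Γ) hd ((coprod ρ).wk0 k)
  exact .tapp_eq C (by rw [← coprod_wk0]; exact this) (coprod_inst ρ C)

theorem PEq.coprodElim_beta (hx : HasType Γ allIntu x ((coprod ρ).wk0 k))
    (hg : HasType Γ allIntu g (coconeTy ρ C)) :
    PEq T Γ Θ [] C (.app (coprodElim ρ C g) x) (.app (.tapp x C) g) := by
  have e : (Tm.app (.tapp (.var 0) C) (g.wk 0 1)).inst x = .app (.tapp x C) g := by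
    simp only [Tm.inst, Tm.sub, Tm.wk_sub_cons, Ty.sub_var]; rfl
  exact .ofAx .nil (.app_intu (.coprodElim hg) hx) (.coprod_app hx hg) (e ▸ EqAx.betaTerm _ _ _)

theorem HasType.pack_cocone (ρ : Typ S 1) :
    HasType Γ allIntu ((LAPL.pack ρ).wk0 k n) (coconeTy ρ ((coprod ρ).wk0 k)) := by
  have := (HasType.pack ρ).wk0 (Γ := Γ) (k := k) noLin_allIntu
  rw [Ty.wk0, Ty.ren, Ty.ren, Ty.wk0_ren, Ty.ren_eq_ap ρ] at this
  rw [coconeTy, Ty.wk0_ren]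
  exact this

theorem coconeTy_ren (p : Fin k → Fin k') :
    (coconeTy ρ C).ren p = coconeTy ρ (C.ren p) := by
  simp only [coconeTy, Ty.ren, Ty.ap_ren, Ty.ren_ren]; rfl

theorem PEq.coprodElim_pack (hExt : Extensionality T)
    (hg : HasType Γ allIntu g (coconeTy ρ C)) (D : Typ S k) :
    PEq T Γ Θ [] (.lolli (ρ.ap D) C) (.tapp g D)
      (Tm.comp (ρ.ap D) (coprodElim ρ C g) (.tapp ((pack ρ).wk0 k n) D)) := by
  have hpD := HasType.pack_tapp (Γ := Γ) ρ noLin_allIntu D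
  refine .funext hExt (hg.cocone_tapp D) ((HasType.coprodElim hg).comp_intu hpD) ?_
  have hy : HasType (cons (ρ.ap D) Γ) allIntu (Tm.var 0) (ρ.ap D) := .var_intu 0 rfl
  have hg1 := hg.wk_tm (ρ.ap D)
  have hpD1 := HasType.pack_tapp (Γ := cons (ρ.ap D) Γ) ρ noLin_allIntu D
  have e1 : (Tm.tapp g D).wk 0 1 = .tapp (g.wk 0 1) D := by
    simp only [Tm.wk, Tm.ren, up_zero, Ty.ren_id]
  have e2 : (Tm.tapp ((pack ρ).wk0 k n) D).wk 0 1 = .tapp ((pack ρ).wk0 k (n + 1)) D := by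
    simp only [Tm.wk, Tm.ren, up_zero, Ty.ren_id, Tm.wk0_ren]; rfl
  have e3 : (coprodElim ρ C g).wk 0 1 = coprodElim ρ C (g.wk 0 1) := by
    rw [Tm.wk, coprodElim_ren, up_zero, Ty.ren_id]; rfl
  rw [Tm.comp_wk, e1, e2, e3]
  exact ((PEq.beta_comp .nil (.coprodElim hg1) hpD1 hy).trans
    ((PEq.coprodElim_beta (.app_intu hpD1 hy) hg1).trans (.pack_beta hy hg1))).symm

theorem PEq.coprod_pack_app (hId : IdentityExtension T) (hExt : Extensionality T)
    (hx : HasType Γ allIntu x ((coprod ρ).wk0 k)) (hg : HasType Γ allIntu g (coconeTy ρ C)) :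
    PEq T Γ Θ [] C (.app (.tapp
      (.app (.tapp x ((coprod ρ).wk0 k)) ((pack ρ).wk0 k n)) C) g) (.app (.tapp x C) g) := by
  have hp := HasType.pack_cocone (Γ := Γ) (k := k) ρ
  refine (PEq.coprodElim_beta (.coprod_app hx hp) hg).symm.trans
    (.coprod_natural hId hp hg (.coprodElim hg) hx ?_)
  have hg1 := hg.wk_ty
  rw [coconeTy_ren] at hg1
  have e : ((pack ρ).wk0 k n).wk 1 0 = (pack ρ).wk0 (k + 1) n := Tm.wk0_ren ..
  have e' : (coprodElim ρ C g).wk 1 0 = coprodElim ρ (C.ren (up 1)) (g.wk 1 0) :=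
    coprodElim_ren ..
  rw [e, e']
  exact .coprodElim_pack hExt hg1 (.var 0)

theorem PEq.coprod_pack (hId : IdentityExtension T) (hExt : Extensionality T)
    (hx : HasType Γ allIntu x ((coprod ρ).wk0 k)) :
    PEq T Γ Θ [] ((coprod ρ).wk0 k) (.app (.tapp x ((coprod ρ).wk0 k)) ((pack ρ).wk0 k n)) x := by
  have hxp := HasType.coprod_app hx (.pack_cocone ρ)
  have hx1 := hx.wk_ty
  rw [Ty.wk0_ren] at hx1
  have hg : HasType (cons (coconeTy ρ (.var 0)) (wkCx Γ 1)) allIntu (Tm.var 0)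
    (coconeTy ρ (.var 0)) := .var_intu 0 rfl
  have h := PEq.coprod_pack_app (T := T) (Θ := wkRCx Θ 1) hId hExt
    (hx1.wk_tm (coconeTy ρ (.var 0))) hg
  have e : ((Tm.tapp ((Tm.app (.tapp x ((coprod ρ).wk0 k)) ((pack ρ).wk0 k n)).wk 1 0)
      (.var 0)).wk 0 1) = .tapp (.app (.tapp ((x.wk 1 0).wk 0 1) ((coprod ρ).wk0 (k + 1)))
        ((pack ρ).wk0 (k + 1) (n + 1))) (.var 0) := by
    simp only [Tm.wk, Tm.ren, Tm.wk0_ren, Ty.wk0_ren]; rfl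
  have ht : ∀ {t : Tm S k n}, HasType Γ allIntu t ((coprod ρ).wk0 k) →
      HasType (wkCx Γ 1) allIntu (.tapp (t.wk 1 0) (.var 0))
        (.lolli (coconeTy ρ (.var 0)) (.var 0)) := fun ht => by
    have := ht.wk_ty
    rw [Ty.wk0_ren, coprod_wk0] at this
    exact .tapp_eq _ this (coprod_inst ρ _)
  have h' := PEq.funext hExt (ht hxp) (ht hx) (by rw [e]; exact h)
  rw [coprod_wk0] at hx hxp ⊢
  rw [coprod_wk0] at h'
  exact .tyext hExt hxp hx h'

end Evaluation

section Final

variable {S : Sig.{u, v}} {T : Set (Form S 0 0 0)} {k n m : ℕ}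
  {Γ : Fin n → Typ S k} {Θ : Fin m → RelDecl S k} {σ : Typ S 1} {A : Typ S k}
  {f h x : Tm S k n}

theorem PEq.unf_out_pack (hExt : Extensionality T) (hId : IdentityExtension T)
    (hPos : σ.OnlyPositive 0) (D : Typ S k) :
    PEq T Γ Θ [] (.lolli ((coalgTy σ).ap D) ((nu σ).wk0 k))
      (.tapp ((pack (coalgTy σ)).wk0 k n) D)
      (Tm.comp ((coalgTy σ).ap D) (unf σ ((nu σ).wk0 k) ((out σ).wk0 k n))
        (.tapp ((pack (coalgTy σ)).wk0 k n) D)) := by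
  have ho : ∀ {n : ℕ} {Γ : Fin n → Typ S k}, HasType Γ allIntu _ _ :=
    fun {n Γ} => HasType.out_wk0 (Γ := Γ) (k := k) hPos noLin_allIntu
  have hpD : ∀ {n : ℕ} {Γ : Fin n → Typ S k}, HasType Γ allIntu _ _ :=
    fun {n Γ} => HasType.pack_tapp (Γ := Γ) (coalgTy σ) noLin_allIntu D
  refine .bang_tensor_ext hExt hId hpD
    (HasType.comp_intu (.unf noLin_allIntu ho) hpD) ?_
  have e1 : (Tm.tapp ((pack (coalgTy σ)).wk0 k n) D).wk 0 2 =
      .tapp ((pack (coalgTy σ)).wk0 k (n + 2)) D := by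
    simp only [Tm.wk, Tm.ren, up_zero, Ty.ren_id, Tm.wk0_ren]; rfl
  have e2 : ((out σ).wk0 k n).wk 0 2 = (out σ).wk0 k (n + 2) := Tm.wk0_ren ..
  rw [Tm.comp_wk, unf_wk, e1, e2]
  have hf : HasType (cons D (cons (.lolli D (σ.ap D)) Γ)) allIntu (Tm.var 1)
    (.lolli D (σ.ap D)) := .var_intu 1 rfl
  have hx : HasType (cons D (cons (.lolli D (σ.ap D)) Γ)) allIntu (Tm.var 0) D := .var_intu 0 rfl
  have hu := PEq.unfold_beta (T := T) (Θ := Θ) hf hx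
  have hn := PEq.unf_natural hExt hId hPos hf ho (.unf noLin_allIntu hf)
    (PEq.out_unf (Θ := Θ) hExt hPos hf) hx
  have hU := HasType.unf noLin_allIntu (ho (Γ := cons D (cons (.lolli D (σ.ap D)) Γ)))
  exact hu.symm.trans (hn.trans ((PEq.app .nil (.refl .nil hU) hu).trans
    (PEq.beta_comp .nil hU hpD (.tensor_intu hf.bang_intu hx)).symm))

/-- The map from `out` to itself is the identity. -/
theorem PEq.unf_out (hExt : Extensionality T) (hId : IdentityExtension T)
    (hPos : σ.OnlyPositive 0) (hx : HasType Γ allIntu x ((nu σ).wk0 k)) :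
    PEq T Γ Θ [] ((nu σ).wk0 k) (.app (unf σ ((nu σ).wk0 k) ((out σ).wk0 k n)) x) x := by
  have hp := HasType.pack_cocone (Γ := Γ) (k := k) (coalgTy σ)
  have ho := HasType.out_wk0 (Γ := Γ) (k := k) hPos noLin_allIntu
  have hu := HasType.unf noLin_allIntu ho
  have hx1 := PEq.coprod_pack (Θ := Θ) hId hExt hx
  refine (PEq.app .nil (.refl .nil hu) hx1.symm).trans (.trans ?_ hx1)
  refine .coprod_natural hId hp hp hu hx ?_
  have e1 : ((pack (coalgTy σ)).wk0 k n).wk 1 0 = (pack (coalgTy σ)).wk0 (k + 1) n :=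
    Tm.wk0_ren ..
  have e2 : (unf σ ((nu σ).wk0 k) ((out σ).wk0 k n)).wk 1 0 =
      unf σ ((nu σ).wk0 (k + 1)) ((out σ).wk0 (k + 1) n) := by
    simp only [unf, Tm.wk, Tm.ren, Tm.wk0_ren, Ty.wk0_ren]; rfl
  have h := PEq.unf_out_pack (T := T) (Γ := wkCx Γ 1) (Θ := wkRCx Θ 1) hExt hId hPos (.var 0)
  rw [e1, e2, Ty.wk0_ren]
  exact h

/-- Maps of coalgebras to `out` are unique. -/
theorem PEq.coalgMap_unique (hExt : Extensionality T) (hId : IdentityExtension T)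
    (hPos : σ.OnlyPositive 0) (hf : HasType Γ allIntu f (.lolli A (σ.ap A)))
    (hh : HasType Γ allIntu h (.lolli A ((nu σ).wk0 k)))
    (hc : PEq T Γ Θ [] (.lolli A (σ.ap ((nu σ).wk0 k))) (Tm.comp A ((out σ).wk0 k n) h)
      (Tm.comp A (fmap σ A ((nu σ).wk0 k) h) f)) :
    PEq T Γ Θ [] (.lolli A ((nu σ).wk0 k)) h (unf σ A f) := by
  have hc1 := hc.wk_tm A
  rw [Tm.comp_wk, Tm.comp_wk, fmap_wk, Tm.wk, Tm.wk0_ren] at hc1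
  have hv : HasType (cons A Γ) allIntu (Tm.var 0) A := .var_intu 0 rfl
  have ho := HasType.out_wk0 (Γ := cons A Γ) (k := k) hPos noLin_allIntu
  have h1 := PEq.unf_natural hExt hId hPos (hf.wk_tm A) ho (hh.wk_tm A) hc1 hv
  have h2 := h1.trans (.unf_out hExt hId hPos (.app_intu (hh.wk_tm A) hv))
  rw [← unf_wk] at h2
  exact .funext hExt hh (.unf noLin_allIntu hf) h2.symm

end Final

end LAPL

theorem mainTheorem8 {S : LAPL.Sig} (T : Set (LAPL.Form S 0 0 0))
    (hExt : LAPL.Extensionality T) (hId : LAPL.IdentityExtension T)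
    (σ : LAPL.Typ S 1) (hInd : σ.IsInductive) (hPos : σ.OnlyPositive 0) (k : ℕ) :
    LAPL.IsFinalCoalg T σ ((LAPL.nu σ).wk0 k) ((LAPL.out σ).wk0 k 0) ∧
    ∀ (τ : LAPL.Typ S k) (f : LAPL.Tm S k 0), LAPL.IsMap τ (σ.ap τ) f →
      LAPL.IsCoalgMap T σ τ ((LAPL.nu σ).wk0 k) f ((LAPL.out σ).wk0 k 0)
        (LAPL.unfoldAt σ τ f) ∧
      ∀ h : LAPL.Tm S k 0,
        LAPL.IsCoalgMap T σ τ ((LAPL.nu σ).wk0 k) f ((LAPL.out σ).wk0 k 0) h →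
        LAPL.MapEq T τ ((LAPL.nu σ).wk0 k) h (LAPL.unfoldAt σ τ f) := by
  have key : ∀ (τ : LAPL.Typ S k) (f : LAPL.Tm S k 0), LAPL.IsMap τ (σ.ap τ) f →
      LAPL.IsCoalgMap T σ τ ((LAPL.nu σ).wk0 k) f ((LAPL.out σ).wk0 k 0)
        (LAPL.unfoldAt σ τ f) ∧
      ∀ h : LAPL.Tm S k 0,
        LAPL.IsCoalgMap T σ τ ((LAPL.nu σ).wk0 k) f ((LAPL.out σ).wk0 k 0) h →
        LAPL.MapEq T τ ((LAPL.nu σ).wk0 k) h (LAPL.unfoldAt σ τ f) := by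
    intro τ f hf
    have hf' : LAPL.HasType LAPL.nil LAPL.allIntu f (.lolli τ (σ.ap τ)) := hf
    refine ⟨⟨.unf LAPL.noLin_allIntu hf', (LAPL.PEq.out_unf hExt hPos hf').prov⟩, ?_⟩
    rintro h ⟨hh, hc⟩
    have hh' : LAPL.HasType LAPL.nil LAPL.allIntu h (.lolli τ ((LAPL.nu σ).wk0 k)) := hh
    exact (LAPL.PEq.coalgMap_unique hExt hId hPos hf' hh'
      ⟨(LAPL.HasType.out_wk0 hPos LAPL.noLin_allIntu).comp_intu hh',
        (LAPL.HasType.fmap hPos LAPL.noLin_allIntu hh').comp_intu hf', hc⟩).prov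
  exact ⟨⟨.out_wk0 hPos LAPL.noLin_allIntu, fun τ f hf => ⟨_, key τ f hf⟩⟩, key⟩
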